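/- **Conventions.** Let $p$ be a prime number. For a field $K$ of characteristic $p$ and $j\in\mathbb Z$, let $\Omega^j_K=\Lambda^j_K\,\Omega^1_{K/\mathbb Z}$ be the group of absolute differential forms ($\Omega^j_K=0$ for $j<0$), let $d$ be the exterior derivative, and let $Z^j_K=\ker(d\colon\Omega^j_K\to\Omega^{j+1}_K)$ be the subgroup of closed forms. Let $H^{j+1,j}(K)$ be the mod $p$ étale motivic cohomology group $H^{j+1}_{\mathrm{et}}(K,\mathbb Z/p(j))$ in Kato's description, i.e. the cokernel of the homomorphism $\mathcal P\colon\Omega^j_K\to\Omega^j_K/d\Omega^{j-1}_K$ given by $$\mathcal P\Big(a\,\tfrac{db_1}{b_1}\wedge\cdots\wedge\tfrac{db_j}{b_j}\Big)=(a^p-a)\,\tfrac{db_1}{b_1}\wedge\cdots\wedge\tfrac{db_j}{b_j}\qquad(a\in K,\ b_i\in K^*).$$ Write $[a,b_1,\ldots,b_j\}\in H^{j+1,j}(K)$ for the class of $a\,\frac{db_1}{b_1}\wedge\cdots\wedge\frac{db_j}{b_j}$. Let $F$ be a field of characteristic $p$ with a normalized discrete valuation $v\colon F^*\twoheadrightarrow\mathbb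 Z$, valuation ring $O_F$, residue field $k$, and residue map $a\mapsto\bar a$, and let $n\ge 0$ be an integer. For $i\ge0$ let $U_i\subset H^{n+1,n}(F)$ be the subgroup generated by the symbols $[f,g_1,\ldots,g_n\}$ with $f\in F$, $v(f)\ge -i$ and $g_1,\ldots,g_n\in F^*$. Let $H^{n+1,n}_{\mathrm{nr}}(F)$ be the subgroup generated by the symbols $[a,b_1,\ldots,b_n\}$ with $a\in O_F$ and $b_1,\ldots,b_n\in O_F^*$. Let $F_v$ be the completion of $F$, and let $F_{\mathrm{tame}}$ be the maximal tamely ramified extension of $F_v$, i.e. the compositum, in an algebraic closure, of all finite extensions of $F_v$ whose residue field extension is separable and whose ramification index is prime to $p$. Let $H^{n+1,n}_{\mathrm{tame}}(F)$ be the inverse image of $\ker\big(H^{n+1,n}(F_v)\to H^{n+1,n}(F_{\mathrm{tame}})\big)$ under $H^{n+1,n}(F)\to H^{n+1,n}(F_v)$. **Theorem.** 1. $U_0\subset U_1\subset\cdots$ and $\bigcup_{i\ge0}U_i=H^{n+1,n}(F)$. 2. Let $t$ be a uniformizer of $F$ and let $i>0$. - If $p\nmid i$, there is an isomorphism $\Omega^n_k\cong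 U_i/U_{i-1}$ with $$\bar a\,\tfrac{d\bar b_1}{\bar b_1}\wedge\cdots\wedge\tfrac{d\bar b_n}{\bar b_n}\mapsto[a t^{-i},b_1,\ldots,b_n\}\pmod{U_{i-1}}$$ for all $a\in O_F$ and $b_1,\ldots,b_n\in O_F^*$. - If $p\mid i$, there is an isomorphism $\Omega^n_k/Z^n_k\oplus\Omega^{n-1}_k/Z^{n-1}_k\cong U_i/U_{i-1}$ which is given on the first summand by the same formula, and on the second summand (for $n\geq 1$) by $$\bar a\,\tfrac{d\bar b_1}{\bar b_1}\wedge\cdots\wedge\tfrac{d\bar b_{n-1}}{\bar b_{n-1}}\mapsto[a t^{-i},t,b_1,\ldots,b_{n-1}\}\pmod{U_{i-1}}$$ for all $a\in O_F$ and $b_1,\ldots,b_{n-1}\in O_F^*$. 3. $U_0=H^{n+1,n}_{\mathrm{tame}}(F)$ and $H^{n+1,n}_{\mathrm{nr}}(F)\subset H^{n+1,n}_{\mathrm{tame}}(F)$. There is a unique homomorphism (the residue) $\partial_v\colon H^{n+1,n}_{\mathrm{tame}}(F)\to H^{n,n-1}(k)$ such that $\partial_v[a,b_1,\ldots,b_n\}=0$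 for all $a\in O_F$, $b_1,\ldots,b_n\in O_F^*$ and, if $n\ge1$, $\partial_v[a,t,b_1,\ldots,b_{n-1}\}=[\bar a,\bar b_1,\ldots,\bar b_{n-1}\}$ for all uniformizers $t$, all $a\in O_F$ and all $b_1,\ldots,b_{n-1}\in O_F^*$. The sequence $$0\to H^{n+1,n}_{\mathrm{nr}}(F)\to H^{n+1,n}_{\mathrm{tame}}(F)\xrightarrow{\ \partial_v\ }H^{n,n-1}(k)\to0$$ is exact. 4. If $O_F$ is henselian, there is an isomorphism $H^{n+1,n}(k)\cong H^{n+1,n}_{\mathrm{nr}}(F)$ with $[\bar a,\bar b_1,\ldots,\bar b_n\}\mapsto[a,b_1,\ldots,b_n\}$ for all $a\in O_F$ and $b_1,\ldots,b_n\in O_F^*$. -/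

import Mathlib

open scoped KaehlerDifferential WithZero

noncomputable section

namespace ModPCohomology

universe u w

/-! ### Absolute differential forms and the exterior derivative -/

section Forms

variable (A : Type u) [CommRing A]

/-- The algebra of absolute differential forms: the exterior algebra over `A` of the module of
absolute Kähler differentials of `A`. -/
abbrev DiffAlg : Type u := ExteriorAlgebra A Ω[A⁄ℤ]

/-- The absolute differential forms of degree `j`; they vanish for `j < 0`. -/
def Forms : ℤ → Submodule A (DiffAlg A)
  | Int.ofNat n => ⋀[A]^n Ω[A⁄ℤ]
  | Int.negSucc _ => ⊥

/-- A copy of the algebra of forms, seen as a bimodule over that algebra: the right action is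
multiplication and the left action is multiplication twisted by the sign `(-1) ^ deg`. -/
def Twist : Type u := DiffAlg A

instance : AddCommGroup (Twist A) := inferInstanceAs (AddCommGroup (DiffAlg A))

instance : Module (DiffAlg A) (Twist A) :=
  Module.compHom (DiffAlg A)
    (CliffordAlgebra.involute (Q := (0 : QuadraticForm A Ω[A⁄ℤ]))).toRingHom

instance : Module (DiffAlg A)ᵐᵒᵖ (Twist A) :=
  inferInstanceAs (Module (DiffAlg A)ᵐᵒᵖ (DiffAlg A))

instance : SMulCommClass (DiffAlg A) (DiffAlg A)ᵐᵒᵖ (Twist A) where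
  smul_comm a b x := (mul_assoc (CliffordAlgebra.involute a) (x : DiffAlg A) b.unop).symm

/-- The ring of pairs `(x, y)` with `(x, y) (x', y') = (x x', (-1) ^ deg x * x y' + y x')`. -/
abbrev Pairs : Type u := TrivSqZeroExt (DiffAlg A) (Twist A)

variable {A}

/-- The pair `(x, y)`. -/
def pair (x y : DiffAlg A) : Pairs A :=
  TrivSqZeroExt.inl x + TrivSqZeroExt.inr (show Twist A from y)

/-- The second component of a pair. -/
def second (z : Pairs A) : DiffAlg A := TrivSqZeroExt.snd z

@[simp] theorem fst_pair (x y : DiffAlg A) : (pair x y).fst = x := add_zero x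

@[simp] theorem second_pair (x y : DiffAlg A) : second (pair x y) = y := zero_add y

theorem pair_ext {z z' : Pairs A} (h : z.fst = z'.fst) (h' : second z = second z') : z = z' :=
  TrivSqZeroExt.ext h h'

@[simp] theorem second_add (z z' : Pairs A) : second (z + z') = second z + second z' := rfl

@[simp] theorem second_zero : second (0 : Pairs A) = 0 := rfl

@[simp] theorem second_one : second (1 : Pairs A) = 0 := rfl

@[simp] theorem second_mul (z z' : Pairs A) :
    second (z * z') = CliffordAlgebra.involute z.fst * second z' + second z * z'.fst := rfl

/-- The class in the algebra of forms of the differential of `a`. -/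
def dd (a : A) : DiffAlg A := ExteriorAlgebra.ι A (KaehlerDifferential.D ℤ A a)

theorem involute_mul_dd (a : A) (x : DiffAlg A) :
    CliffordAlgebra.involute x * dd a = dd a * x := by
  induction x using ExteriorAlgebra.induction with
  | algebraMap r => simp [Algebra.commutes]
  | ι m =>
    rw [CliffordAlgebra.involute_ι, neg_mul, neg_eq_iff_add_eq_zero, dd]
    exact ExteriorAlgebra.ι_add_mul_swap _ _
  | mul x y hx hy => rw [map_mul, mul_assoc, hy, ← mul_assoc, hx, mul_assoc]
  | add x y hx hy => rw [map_add, add_mul, hx, hy, mul_add]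

theorem dd_mul_swap (a b : A) : dd a * dd b + dd b * dd a = 0 :=
  ExteriorAlgebra.ι_add_mul_swap _ _

variable (A) in
/-- The ring homomorphism `a ↦ (a, da)`. -/
def pairsAlgebraMap : A →+* Pairs A where
  toFun a := pair (algebraMap A _ a) (dd a)
  map_one' := pair_ext (by simp) (by simp [dd])
  map_zero' := pair_ext (by simp) (by simp [dd])
  map_add' a b := pair_ext (by simp) (by simp [dd])
  map_mul' a b := pair_ext (by simp) (by
    rw [second_mul, fst_pair, fst_pair, second_pair, second_pair, second_pair, AlgHom.commutes,
      ← Algebra.commutes b, ← Algebra.smul_def, ← Algebra.smul_def]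
    simp [dd])

theorem pairsAlgebraMap_apply (a : A) :
    pairsAlgebraMap A a = pair (algebraMap A _ a) (dd a) := rfl

instance : Algebra A (Pairs A) :=
  (pairsAlgebraMap A).toAlgebra' fun a z => pair_ext
    (by simp only [pairsAlgebraMap_apply, TrivSqZeroExt.fst_mul, fst_pair, Algebra.commutes])
    (by
      simp only [pairsAlgebraMap_apply, second_mul, fst_pair, second_pair, involute_mul_dd,
        AlgHom.commutes]
      rw [Algebra.commutes, add_comm])

theorem pairs_smul_def (a : A) (z : Pairs A) :
    a • z = pair (algebraMap A _ a) (dd a) * z := rfl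

variable (A) in
/-- The derivation `a ↦ (da, 0)` with values in the pairs. -/
def pairsDer : Derivation ℤ A (Pairs A) :=
  Derivation.mk' (AddMonoidHom.toIntLinearMap
    { toFun := fun a => pair (dd a) 0
      map_zero' := pair_ext (by simp [dd]) (by simp)
      map_add' := fun a b => pair_ext (by simp [dd]) (by simp) })
    fun a b => by
      simp only [pairs_smul_def]
      exact pair_ext (by simp [dd, Algebra.smul_def])
        (by simpa using (dd_mul_swap a b).symm)

theorem pairsDer_apply (a : A) : pairsDer A a = pair (dd a) 0 := rfl

theorem pairsDer_lift_swap (x y : Ω[A⁄ℤ]) :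
    (pairsDer A).liftKaehlerDifferential x * (pairsDer A).liftKaehlerDifferential y +
      (pairsDer A).liftKaehlerDifferential y * (pairsDer A).liftKaehlerDifferential x = 0 := by
  have hx : x ∈ Submodule.span A (Set.range (KaehlerDifferential.D ℤ A)) := by
    rw [KaehlerDifferential.span_range_derivation]; trivial
  have hy : y ∈ Submodule.span A (Set.range (KaehlerDifferential.D ℤ A)) := by
    rw [KaehlerDifferential.span_range_derivation]; trivial
  induction hx using Submodule.span_induction with
  | zero => simp
  | add x x' _ _ h h' =>
    rw [map_add, add_mul, mul_add, add_add_add_comm, h, h', add_zero]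
  | smul a x _ h => rw [map_smul, smul_mul_assoc, mul_smul_comm, ← smul_add, h, smul_zero]
  | mem x hx =>
    obtain ⟨a, rfl⟩ := hx
    induction hy using Submodule.span_induction with
    | zero => simp
    | add x x' _ _ h h' =>
      rw [map_add, add_mul, mul_add, add_add_add_comm, h, h', add_zero]
    | smul a x _ h => rw [map_smul, smul_mul_assoc, mul_smul_comm, ← smul_add, h, smul_zero]
    | mem y hy =>
      obtain ⟨b, rfl⟩ := hy
      simp only [Derivation.liftKaehlerDifferential_comp_D, pairsDer_apply]
      exact pair_ext (by simpa using dd_mul_swap a b) (by simp)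

theorem pairsDer_lift_sq (x : Ω[A⁄ℤ]) :
    (pairsDer A).liftKaehlerDifferential x * (pairsDer A).liftKaehlerDifferential x = 0 := by
  have hx : x ∈ Submodule.span A (Set.range (KaehlerDifferential.D ℤ A)) := by
    rw [KaehlerDifferential.span_range_derivation]; trivial
  induction hx using Submodule.span_induction with
  | zero => simp
  | add x y _ _ hx hy =>
    rw [map_add, mul_add, add_mul, add_mul, hx, hy, zero_add, add_zero, add_comm]
    exact pairsDer_lift_swap x y
  | smul a x _ h => rw [map_smul, smul_mul_assoc, mul_smul_comm, h, smul_zero, smul_zero]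
  | mem x hx =>
    obtain ⟨a, rfl⟩ := hx
    simp only [Derivation.liftKaehlerDifferential_comp_D, pairsDer_apply]
    exact pair_ext (by simp [dd]) (by simp)

variable (A) in
/-- The ring homomorphism `ω ↦ (ω, dω)`. -/
def toPairs : DiffAlg A →ₐ[A] Pairs A :=
  ExteriorAlgebra.lift A ⟨(pairsDer A).liftKaehlerDifferential, pairsDer_lift_sq⟩

variable (A) in
/-- The exterior derivative on absolute differential forms. It is the additive map with
`d a` the Kähler differential of `a`, `d (d a) = 0`, and
`d (x y) = d x * y + (-1) ^ deg x * x * d y`. -/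
def extD : DiffAlg A →+ DiffAlg A where
  toFun x := second (toPairs A x)
  map_zero' := by simp
  map_add' x y := by simp

theorem extD_algebraMap (a : A) : extD A (algebraMap A _ a) = dd a := by
  have : toPairs A (algebraMap A _ a) = pair (algebraMap A _ a) (dd a) :=
    (toPairs A).commutes a
  simp [extD, this]

theorem toPairs_dd (a : A) : toPairs A (dd a) = pair (dd a) 0 := by
  simp [toPairs, dd, pairsDer_apply]

theorem extD_dd (a : A) : extD A (dd a) = 0 := by
  simp [extD, toPairs_dd]

variable (A) in
/-- The algebra of forms is generated by the elements `a` and `da`. -/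
theorem diffAlg_induction {C : DiffAlg A → Prop}
    (algebraMap : ∀ a : A, C (algebraMap A _ a)) (der : ∀ a : A, C (dd a))
    (mul : ∀ x y, C x → C y → C (x * y)) (add : ∀ x y, C x → C y → C (x + y))
    (x : DiffAlg A) : C x := by
  induction x using ExteriorAlgebra.induction with
  | algebraMap r => exact algebraMap r
  | mul x y hx hy => exact mul x y hx hy
  | add x y hx hy => exact add x y hx hy
  | ι x =>
    have hx : x ∈ Submodule.span A (Set.range (KaehlerDifferential.D ℤ A)) := by
      rw [KaehlerDifferential.span_range_derivation]; trivial
    induction hx using Submodule.span_induction with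
    | zero => simpa using algebraMap 0
    | add x y _ _ hx hy => rw [map_add]; exact add _ _ hx hy
    | smul a x _ h => rw [map_smul, Algebra.smul_def]; exact mul _ _ (algebraMap a) h
    | mem x hx => obtain ⟨a, rfl⟩ := hx; exact der a

theorem fst_toPairs (x : DiffAlg A) : (toPairs A x).fst = x := by
  induction x using diffAlg_induction with
  | algebraMap a =>
    have : toPairs A (algebraMap A _ a) = pair (algebraMap A _ a) (dd a) :=
      (toPairs A).commutes a
    simp [this]
  | der a => simp [toPairs_dd]
  | mul x y hx hy => rw [map_mul, TrivSqZeroExt.fst_mul, hx, hy]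
  | add x y hx hy => rw [map_add, TrivSqZeroExt.fst_add, hx, hy]

theorem extD_mul (x y : DiffAlg A) :
    extD A (x * y) = extD A x * y + CliffordAlgebra.involute x * extD A y := by
  simp only [extD, AddMonoidHom.coe_mk, ZeroHom.coe_mk, map_mul, second_mul, fst_toPairs]
  rw [add_comm]

end Forms

/-! ### Functoriality of differential forms -/

section Functoriality

variable (A : Type u) (B : Type w) [CommRing A] [CommRing B] [Algebra A B]

/-- The pullback of differential forms along an algebra `A → B`. -/
def formMap : DiffAlg A →ₐ[A] DiffAlg B :=
  ExteriorAlgebra.lift A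
    ⟨((ExteriorAlgebra.ι B).restrictScalars A).comp (KaehlerDifferential.map ℤ ℤ A B),
      fun _ => ExteriorAlgebra.ι_sq_zero _⟩

theorem formMap_ι (x : Ω[A⁄ℤ]) : formMap A B (ExteriorAlgebra.ι A x) =
    ExteriorAlgebra.ι B (KaehlerDifferential.map ℤ ℤ A B x) :=
  ExteriorAlgebra.lift_ι_apply A _ _ x

theorem formMap_algebraMap (a : A) :
    formMap A B (algebraMap A _ a) = algebraMap B _ (algebraMap A B a) :=
  ((formMap A B).commutes a).trans (IsScalarTower.algebraMap_apply A B (DiffAlg B) a)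

theorem formMap_dd (a : A) : formMap A B (dd a) = dd (algebraMap A B a) := by
  rw [dd, formMap_ι, KaehlerDifferential.map_D, dd]

theorem involute_formMap (x : DiffAlg A) :
    CliffordAlgebra.involute (formMap A B x) = formMap A B (CliffordAlgebra.involute x) := by
  induction x using diffAlg_induction with
  | algebraMap a => rw [formMap_algebraMap, AlgHom.commutes, AlgHom.commutes, formMap_algebraMap]
  | der a =>
    rw [formMap_dd, dd, dd, CliffordAlgebra.involute_ι, CliffordAlgebra.involute_ι, map_neg,
      ← dd, ← dd, formMap_dd]
  | mul x y hx hy => simp only [map_mul, hx, hy]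
  | add x y hx hy => simp only [map_add, hx, hy]

theorem extD_formMap (x : DiffAlg A) : extD B (formMap A B x) = formMap A B (extD A x) := by
  induction x using diffAlg_induction with
  | algebraMap a => rw [formMap_algebraMap, extD_algebraMap, extD_algebraMap, formMap_dd]
  | der a => rw [formMap_dd, extD_dd, extD_dd, map_zero]
  | mul x y hx hy => simp only [map_mul, map_add, extD_mul, hx, hy, involute_formMap]
  | add x y hx hy => simp only [map_add, hx, hy]

theorem formMap_mem {j : ℤ} {x : DiffAlg A} (hx : x ∈ Forms A j) :
    formMap A B x ∈ Forms B j := by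
  match j, hx with
  | Int.negSucc _, hx =>
    obtain rfl : x = 0 := hx
    simp
  | Int.ofNat n, hx =>
    replace hx : x ∈ ⋀[A]^n Ω[A⁄ℤ] := hx
    change _ ∈ ⋀[B]^n Ω[B⁄ℤ]
    clear * - hx
    induction hx using Submodule.pow_induction_on_left' with
    | algebraMap r =>
      rw [formMap_algebraMap, ExteriorAlgebra.exteriorPower, pow_zero]
      exact Submodule.algebraMap_mem _
    | add x y i _ _ hx hy => rw [map_add]; exact add_mem hx hy
    | mem_mul m hm i x _ hx =>
      obtain ⟨y, rfl⟩ := hm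
      rw [map_mul, formMap_ι, ExteriorAlgebra.exteriorPower, pow_succ']
      exact Submodule.mul_mem_mul ⟨_, rfl⟩ hx

end Functoriality

/-! ### The groups `H^{j+1,j}` -/

section Cohomology

variable {A : Type u} [CommRing A]

/-- The logarithmic differential `db / b` of a unit. -/
def dlog (b : Aˣ) : Ω[A⁄ℤ] := (↑b⁻¹ : A) • KaehlerDifferential.D ℤ A b

theorem cast_succ {m n : ℕ} (hm : m + 1 = n) : ((m + 1 : ℕ) : ℤ) = (n : ℤ) := by omega

theorem cast_pred {m n : ℕ} (hm : m + 1 = n) : (m : ℤ) = (n : ℤ) - 1 := by omega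

/-- The form `a (db₁ / b₁) ∧ ⋯ ∧ (dbₘ / bₘ)`, of degree `j = m`. -/
def logForm {m : ℕ} {j : ℤ} (hm : (m : ℤ) = j) (a : A) (b : Fin m → Aˣ) : Forms A j :=
  ⟨a • ExteriorAlgebra.ιMulti A m (fun i => dlog (b i)), by
    subst hm
    exact Submodule.smul_mem _ _ (ExteriorAlgebra.ιMulti_range A m (Set.mem_range_self _))⟩

theorem formMap_logForm (B : Type w) [CommRing B] [Algebra A B] {m : ℕ} {j : ℤ}
    (hm : (m : ℤ) = j) (a : A) (b : Fin m → Aˣ) :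
    formMap A B (logForm hm a b : DiffAlg A) =
      logForm hm (algebraMap A B a) (fun i => Units.map (algebraMap A B : A →* B) (b i)) := by
  have h (b : Aˣ) : formMap A B (ExteriorAlgebra.ι A (dlog b)) =
      ExteriorAlgebra.ι B (dlog (Units.map (algebraMap A B : A →* B) b)) := by
    rw [formMap_ι, dlog, dlog, map_smul, KaehlerDifferential.map_D, ← algebraMap_smul B]
    rfl
  simp only [logForm, Algebra.smul_def, map_mul, formMap_algebraMap,
    ExteriorAlgebra.ιMulti_apply, map_list_prod, List.map_ofFn]
  congr 3
  funext i
  exact h (b i)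

variable (A) in
/-- The subgroup `Z^j` of closed forms of degree `j`. -/
def closedForms (j : ℤ) : AddSubgroup (Forms A j) :=
  ((extD A).comp (Forms A j).subtype.toAddMonoidHom).ker

variable (p : ℕ)

variable (A) in
/-- The subgroup of forms of degree `j` generated by the exact forms `dη` (with `η` of degree
`j - 1`) and by the forms `(a ^ p - a) (db₁ / b₁) ∧ ⋯ ∧ (dbⱼ / bⱼ)`. -/
def relations (j : ℤ) : AddSubgroup (Forms A j) :=
  AddSubgroup.closure
    ({x | ∃ η ∈ Forms A (j - 1), extD A η = x} ∪
      {x | ∃ (m : ℕ) (hm : (m : ℤ) = j) (a : A) (b : Fin m → Aˣ),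
        x = logForm hm (a ^ p - a) b})

variable (A) in
/-- The group `H^{j+1,j}` of a field `A` of characteristic `p`: the cokernel of the homomorphism
`𝒫 : Ω^j → Ω^j / dΩ^{j-1}` with
`𝒫 (a (db₁ / b₁) ∧ ⋯ ∧ (dbⱼ / bⱼ)) = (a ^ p - a) (db₁ / b₁) ∧ ⋯ ∧ (dbⱼ / bⱼ)`.
As `Ω^j` is generated by the forms `a (db₁ / b₁) ∧ ⋯ ∧ (dbⱼ / bⱼ)`, this cokernel is the quotient
of `Ω^j` by the subgroup `relations`. -/
abbrev H (j : ℤ) : Type u := Forms A j ⧸ relations A p j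

/-- The symbol `[a, b₁, …, bₘ}`: the class of the form `a (db₁ / b₁) ∧ ⋯ ∧ (dbₘ / bₘ)`. -/
def symb {m : ℕ} {j : ℤ} (hm : (m : ℤ) = j) (a : A) (b : Fin m → Aˣ) : H A p j :=
  QuotientAddGroup.mk (logForm hm a b)

variable (A) in
/-- Pullback of forms of degree `j` along an algebra `A → B`. -/
def formMapDeg (B : Type w) [CommRing B] [Algebra A B] (j : ℤ) : Forms A j →+ Forms B j where
  toFun x := ⟨formMap A B x, formMap_mem A B x.2⟩
  map_zero' := Subtype.ext (map_zero _)
  map_add' _ _ := Subtype.ext (map_add _ _ _)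

theorem relations_le (B : Type w) [CommRing B] [Algebra A B] (j : ℤ) :
    relations A p j ≤ (relations B p j).comap (formMapDeg A B j) := by
  refine (AddSubgroup.closure_le _).2 ?_
  rintro x (⟨η, hη, h⟩ | ⟨m, hm, a, b, rfl⟩)
  · refine AddSubgroup.subset_closure (Or.inl ⟨formMap A B η, formMap_mem A B hη, ?_⟩)
    rw [extD_formMap, h]
    rfl
  · refine AddSubgroup.subset_closure (Or.inr ⟨m, hm, algebraMap A B a,
      fun i => Units.map (algebraMap A B : A →* B) (b i), Subtype.ext ?_⟩)
    refine (formMap_logForm B hm _ b).trans ?_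
    rw [map_sub, map_pow]

/-- The homomorphism `H^{j+1,j}(A) → H^{j+1,j}(B)` induced by a ring homomorphism `A → B`. -/
def mapH {B : Type w} [CommRing B] (f : A →+* B) (j : ℤ) : H A p j →+ H B p j :=
  letI := f.toAlgebra
  QuotientAddGroup.map _ _ (formMapDeg A B j) (relations_le p B j)

end Cohomology

/-! ### Tame extensions -/

section Tame

variable {K : Type u} [Field K] (O : ValuationSubring K)

/-- A finite extension `L` of a complete discretely valued field `K` with valuation ring `O` is
tame if the extension of residue fields is separable and the ramification index is invertible in
the residue field. -/
def IsFiniteTame (L : Type w) [Field L] [Algebra K L] [Algebra O L]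
    [IsScalarTower O K L] : Prop :=
  FiniteDimensional K L ∧
    ∀ (P : Ideal (integralClosure O L)) [P.IsMaximal] [P.LiesOver (IsLocalRing.maximalIdeal O)],
      Algebra.IsSeparable (O ⧸ IsLocalRing.maximalIdeal O) (integralClosure O L ⧸ P) ∧
        ((P.ramificationIdx O : ℕ) : O ⧸ IsLocalRing.maximalIdeal O) ≠ 0

/-- The maximal tamely ramified extension of a complete discretely valued field `K` inside an
algebraic closure: the compositum of all finite tame extensions of `K`. -/
def tameClosure : IntermediateField K (AlgebraicClosure K) :=
  sSup {L | IsFiniteTame O L}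

end Tame

/-! ### The filtration of `H^{j+1,j}` of a discretely valued field -/

section Filtration

variable {F : Type u} [Field F] (p : ℕ) (v : Valuation F ℤᵐ⁰)

/-- The residue field of the valuation ring of `v`. -/
abbrev ResField : Type u := IsLocalRing.ResidueField v.valuationSubring

variable {v} in
/-- The image in `F` of a unit of the valuation ring. -/
def toF (b : v.valuationSubringˣ) : Fˣ :=
  Units.map (algebraMap v.valuationSubring F : v.valuationSubring →* F) b

variable {v} in
/-- The image in the residue field of a unit of the valuation ring. -/
def toRes (b : v.valuationSubringˣ) : (ResField v)ˣ :=
  Units.map (IsLocalRing.residue v.valuationSubring : v.valuationSubring →* ResField v) b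

/-- The subgroup `U i`, generated by the symbols `[f, g₁, …, gⱼ}` with `v(f) ≥ -i` in additive
notation. -/
def U (j : ℤ) (i : ℕ) : AddSubgroup (H F p j) :=
  AddSubgroup.closure {x | ∃ (m : ℕ) (hm : (m : ℤ) = j) (f : F) (g : Fin m → Fˣ),
    v f ≤ WithZero.exp (i : ℤ) ∧ x = symb p hm f g}

/-- The quotient `U i / U (i - 1)`, for `i > 0`. -/
abbrev Gr (j : ℤ) (i : ℕ) : Type u := U p v j i ⧸ (U p v j (i - 1)).addSubgroupOf (U p v j i)

/-- The unramified subgroup, generated by the symbols `[a, b₁, …, bⱼ}` with `a` in the valuation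
ring and `b₁, …, bⱼ` units of the valuation ring. -/
def unramified (j : ℤ) : AddSubgroup (H F p j) :=
  AddSubgroup.closure {x | ∃ (m : ℕ) (hm : (m : ℤ) = j) (a : v.valuationSubring)
    (b : Fin m → v.valuationSubringˣ), x = symb p hm (a : F) (fun i => toF (b i))}

/-- The embedding of `F` into its completion. -/
def toCompletion : F →+* v.Completion :=
  (UniformSpace.Completion.coeRingHom (α := WithVal v)).comp
    (WithVal.equiv v).symm.toRingHom

/-- The valuation ring of the completion. -/
abbrev completionInt : ValuationSubring v.Completion :=
  (Valued.v : Valuation v.Completion ℤᵐ⁰).valuationSubring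

/-- The tame subgroup: the classes that vanish in the maximal tamely ramified extension of the
completion, i.e. the inverse image of the kernel of
`H^{j+1,j}(F_v) → H^{j+1,j}(F_tame)` under `H^{j+1,j}(F) → H^{j+1,j}(F_v)`. -/
def tame (j : ℤ) : AddSubgroup (H F p j) :=
  (mapH p (algebraMap v.Completion (tameClosure (completionInt v))) j).ker.comap
    (mapH p (toCompletion v) j)

/-- The characterization of the residue homomorphism `H^{n+1,n}_tame(F) → H^{n,n-1}(k)`: it maps
`[a, b₁, …, bₙ}` to `0` and, for every uniformizer `t`, maps `[a, t, b₁, …, bₙ₋₁}` to the symbol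
of the residue classes of `a, b₁, …, bₙ₋₁`, for `a` in the valuation ring and `b₁, b₂, …` units of
the valuation ring. -/
def IsResidue (n : ℕ) (res : tame p v n →+ H (ResField v) p (n - 1)) : Prop :=
  (∀ (a : v.valuationSubring) (b : Fin n → v.valuationSubringˣ),
    ∃ h : symb p rfl (a : F) (fun l => toF (b l)) ∈ tame p v n, res ⟨_, h⟩ = 0) ∧
  ∀ (t : Fˣ), v t = WithZero.exp (-1 : ℤ) →
    ∀ (m : ℕ) (hm : m + 1 = n) (a : v.valuationSubring) (b : Fin m → v.valuationSubringˣ),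
      ∃ h : symb p (cast_succ hm) (a : F)
          (Fin.cons t (fun l => toF (b l)) : Fin (m + 1) → Fˣ) ∈ tame p v n,
        res ⟨_, h⟩ = symb p (cast_pred hm) (IsLocalRing.residue v.valuationSubring a)
          (fun l => toRes (b l))

end Filtration

end ModPCohomology

end

open ModPCohomology

/-! Fix a uniformizer t. Since every element of F^* is a power of t times a unit, every form with a
pole of order at most i is t^(-i) (x + dt/t ∧ y) with x, y forms over O_F (`polar`,
`exists_dlogs_eq`). If x and y reduce to zero over k, the pole order drops. So U_i / U_(i-1) is a
quotient of the sum of Ω^n_k and Ω^(n-1)_k, and only the kernel is in question.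

Enough elements are killed, by explicit relations. If i is prime to p, the differential of t^(-i) y
/ i trades the term dt/t ∧ y for one without dt/t. If p divides i, a closed form over k is, by the
Cartier isomorphism, an exact form plus a sum of forms a^p dlog b_1 ∧ ⋯. The factor t^(-i) is a p-th
power, so t^(-i) times an exact form is exact, and t^(-i) a^p may be replaced by its p-th root,
which has a smaller pole.

Nothing more is killed. As k is formally smooth over the prime field, F embeds into k((t)). Forms of
a field of Hahn series map to series whose coefficients are pairs (x, y), a pair at exponent a
standing for t^a (x + dt/t ∧ y) (`hahnForms`). A lift Φ of the inverse Cartier operator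
(`exists_inverseCartier`) acts on these series by `hahnFrob`, and every relation maps to some Frob ξ
- ξ + dθ (`exists_hahnForms_eq`). If ξ had a term at an exponent c too negative for the pole of the
relation, injectivity of the inverse Cartier operator would put c, pc, p²c, … in its support,
against well-ordering. Hence the lowest coefficient of a relation is known (`lead_of_mem_relTotal`):
it is a pair of relations over k at exponent 0, a pair of closed forms at a negative exponent
divisible by p, and it cannot be (x, 0) with x nonzero at a negative exponent that is nonzero modulo
p. Exponent 0 yields the residue map, its kernel, and the injectivity needed in the henselian case,
where the remaining relations come from solving c^p - c = a for a in the maximal ideal.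

For the tame subgroup, U_0 dies in the tame closure because a root of X^p - X - a with a integral
generates an unramified extension (`isFiniteTame_of_artinSchreier`). Conversely, the tame closure
embeds into Hahn series over a separably closed, separable extension of k, with exponents the
rational numbers of denominator prime to p (`exists_tameClosure_hom`). The computation of lowest
coefficients holds there with exponents read modulo p. As forms inject along separable extensions, a
tame class in U_(i+1) already lies in U_i (`mem_U_of_mem_tame`). -/

noncomputable section

namespace ModPCohomology

universe u w

/-! ### Ring homomorphisms out of the algebra of forms -/

section Lift

variable {A : Type u} [CommRing A] {E : Type w} [Ring E]

/-- A ring homomorphism out of the algebra of forms is determined by its values on `a` and `da`. -/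
theorem diffAlg_ringHom_ext {f g : DiffAlg A →+* E}
    (h : ∀ a, f (algebraMap A _ a) = g (algebraMap A _ a)) (h' : ∀ a, f (dd a) = g (dd a)) :
    f = g := by
  ext x
  induction x using diffAlg_induction with
  | algebraMap a => exact h a
  | der a => exact h' a
  | mul x y hx hy => rw [map_mul, map_mul, hx, hy]
  | add x y hx hy => rw [map_add, map_add, hx, hy]

/-- Through `φ` the ring `E` becomes an `A`-algebra and `δ` a derivation, which factors through the
Kähler differentials. The hypothesis on squares concerns only the elements da; polarization shows
that two of them anticommute, and bilinearity extends this to all differentials, as the universal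
property of the exterior algebra requires. `E` has no algebra structure beforehand because it is
used with structures twisted by the Frobenius or defined on quotients. -/
theorem exists_formsLift (φ : A →+* E) (hφ : ∀ a x, φ a * x = x * φ a) (δ : A →+ E)
    (hδ : ∀ a b, δ (a * b) = φ a * δ b + φ b * δ a) (hsq : ∀ a, δ a * δ a = 0) :
    ∃ f : DiffAlg A →+* E, (∀ a, f (algebraMap A _ a) = φ a) ∧ ∀ a, f (dd a) = δ a := by
  let _ : Algebra A E := φ.toAlgebra' hφ
  have hs (a : A) (x : E) : a • x = φ a * x := rfl
  let D : Derivation ℤ A E := Derivation.mk' δ.toIntLinearMap hδ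
  have hD (a) : D a = δ a := rfl
  have swap0 (a b : A) : δ a * δ b + δ b * δ a = 0 := by
    have := hsq (a + b)
    rw [map_add, mul_add, add_mul, add_mul, hsq, hsq, zero_add, add_zero, add_comm] at this
    exact this
  have mem (x : Ω[A⁄ℤ]) : x ∈ Submodule.span A (Set.range (KaehlerDifferential.D ℤ A)) := by
    rw [KaehlerDifferential.span_range_derivation]; trivial
  have swap (x y : Ω[A⁄ℤ]) : D.liftKaehlerDifferential x * D.liftKaehlerDifferential y +
      D.liftKaehlerDifferential y * D.liftKaehlerDifferential x = 0 := by
    induction mem x using Submodule.span_induction with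
    | zero => simp
    | add x x' _ _ h h' => rw [map_add, add_mul, mul_add, add_add_add_comm, h, h', add_zero]
    | smul a x _ h => rw [map_smul, smul_mul_assoc, mul_smul_comm, ← smul_add, h, smul_zero]
    | mem x hx =>
      obtain ⟨a, rfl⟩ := hx
      induction mem y using Submodule.span_induction with
      | zero => simp
      | add x x' _ _ h h' => rw [map_add, add_mul, mul_add, add_add_add_comm, h, h', add_zero]
      | smul a x _ h => rw [map_smul, smul_mul_assoc, mul_smul_comm, ← smul_add, h, smul_zero]
      | mem y hy =>
        obtain ⟨b, rfl⟩ := hy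
        simp only [Derivation.liftKaehlerDifferential_comp_D, hD]
        exact swap0 a b
  have sq (x : Ω[A⁄ℤ]) : D.liftKaehlerDifferential x * D.liftKaehlerDifferential x = 0 := by
    induction mem x using Submodule.span_induction with
    | zero => simp
    | add x y _ _ hx hy =>
      rw [map_add, mul_add, add_mul, add_mul, hx, hy, zero_add, add_zero, add_comm]
      exact swap x y
    | smul a x _ h => rw [map_smul, smul_mul_assoc, mul_smul_comm, h, smul_zero, smul_zero]
    | mem x hx =>
      obtain ⟨a, rfl⟩ := hx
      simp only [Derivation.liftKaehlerDifferential_comp_D, hD]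
      exact hsq a
  refine ⟨(ExteriorAlgebra.lift A ⟨D.liftKaehlerDifferential, sq⟩ : DiffAlg A →ₐ[A] E).toRingHom,
    fun a => AlgHom.commutes _ a, fun a => ?_⟩
  exact (ExteriorAlgebra.lift_ι_apply A _ _ _).trans (Derivation.liftKaehlerDifferential_comp_D D a)

/-- The ring homomorphism out of the algebra of forms with `a ↦ φ a` and `da ↦ δ a`. -/
def formsLift (φ : A →+* E) (hφ : ∀ a x, φ a * x = x * φ a) (δ : A →+ E)
    (hδ : ∀ a b, δ (a * b) = φ a * δ b + φ b * δ a) (hsq : ∀ a, δ a * δ a = 0) :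
    DiffAlg A →+* E :=
  (exists_formsLift φ hφ δ hδ hsq).choose

variable (φ : A →+* E) (hφ : ∀ a x, φ a * x = x * φ a) (δ : A →+ E)
    (hδ : ∀ a b, δ (a * b) = φ a * δ b + φ b * δ a) (hsq : ∀ a, δ a * δ a = 0)

theorem formsLift_algebraMap (a : A) : formsLift φ hφ δ hδ hsq (algebraMap A _ a) = φ a :=
  (exists_formsLift φ hφ δ hδ hsq).choose_spec.1 a

theorem formsLift_dd (a : A) : formsLift φ hφ δ hδ hsq (dd a) = δ a :=
  (exists_formsLift φ hφ δ hδ hsq).choose_spec.2 a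

end Lift

/-! ### The exterior derivative and the grading -/

section Basics

variable {A : Type u} [CommRing A]

local notation "inv" => CliffordAlgebra.involute (Q := (0 : QuadraticForm A Ω[A⁄ℤ]))

theorem dd_add (a b : A) : dd (a + b) = dd a + dd b := by simp [dd]

theorem dd_zero : dd (0 : A) = 0 := by simp [dd]

theorem dd_one : dd (1 : A) = 0 := by simp [dd]

theorem dd_mul (a b : A) : dd (a * b) = a • dd b + b • dd a := by simp [dd]

theorem dd_sq (a : A) : dd a * dd a = 0 := ExteriorAlgebra.ι_sq_zero _

theorem involute_dd (a : A) : inv (dd a) = -dd a := CliffordAlgebra.involute_ι _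

theorem involute_algebraMap (a : A) :
    inv (algebraMap A (DiffAlg A) a) = algebraMap A (DiffAlg A) a :=
  AlgHom.commutes _ _

theorem extD_one : extD A 1 = 0 := by
  rw [← map_one (algebraMap A (DiffAlg A)), extD_algebraMap, dd_one]

theorem extD_smul (a : A) (x : DiffAlg A) : extD A (a • x) = dd a * x + a • extD A x := by
  rw [Algebra.smul_def, extD_mul, extD_algebraMap, involute_algebraMap, Algebra.smul_def]

theorem extD_dd_mul (a : A) (x : DiffAlg A) : extD A (dd a * x) = -(dd a * extD A x) := by
  rw [extD_mul, extD_dd, zero_mul, zero_add, involute_dd, neg_mul]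

theorem involute_extD (x : DiffAlg A) : inv (extD A x) = -extD A (inv x) := by
  induction x using diffAlg_induction with
  | algebraMap a => rw [involute_algebraMap, extD_algebraMap, involute_dd]
  | der a => rw [involute_dd, map_neg, extD_dd]; simp
  | mul x y hx hy =>
    rw [extD_mul, map_add, map_mul, map_mul, map_mul, extD_mul, hx, hy, neg_add, neg_mul, mul_neg]
  | add x y hx hy => simp only [map_add, hx, hy, neg_add]

theorem extD_extD (x : DiffAlg A) : extD A (extD A x) = 0 := by
  induction x using diffAlg_induction with
  | algebraMap a => rw [extD_algebraMap, extD_dd]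
  | der a => rw [extD_dd, map_zero]
  | mul x y hx hy =>
    rw [extD_mul, map_add, extD_mul, extD_mul, hx, hy, involute_extD]
    simp
  | add x y hx hy => rw [map_add, map_add, hx, hy, add_zero]

theorem one_mem_forms : (1 : DiffAlg A) ∈ Forms A 0 := by
  change (1 : DiffAlg A) ∈ ⋀[A]^0 Ω[A⁄ℤ]
  rw [ExteriorAlgebra.exteriorPower, pow_zero]
  exact Submodule.one_le.mp le_rfl

theorem ι_mul_mem_forms (m : Ω[A⁄ℤ]) {j : ℤ} {x : DiffAlg A} (hx : x ∈ Forms A j) :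
    ExteriorAlgebra.ι A m * x ∈ Forms A (j + 1) := by
  match j, hx with
  | Int.negSucc _, hx =>
    obtain rfl : x = 0 := hx
    simp
  | Int.ofNat n, hx =>
    replace hx : x ∈ ⋀[A]^n Ω[A⁄ℤ] := hx
    change _ ∈ ⋀[A]^(n + 1) Ω[A⁄ℤ]
    rw [ExteriorAlgebra.exteriorPower, pow_succ']
    exact Submodule.mul_mem_mul ⟨_, rfl⟩ hx

theorem extD_mem_forms {j : ℤ} {x : DiffAlg A} (hx : x ∈ Forms A j) :
    extD A x ∈ Forms A (j + 1) := by
  match j, hx with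
  | Int.negSucc _, hx =>
    obtain rfl : x = 0 := hx
    simp
  | Int.ofNat n, hx =>
    have h (m : Ω[A⁄ℤ]) {i : ℕ} {x : DiffAlg A} (hx : x ∈ ⋀[A]^i Ω[A⁄ℤ])
        (hd : extD A x ∈ ⋀[A]^(i + 1) Ω[A⁄ℤ]) :
        extD A (ExteriorAlgebra.ι A m * x) ∈ ⋀[A]^(i + 2) Ω[A⁄ℤ] := by
      have hm : m ∈ Submodule.span A (Set.range (KaehlerDifferential.D ℤ A)) := by
        rw [KaehlerDifferential.span_range_derivation]; trivial
      induction hm using Submodule.span_induction with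
      | zero => simp
      | add m m' _ _ h h' => rw [map_add, add_mul, map_add]; exact add_mem h h'
      | smul a m _ h =>
        rw [map_smul, smul_mul_assoc, extD_smul]
        exact add_mem (ι_mul_mem_forms (j := (i + 1 : ℕ)) _ (ι_mul_mem_forms (j := i) _ hx))
          (Submodule.smul_mem _ _ h)
      | mem m hm =>
        obtain ⟨a, rfl⟩ := hm
        rw [← dd, extD_dd_mul]
        exact neg_mem (ι_mul_mem_forms (j := (i + 1 : ℕ)) _ hd)
    replace hx : x ∈ ⋀[A]^n Ω[A⁄ℤ] := hx
    change _ ∈ ⋀[A]^(n + 1) Ω[A⁄ℤ]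
    clear * - hx h
    induction hx using Submodule.pow_induction_on_left' with
    | algebraMap r =>
      rw [extD_algebraMap, zero_add, ExteriorAlgebra.exteriorPower, pow_one]
      exact ⟨_, rfl⟩
    | add x y i _ _ hx hy => rw [map_add]; exact add_mem hx hy
    | mem_mul m hm i x hx hd =>
      obtain ⟨y, rfl⟩ := hm
      exact h y hx hd

variable (A) in
/-- The homogeneous component of degree `n` of a form. -/
def component (n : ℕ) : DiffAlg A →ₗ[A] DiffAlg A :=
  GradedAlgebra.proj (fun n => ⋀[A]^n Ω[A⁄ℤ]) n

theorem component_of_mem {n : ℕ} {x : DiffAlg A} (hx : x ∈ Forms A n) : component A n x = x := by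
  simp only [component, GradedAlgebra.proj_apply]
  exact DirectSum.decompose_of_mem_same (fun n => ⋀[A]^n Ω[A⁄ℤ]) hx

theorem component_of_mem_ne {n : ℕ} {j : ℤ} (hj : j ≠ n) {x : DiffAlg A} (hx : x ∈ Forms A j) :
    component A n x = 0 := by
  match j, hx with
  | Int.negSucc _, hx =>
    obtain rfl : x = 0 := hx
    simp
  | Int.ofNat m, hx =>
    simp only [component, GradedAlgebra.proj_apply]
    exact DirectSum.decompose_of_mem_ne (fun n => ⋀[A]^n Ω[A⁄ℤ]) hx (fun h => hj (by simp [h]))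

theorem component_mem (n : ℕ) (x : DiffAlg A) : component A n x ∈ Forms A n := by
  simp only [component, GradedAlgebra.proj_apply]
  exact SetLike.coe_mem _

/-- A homogeneous element of a subgroup generated by homogeneous elements lies in the subgroup
generated by the generators of its degree. -/
theorem mem_closure_inter_forms {G : Set (DiffAlg A)} (hG : ∀ g ∈ G, ∃ j, g ∈ Forms A j) {j : ℤ}
    {x : DiffAlg A} (hx : x ∈ AddSubgroup.closure G) (hxj : x ∈ Forms A j) :
    x ∈ AddSubgroup.closure (G ∩ Forms A j) := by
  cases j with
  | negSucc _ =>
    obtain rfl : x = 0 := hxj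
    exact zero_mem _
  | ofNat n =>
    rw [← component_of_mem (n := n) hxj]
    clear hxj
    induction hx using AddSubgroup.closure_induction with
    | zero => simp
    | add x y _ _ hx hy => rw [map_add]; exact add_mem hx hy
    | neg x _ hx => rw [map_neg]; exact neg_mem hx
    | mem x hx =>
      obtain ⟨j, hj⟩ := hG x hx
      by_cases h : j = n
      · subst h
        rw [component_of_mem hj]
        exact AddSubgroup.subset_closure ⟨hx, hj⟩
      · rw [component_of_mem_ne h hj]
        exact zero_mem _

variable (A) in
/-- Every form is a sum of homogeneous forms. -/
theorem mem_closure_forms (x : DiffAlg A) :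
    x ∈ AddSubgroup.closure {y : DiffAlg A | ∃ n : ℕ, y ∈ Forms A n} := by
  classical
  rw [← DirectSum.sum_support_decompose (fun n => ⋀[A]^n Ω[A⁄ℤ]) x]
  exact sum_mem fun i _ => AddSubgroup.subset_closure ⟨i, SetLike.coe_mem _⟩


theorem eq_zero_of_mem_forms_of_ne {i j : ℤ} (h : i ≠ j) {x : DiffAlg A} (hi : x ∈ Forms A i)
    (hj : x ∈ Forms A j) : x = 0 := by
  match j, hj with
  | Int.negSucc _, hj => exact hj
  | Int.ofNat n, hj =>
    exact (component_of_mem (n := n) hj).symm.trans (component_of_mem_ne h hi)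

end Basics

/-! ### Logarithmic forms -/

section Log

variable {A : Type u} [CommRing A]

/-- The class in the algebra of forms of the logarithmic differential of a unit. -/
def dlg (b : Aˣ) : DiffAlg A := ExteriorAlgebra.ι A (dlog b)

theorem dlg_eq (b : Aˣ) : dlg b = (↑b⁻¹ : A) • dd (b : A) := by simp [dlg, dlog, dd]

theorem smul_dlg (b : Aˣ) : (b : A) • dlg b = dd (b : A) := by simp [dlg_eq, smul_smul]

theorem dlog_mul (b c : Aˣ) : dlog (b * c) = dlog b + dlog c := by
  simp only [dlog, Units.val_mul, Derivation.leibniz, smul_add, smul_smul, mul_inv_rev]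
  rw [add_comm]
  congr 2
  · rw [mul_comm, ← mul_assoc]; simp
  · rw [mul_assoc]; simp

theorem dlg_mul (b c : Aˣ) : dlg (b * c) = dlg b + dlg c := by
  rw [dlg, dlog_mul, map_add, dlg, dlg]

theorem dlg_one : dlg (1 : Aˣ) = 0 := by simp [dlg_eq, dd_one]

theorem dlg_zpow (b : Aˣ) (n : ℤ) : dlg (b ^ n) = n • dlg b := by
  let f : Additive Aˣ →+ DiffAlg A :=
    { toFun := fun x => dlg x.toMul, map_zero' := dlg_one, map_add' := fun x y => dlg_mul _ _ }
  exact map_zsmul f n (Additive.ofMul b)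

theorem dlg_sq (b : Aˣ) : dlg b * dlg b = 0 := ExteriorAlgebra.ι_sq_zero _

theorem dlg_mul_swap (b c : Aˣ) : dlg b * dlg c + dlg c * dlg b = 0 :=
  ExteriorAlgebra.ι_add_mul_swap _ _

theorem involute_dlg (b : Aˣ) : CliffordAlgebra.involute (dlg b) = -dlg b :=
  CliffordAlgebra.involute_ι _

theorem extD_dlg (b : Aˣ) : extD A (dlg b) = 0 := by
  -- The differentials of b and of its inverse are multiples of the same logarithmic differential.
  have h : dd (b : A) * dd (↑b⁻¹ : A) = 0 := by
    have h1 : dlg b⁻¹ = -dlg b := by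
      rw [eq_neg_iff_add_eq_zero, ← dlg_mul, inv_mul_cancel, dlg_one]
    rw [← smul_dlg b, ← smul_dlg b⁻¹, h1]
    simp [dlg_sq]
  rw [dlg_eq, extD_smul, extD_dd, smul_zero, add_zero]
  have := dd_mul_swap (b : A) (↑b⁻¹ : A)
  rwa [h, zero_add] at this

theorem extD_dlg_mul (b : Aˣ) (x : DiffAlg A) : extD A (dlg b * x) = -(dlg b * extD A x) := by
  rw [extD_mul, extD_dlg, involute_dlg, zero_mul, zero_add, neg_mul]

/-- The product of the logarithmic differentials of a list of units. -/
def dlogs (l : List Aˣ) : DiffAlg A := (l.map dlg).prod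

@[simp] theorem dlogs_nil : dlogs ([] : List Aˣ) = 1 := rfl

@[simp] theorem dlogs_cons (b : Aˣ) (l : List Aˣ) : dlogs (b :: l) = dlg b * dlogs l :=
  List.prod_cons

theorem dlogs_append (l l' : List Aˣ) : dlogs (l ++ l') = dlogs l * dlogs l' := by
  simp [dlogs]

theorem extD_dlogs (l : List Aˣ) : extD A (dlogs l) = 0 := by
  induction l with
  | nil => exact extD_one
  | cons b l h => rw [dlogs_cons, extD_dlg_mul, h, mul_zero, neg_zero]

theorem extD_smul_dlogs (a : A) (l : List Aˣ) : extD A (a • dlogs l) = dd a * dlogs l := by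
  rw [extD_smul, extD_dlogs, smul_zero, add_zero]

theorem dlogs_mem_forms (l : List Aˣ) : dlogs l ∈ Forms A l.length := by
  induction l with
  | nil => exact one_mem_forms
  | cons b l h =>
    rw [dlogs_cons, List.length_cons, Nat.cast_succ]
    exact ι_mul_mem_forms _ h

theorem coe_logForm {m : ℕ} {j : ℤ} (hm : (m : ℤ) = j) (a : A) (b : Fin m → Aˣ) :
    (logForm hm a b : DiffAlg A) = a • dlogs (List.ofFn b) := by
  simp only [logForm, ExteriorAlgebra.ιMulti_apply, dlogs, List.map_ofFn]
  rfl

theorem formMap_dlg (B : Type w) [CommRing B] [Algebra A B] (b : Aˣ) :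
    formMap A B (dlg b) = dlg (Units.map (algebraMap A B : A →* B) b) := by
  rw [dlg, formMap_ι, dlog, map_smul, KaehlerDifferential.map_D, ← algebraMap_smul B]
  rfl

theorem formMap_dlogs (B : Type w) [CommRing B] [Algebra A B] (l : List Aˣ) :
    formMap A B (dlogs l) = dlogs (l.map (Units.map (algebraMap A B : A →* B))) := by
  induction l with
  | nil => simp
  | cons b l h => rw [dlogs_cons, map_mul, h, formMap_dlg, List.map_cons, dlogs_cons]

theorem formMap_smul (B : Type w) [CommRing B] [Algebra A B] (a : A) (x : DiffAlg A) :
    formMap A B (a • x) = algebraMap A B a • formMap A B x := by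
  rw [map_smul, algebraMap_smul]

/-- Over a local ring, the forms of degree `j` are the sums of forms
`a (db₁ / b₁) ∧ ⋯ ∧ (dbⱼ / bⱼ)`. -/
theorem mem_closure_logForm [IsLocalRing A] {j : ℤ} (x : Forms A j) :
    x ∈ AddSubgroup.closure {y : Forms A j | ∃ (m : ℕ) (hm : (m : ℤ) = j) (a : A)
      (b : Fin m → Aˣ), y = logForm hm a b} := by
  have hs : Submodule.span A (Set.range (dlog : Aˣ → Ω[A⁄ℤ])) = ⊤ := by
    rw [eq_top_iff, ← KaehlerDifferential.span_range_derivation, Submodule.span_le]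
    rintro _ ⟨a, rfl⟩
    have key (u : Aˣ) : KaehlerDifferential.D ℤ A (u : A) ∈
        Submodule.span A (Set.range (dlog : Aˣ → Ω[A⁄ℤ])) := by
      have : KaehlerDifferential.D ℤ A (u : A) = (u : A) • dlog u := by simp [dlog, smul_smul]
      rw [this]
      exact Submodule.smul_mem _ _ (Submodule.subset_span ⟨u, rfl⟩)
    -- Only units have logarithmic differentials; for a nonunit a, the unit 1 - a has differential
    -- -da.
    rcases IsLocalRing.isUnit_or_isUnit_one_sub_self a with ⟨u, rfl⟩ | ⟨u, hu⟩
    · exact key u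
    · have : KaehlerDifferential.D ℤ A a = -KaehlerDifferential.D ℤ A (u : A) := by
        rw [hu, map_sub]; simp
      rw [this]
      exact neg_mem (key u)
  obtain ⟨x, hx⟩ := x
  cases j with
  | negSucc m =>
    obtain rfl : x = 0 := hx
    exact zero_mem _
  | ofNat n =>
    have hx' : x ∈ Submodule.span A
        (ExteriorAlgebra.ιMulti A n '' {a | Set.range a ⊆ Set.range (dlog : Aˣ → Ω[A⁄ℤ])}) := by
      rw [exteriorPower.ιMulti_span_fixedDegree_of_span_eq_top A n _ hs]; exact hx
    clear hs
    induction hx' using Submodule.closure_induction with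
    | zero => exact zero_mem _
    | add x y hx' hy' h h' =>
      have mem {x : DiffAlg A} (hx : x ∈ Submodule.span A (ExteriorAlgebra.ιMulti A n ''
          {a | Set.range a ⊆ Set.range (dlog : Aˣ → Ω[A⁄ℤ])})) : x ∈ Forms A (Int.ofNat n) := by
        refine Submodule.span_le.2 ?_ hx
        rintro _ ⟨v, -, rfl⟩
        exact ExteriorAlgebra.ιMulti_range A n (Set.mem_range_self _)
      exact add_mem (h (mem hx')) (h' (mem hy'))
    | smul_mem r x hx' =>
      obtain ⟨v, hv, rfl⟩ := hx'
      choose b hb using fun i => hv (Set.mem_range_self i)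
      refine AddSubgroup.subset_closure ⟨n, rfl, r, b, Subtype.ext ?_⟩
      simp [logForm, hb]

theorem mem_closure_dlogs [IsLocalRing A] (x : DiffAlg A) :
    x ∈ AddSubgroup.closure {y : DiffAlg A | ∃ (a : A) (l : List Aˣ), y = a • dlogs l} := by
  induction mem_closure_forms A x using AddSubgroup.closure_induction with
  | zero => exact zero_mem _
  | add x y _ _ hx hy => exact add_mem hx hy
  | neg x _ hx => exact neg_mem hx
  | mem x hx =>
    obtain ⟨n, hn⟩ := hx
    have := mem_closure_logForm ⟨x, hn⟩
    have h2 := AddSubgroup.mem_map_of_mem (Forms A n).subtype.toAddMonoidHom this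
    rw [AddMonoidHom.map_closure] at h2
    refine AddSubgroup.closure_mono ?_ h2
    rintro _ ⟨_, ⟨m, hm, a, b, rfl⟩, rfl⟩
    exact ⟨a, List.ofFn b, coe_logForm hm a b⟩

end Log

/-! ### Relations in the whole algebra of forms -/

section Relations

variable (A : Type u) [CommRing A] (p : ℕ)

/-- The relations of all degrees. -/
def relTotal : AddSubgroup (DiffAlg A) :=
  AddSubgroup.closure ({x | ∃ n : ℕ, ∃ η ∈ Forms A n, extD A η = x} ∪
    {x | ∃ (a : A) (l : List Aˣ), x = (a ^ p - a) • dlogs l})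

variable {A}

theorem extD_mem_relTotal (η : DiffAlg A) : extD A η ∈ relTotal A p := by
  induction mem_closure_forms A η using AddSubgroup.closure_induction with
  | zero => simp
  | add x y _ _ hx hy => rw [map_add]; exact add_mem hx hy
  | neg x _ hx => rw [map_neg]; exact neg_mem hx
  | mem x hx => exact AddSubgroup.subset_closure (Or.inl ⟨hx.choose, x, hx.choose_spec, rfl⟩)

theorem pow_sub_smul_dlogs_mem_relTotal (a : A) (l : List Aˣ) :
    (a ^ p - a) • dlogs l ∈ relTotal A p :=
  AddSubgroup.subset_closure (Or.inr ⟨a, l, rfl⟩)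

theorem coe_mem_relTotal {j : ℤ} {x : Forms A j} (hx : x ∈ relations A p j) :
    (x : DiffAlg A) ∈ relTotal A p := by
  induction hx using AddSubgroup.closure_induction with
  | zero => exact zero_mem _
  | add x y _ _ hx hy => exact add_mem hx hy
  | neg x _ hx => exact neg_mem hx
  | mem x hx =>
    rcases hx with ⟨η, -, h⟩ | ⟨m, hm, a, b, rfl⟩
    · rw [← h]; exact extD_mem_relTotal p η
    · rw [coe_logForm]; exact pow_sub_smul_dlogs_mem_relTotal p a _

/-- All generators involved are homogeneous, so projecting to degree `j` leaves only the generators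
of that degree. This is the way back from the whole algebra, where no bookkeeping of degrees is
needed, to a group `H A p j`. -/
theorem mk_mem_of_mem_sup {G : Set (DiffAlg A)} (hG : ∀ g ∈ G, ∃ j, g ∈ Forms A j) {j : ℤ}
    (V : AddSubgroup (H A p j))
    (hV : ∀ g ∈ G, ∀ hg : g ∈ Forms A j, (QuotientAddGroup.mk ⟨g, hg⟩ : H A p j) ∈ V)
    {x : DiffAlg A} (hx : x ∈ Forms A j) (h : x ∈ relTotal A p ⊔ AddSubgroup.closure G) :
    (QuotientAddGroup.mk ⟨x, hx⟩ : H A p j) ∈ V := by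
  rw [relTotal, ← AddSubgroup.closure_union] at h
  have h2 := mem_closure_inter_forms (by
    rintro g ((⟨n, η, hη, rfl⟩ | ⟨a, l, rfl⟩) | hg)
    · exact ⟨_, extD_mem_forms hη⟩
    · exact ⟨_, Submodule.smul_mem _ _ (dlogs_mem_forms l)⟩
    · exact hG g hg) h hx
  clear h
  induction h2 using AddSubgroup.closure_induction with
  | zero => exact zero_mem V
  | neg x h hx' => exact neg_mem (hx' (neg_mem_iff.1 hx))
  | add x y h h' hx' hy' =>
    have mem {x : DiffAlg A} {S : Set (DiffAlg A)}
        (hx : x ∈ AddSubgroup.closure (S ∩ Forms A j)) : x ∈ Forms A j := by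
      have : AddSubgroup.closure (S ∩ Forms A j) ≤ (Forms A j).toAddSubgroup :=
        (AddSubgroup.closure_le _).2 Set.inter_subset_right
      exact this hx
    exact add_mem (hx' (mem h)) (hy' (mem h'))
  | mem x hx' =>
    have zero {r : Forms A j} (hr : r ∈ relations A p j) :
        (QuotientAddGroup.mk r : H A p j) ∈ V := by
      rw [(QuotientAddGroup.eq_zero_iff r).2 hr]; exact zero_mem V
    obtain ⟨(⟨n, η, hη, rfl⟩ | ⟨a, l, rfl⟩) | hg, -⟩ := hx'
    · apply zero
      by_cases hj : (n : ℤ) + 1 = j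
      · subst hj
        exact AddSubgroup.subset_closure (Or.inl ⟨η, by simpa using hη, rfl⟩)
      · convert! zero_mem (relations A p j)
        exact eq_zero_of_mem_forms_of_ne hj (extD_mem_forms hη) hx
    · apply zero
      by_cases hj : (l.length : ℤ) = j
      · exact AddSubgroup.subset_closure (Or.inr ⟨_, hj, a, l.get, Subtype.ext (by
          rw [coe_logForm, List.ofFn_get])⟩)
      · convert! zero_mem (relations A p j)
        exact eq_zero_of_mem_forms_of_ne hj
          (Submodule.smul_mem _ _ (dlogs_mem_forms l)) hx
    · exact hV x hg hx

theorem mem_relations {j : ℤ} {x : DiffAlg A} (hx : x ∈ Forms A j) (h : x ∈ relTotal A p) :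
    (⟨x, hx⟩ : Forms A j) ∈ relations A p j := by
  have := mk_mem_of_mem_sup (G := ∅) p (by simp) ⊥ (by simp) hx (by simpa using h)
  exact (QuotientAddGroup.eq_zero_iff _).1 this

theorem formMap_mem_relTotal (B : Type w) [CommRing B] [Algebra A B] {x : DiffAlg A}
    (hx : x ∈ relTotal A p) : formMap A B x ∈ relTotal B p := by
  induction hx using AddSubgroup.closure_induction with
  | zero => simp
  | add x y _ _ hx hy => rw [map_add]; exact add_mem hx hy
  | neg x _ hx => rw [map_neg]; exact neg_mem hx
  | mem x hx =>
    rcases hx with ⟨n, η, -, rfl⟩ | ⟨a, l, rfl⟩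
    · rw [← extD_formMap]; exact extD_mem_relTotal p _
    · rw [formMap_smul, formMap_dlogs, map_sub, map_pow]
      exact pow_sub_smul_dlogs_mem_relTotal p _ _

end Relations

/-! ### The kernel of the pullback along a surjection -/

section Kernel

variable (A : Type u) (B : Type w) [CommRing A] [CommRing B] [Algebra A B]

theorem formMap_surjective (hf : Function.Surjective (algebraMap A B)) :
    Function.Surjective (formMap A B) := by
  intro x
  induction x using diffAlg_induction with
  | algebraMap b =>
    obtain ⟨a, rfl⟩ := hf b
    exact ⟨algebraMap A _ a, formMap_algebraMap A B a⟩
  | der b =>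
    obtain ⟨a, rfl⟩ := hf b
    exact ⟨dd a, formMap_dd A B a⟩
  | mul x y hx hy =>
    obtain ⟨⟨x, rfl⟩, y, rfl⟩ := And.intro hx hy
    exact ⟨x * y, map_mul _ _ _⟩
  | add x y hx hy =>
    obtain ⟨⟨x, rfl⟩, y, rfl⟩ := And.intro hx hy
    exact ⟨x + y, map_add _ _ _⟩

/-- A preimage in the whole algebra need not be homogeneous; its component of the right degree is
still a preimage because pullback respects degrees. -/
theorem formMapDeg_surjective (hf : Function.Surjective (algebraMap A B)) (j : ℤ) :
    Function.Surjective (formMapDeg A B j) := by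
  rintro ⟨y, hy⟩
  cases j with
  | negSucc m =>
    obtain rfl : y = 0 := hy
    exact ⟨0, map_zero _⟩
  | ofNat n =>
    obtain ⟨x, rfl⟩ := formMap_surjective A B hf y
    refine ⟨⟨component A n x, component_mem n x⟩, Subtype.ext ?_⟩
    change formMap A B (component A n x) = formMap A B x
    rw [← component_of_mem (n := n) hy]
    clear hy
    induction mem_closure_forms A x using AddSubgroup.closure_induction with
    | zero => simp
    | add x y _ _ hx hy => simp only [map_add, hx, hy]
    | neg x _ hx => simp only [map_neg, hx]
    | mem x hx =>
      obtain ⟨m, hm⟩ := hx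
      by_cases h : (m : ℤ) = n
      · rw [component_of_mem (h ▸ hm), component_of_mem (h ▸ formMap_mem A B hm)]
      · rw [component_of_mem_ne h hm, component_of_mem_ne h (formMap_mem A B hm), map_zero]

/-- The kernel of the pullback of forms along a surjection `A → B` is the ideal generated by
the elements `a` and `da`, for `a` in the kernel of `A → B`. -/
theorem mem_closure_of_formMap_eq_zero (hf : Function.Surjective (algebraMap A B)) {x : DiffAlg A}
    (hx : formMap A B x = 0) :
    x ∈ AddSubgroup.closure ({y : DiffAlg A | ∃ a z, algebraMap A B a = 0 ∧ y = a • z} ∪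
      {y | ∃ a z, algebraMap A B a = 0 ∧ y = dd a * z}) := by
  set S := AddSubgroup.closure ({y : DiffAlg A | ∃ a z, algebraMap A B a = 0 ∧ y = a • z} ∪
      {y | ∃ a z, algebraMap A B a = 0 ∧ y = dd a * z}) with hS
  -- `S` is a two-sided ideal: a and da can be moved past any form, da at the cost of the grading
  -- involution.
  have hmul {y} (hy : y ∈ S) (x : DiffAlg A) : x * y ∈ S ∧ y * x ∈ S := by
    induction hy using AddSubgroup.closure_induction with
    | zero => simp
    | add y y' _ _ h h' =>
      rw [mul_add, add_mul]; exact ⟨add_mem h.1 h'.1, add_mem h.2 h'.2⟩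
    | neg y _ h => rw [mul_neg, neg_mul]; exact ⟨neg_mem h.1, neg_mem h.2⟩
    | mem y h =>
      rcases h with ⟨a, z, ha, rfl⟩ | ⟨a, z, ha, rfl⟩
      · exact ⟨AddSubgroup.subset_closure (Or.inl ⟨a, x * z, ha, by simp⟩),
          AddSubgroup.subset_closure (Or.inl ⟨a, z * x, ha, by simp⟩)⟩
      · refine ⟨AddSubgroup.subset_closure (Or.inr ⟨a, CliffordAlgebra.involute x * z, ha, ?_⟩),
          AddSubgroup.subset_closure (Or.inr ⟨a, z * x, ha, by rw [mul_assoc]⟩)⟩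
        rw [← mul_assoc, ← mul_assoc, ← involute_mul_dd, CliffordAlgebra.involute_involute]
  let I : Ideal (DiffAlg A) :=
    { carrier := S, zero_mem' := zero_mem S, add_mem' := add_mem,
      smul_mem' := fun x y hy => (hmul hy x).1 }
  have : I.IsTwoSided := ⟨fun b ha => (hmul ha b).2⟩
  let q : DiffAlg A →+* DiffAlg A ⧸ I := Ideal.Quotient.mk I
  have hq {x} : q x = 0 ↔ x ∈ S := Ideal.Quotient.eq_zero_iff_mem
  have hker0 (a) (ha : algebraMap A B a = 0) : q (algebraMap A _ a) = 0 :=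
    hq.2 (AddSubgroup.subset_closure (Or.inl ⟨a, 1, ha, by simp [Algebra.smul_def]⟩))
  have hker1 (a) (ha : algebraMap A B a = 0) : q (dd a) = 0 :=
    hq.2 (AddSubgroup.subset_closure (Or.inr ⟨a, 1, ha, by simp⟩))
  let φ : B →+* DiffAlg A ⧸ I := (algebraMap A B).liftOfSurjective hf
    ⟨q.comp (algebraMap A (DiffAlg A)), fun a ha => hker0 a ha⟩
  have hφ (a) : φ (algebraMap A B a) = q (algebraMap A _ a) :=
    RingHom.liftOfRightInverse_comp_apply _ _ _ _ _
  let D : A →+ DiffAlg A := ⟨⟨dd, dd_zero⟩, dd_add⟩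
  let δ : B →+ DiffAlg A ⧸ I := (algebraMap A B).toAddMonoidHom.liftOfSurjective hf
    ⟨q.toAddMonoidHom.comp D, fun a ha => hker1 a ha⟩
  have hδ (a) : δ (algebraMap A B a) = q (dd a) :=
    AddMonoidHom.liftOfRightInverse_comp_apply _ _ _ _ _
  -- Modulo the ideal, a and da depend only on the image of a in `B`. So the quotient map factors
  -- through the forms of `B`, and a form that pulls back to zero lies in the ideal.
  let g : DiffAlg B →+* DiffAlg A ⧸ I := formsLift φ
    (fun b y => by
      obtain ⟨a, rfl⟩ := hf b
      obtain ⟨y, rfl⟩ := Ideal.Quotient.mk_surjective y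
      rw [hφ, ← map_mul, ← map_mul, Algebra.commutes]) δ
    (fun b c => by
      obtain ⟨⟨a, rfl⟩, c, rfl⟩ := And.intro (hf b) (hf c)
      rw [← map_mul, hδ, hδ, hδ, hφ, hφ, dd_mul, map_add, ← map_mul, ← map_mul,
        Algebra.smul_def, Algebra.smul_def])
    (fun b => by
      obtain ⟨a, rfl⟩ := hf b
      rw [hδ, ← map_mul, dd_sq, map_zero])
  have key : g.comp (formMap A B).toRingHom = q := diffAlg_ringHom_ext
    (fun a => by
      change g (formMap A B (algebraMap A _ a)) = _
      rw [formMap_algebraMap, formsLift_algebraMap, hφ])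
    (fun a => by
      change g (formMap A B (dd a)) = _
      rw [formMap_dd, formsLift_dd, hδ])
  rw [← hq, ← key]
  change g (formMap A B x) = 0
  rw [hx, map_zero]

end Kernel

/-! ### The additivity of `a ^ (p - 1) da` modulo exact forms -/

section Additivity

variable {A : Type u} [CommRing A]

theorem dd_pow (a : A) (n : ℕ) : dd (a ^ (n + 1)) = ((n + 1 : ℕ) * a ^ n) • dd a := by
  induction n with
  | zero => simp
  | succ n h =>
    rw [pow_succ, dd_mul, h, smul_smul, ← add_smul]
    congr 1
    push_cast
    ring

/-- The exact term is the differential of ((x + y)^p - x^p - y^p) / p, a polynomial with integer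
coefficients, so no assumption on the characteristic is needed. It makes a ↦ a^(p-1) da additive
modulo exact forms, the starting point of the inverse Cartier operator. -/
theorem exists_dd_eq {p : ℕ} (hp : p.Prime) (x y : A) :
    ∃ c : A, (x + y) ^ (p - 1) • dd (x + y) =
      x ^ (p - 1) • dd x + y ^ (p - 1) • dd y + dd c := by
  obtain ⟨q, rfl⟩ : ∃ q, p = q + 1 := ⟨p - 1, (Nat.succ_pred_eq_of_pos hp.pos).symm⟩
  have hdvd (i : ℕ) (hi : i ∈ Finset.range q) : q + 1 ∣ (q + 1).choose (i + 1) :=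
    hp.dvd_choose_self (by omega) (by have := Finset.mem_range.1 hi; omega)
  choose! c hc using hdvd
  -- `c i` is the binomial coefficient of p over i + 1, divided by p. Differentiating in x or in y
  -- multiplies it by i + 1 or by p - 1 - i, which gives back the binomial coefficients of p - 1.
  have h1 (i : ℕ) (hi : i ∈ Finset.range q) : (c i : A) * (i + 1) = q.choose i := by
    have := Nat.add_one_mul_choose_eq q i
    rw [hc i hi, mul_assoc] at this
    have := Nat.eq_of_mul_eq_mul_left (Nat.succ_pos q) this
    rw [this]; push_cast; ring
  have h2 (i : ℕ) (hi : i ∈ Finset.range q) :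
      (c i : A) * (q - i : ℕ) = q.choose (i + 1) := by
    have hi' := Finset.mem_range.1 hi
    have := Nat.choose_mul_succ_eq q (i + 1)
    rw [hc i hi, mul_comm, mul_assoc, show q + 1 - (i + 1) = q - i by omega] at this
    have := Nat.eq_of_mul_eq_mul_left (Nat.succ_pos q) this
    rw [this]; push_cast; ring
  refine ⟨∑ i ∈ Finset.range q, (c i : A) * (x ^ (i + 1) * y ^ (q - i)), ?_⟩
  have hsum (f : ℕ → A) : dd (∑ i ∈ Finset.range q, f i) = ∑ i ∈ Finset.range q, dd (f i) := by
    simp [dd]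
  have hterm (i : ℕ) (hi : i ∈ Finset.range q) : dd ((c i : A) * (x ^ (i + 1) * y ^ (q - i))) =
      (x ^ i * y ^ (q - i) * q.choose i) • dd x +
        (x ^ (i + 1) * y ^ (q - (i + 1)) * q.choose (i + 1)) • dd y := by
    have hi' := Finset.mem_range.1 hi
    have hcast : dd (c i : A) = 0 := by simp [dd]
    have e1 : q - i = (q - i - 1) + 1 := by omega
    have e2 : q - (i + 1) = q - i - 1 := by omega
    rw [dd_mul, hcast, smul_zero, add_zero, dd_mul, e2, ← h1 i hi, ← h2 i hi, dd_pow]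
    conv_lhs => rw [e1, dd_pow]
    rw [← e1, smul_add, smul_smul, smul_smul, smul_smul, smul_smul, add_comm]
    congr 2 <;> push_cast <;> ring
  rw [hsum, Finset.sum_congr rfl hterm, Finset.sum_add_distrib, ← Finset.sum_smul,
    ← Finset.sum_smul, dd_add, smul_add, Nat.add_sub_cancel]
  have e1 : (x + y) ^ q = (∑ i ∈ Finset.range q, x ^ i * y ^ (q - i) * q.choose i) + x ^ q := by
    rw [add_pow, Finset.sum_range_succ]; simp
  have e2 : (x + y) ^ q =
      (∑ i ∈ Finset.range q, x ^ (i + 1) * y ^ (q - (i + 1)) * q.choose (i + 1)) + y ^ q := by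
    rw [add_pow, Finset.sum_range_succ']; simp
  conv_lhs => rw [e1]
  conv_lhs => enter [2]; rw [← e1, e2]
  rw [add_smul, add_smul]
  abel

end Additivity

/-! ### Sections of surjections onto fields of characteristic `p` -/

section Sections

open Polynomial

variable {k : Type u} [Field k] {E : Type w} [CommRing E] (p : ℕ) [Fact p.Prime] [CharP k p]
  [CharP E p] (π : E →+* k)

omit [CharP E p] in
/-- A subring of `E` that contains all `p`-th powers and is mapped injectively to the field `k`
can be enlarged by any element whose image is new. -/
theorem exists_subring_of_notMem (hE : Function.Surjective π) {G : Subring E} (hG : ∀ r, r ^ p ∈ G)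
    (hinj : ∀ x ∈ G, π x = 0 → x = 0) {x₀ : E} (hX : ∀ g ∈ G, π g ≠ π x₀) :
    ∃ G' : Subring E, G ≤ G' ∧ x₀ ∈ G' ∧ ∀ x ∈ G', π x = 0 → x = 0 := by
  have hp : p.Prime := Fact.out
  let f : G →+* k := π.comp G.subtype
  have hf : Function.Injective f := (injective_iff_map_eq_zero f).2 fun x hx =>
    Subtype.ext (hinj x x.2 hx)
  let L : Subfield k :=
    { f.range with
      inv_mem' := by
        rintro _ ⟨x, rfl⟩
        obtain ⟨r, hr⟩ := hE ((f x)⁻¹)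
        by_cases h0 : f x = 0
        · rw [h0, inv_zero]; exact zero_mem f.range
        -- The image of `G` is a field: the inverse of x is its own p-th power times x^(p-1), and
        -- p-th powers lift into `G`.
        refine ⟨⟨r ^ p, hG r⟩ * x ^ (p - 1), ?_⟩
        rw [map_mul, map_pow]
        change π (r ^ p) * _ = _
        rw [map_pow, hr]
        obtain ⟨q, hq⟩ : ∃ q, p = q + 1 := ⟨p - 1, (Nat.succ_pred_eq_of_pos hp.pos).symm⟩
        rw [hq, Nat.add_sub_cancel, pow_succ, mul_right_comm, inv_pow, inv_mul_cancel₀ (pow_ne_zero _ h0),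
          one_mul] }
  let h : G →+* L := f.codRestrict L fun x => ⟨x, rfl⟩
  have hh : Function.Injective h := fun x y hxy => hf (congrArg Subtype.val hxy)
  have : Nontrivial G := f.domain_nontrivial
  let c : G := ⟨x₀ ^ p, hG x₀⟩
  let P : G[X] := X ^ p - C c
  have hPm : P.Monic := monic_X_pow_sub_C c hp.ne_zero
  have hPd : P.natDegree = p := natDegree_X_pow_sub_C
  have hPX : aeval x₀ P = 0 := by
    simp only [P, map_sub, map_pow, aeval_X, aeval_C]
    exact sub_self _
  let P' : L[X] := P.map h
  have hP' : P' = X ^ p - C (h c) := by simp [P', P]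
  -- As the Frobenius of `k` is injective, the image of `x₀` is the only p-th root of its p-th
  -- power. It is not in `L`, so the constant is not a p-th power in `L`, which for the prime
  -- exponent p implies irreducibility.
  have hirr : Irreducible P' := by
    rw [hP']
    refine X_pow_sub_C_irreducible_of_prime hp fun b hb => ?_
    obtain ⟨g, hg⟩ : (b : k) ∈ f.range := b.2
    have h1 : (b : k) ^ p = (π x₀) ^ p := by
      rw [← map_pow]; exact congrArg Subtype.val hb
    exact hX g g.2 (hg.trans (frobenius_inj k p h1))
  have hmin : minpoly L (π x₀) = P' := by
    refine (minpoly.eq_of_irreducible_of_monic hirr ?_ (hPm.map h)).symm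
    rw [hP', map_sub, map_pow, aeval_X, aeval_C]
    change (π x₀) ^ p - π (x₀ ^ p) = 0
    rw [map_pow, sub_self]
  refine ⟨(Algebra.adjoin G {x₀}).toSubring, fun g hg => ?_, Algebra.subset_adjoin rfl, fun x hx h0 => ?_⟩
  · exact (Algebra.adjoin G {x₀}).algebraMap_mem ⟨g, hg⟩
  · replace hx : x ∈ Algebra.adjoin G {x₀} := hx
    rw [Algebra.adjoin_singleton_eq_range_aeval] at hx
    obtain ⟨Q, rfl⟩ := hx
    -- The remainder has degree less than p, the degree of the minimal polynomial of the image of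
    -- `x₀`; if its value vanishes in `k`, so do all its coefficients.
    have hQ : aeval x₀ (Q %ₘ P) = aeval x₀ Q := aeval_modByMonic_eq_self_of_root hPX
    change π (aeval x₀ Q) = 0 at h0
    change aeval x₀ Q = 0
    rw [← hQ] at h0 ⊢
    have h2 : aeval (π x₀) ((Q %ₘ P).map h) = 0 := by
      rw [← h0, aeval_def, eval₂_map, aeval_def, hom_eval₂]
      rfl
    have h3 : (Q %ₘ P).map h = 0 := by
      by_contra hne
      have h4 := natDegree_le_natDegree (minpoly.degree_le_of_ne_zero L (π x₀) hne h2)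
      rw [hmin, natDegree_map_eq_of_injective hh, natDegree_map_eq_of_injective hh] at h4
      have := natDegree_modByMonic_lt Q hPm (fun h => by
        rw [h] at hPd; simp at hPd; exact hp.ne_zero hPd.symm)
      omega
    rw [(Polynomial.map_eq_zero_iff hh).1 h3, map_zero]

omit [CharP E p] in
-- By Zorn there is a maximal subring above `G₀` on which `π` is injective. It surjects onto `k`,
-- since otherwise `exists_subring_of_notMem` would enlarge it, and the inverse of the resulting
-- isomorphism is a section that returns the elements of `G₀`.
theorem exists_section_of_subring (hπ : Function.Surjective π) {G₀ : Subring E}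
    (hG : ∀ r, r ^ p ∈ G₀) (hinj : ∀ x ∈ G₀, π x = 0 → x = 0) :
    ∃ f : k →+* E, (∀ a, π (f a) = a) ∧ ∀ g ∈ G₀, f (π g) = g := by
  obtain ⟨G, hle, hmax⟩ := zorn_le_nonempty₀ {G : Subring E | ∀ x ∈ G, π x = 0 → x = 0}
    (fun c hc hchain y hy => ⟨sSup c, fun x hx h => by
        obtain ⟨s, hs, hxs⟩ := (Subring.mem_sSup_of_directedOn ⟨y, hy⟩ hchain.directedOn).1 hx
        exact hc hs x hxs h, fun z hz => le_sSup hz⟩) G₀ hinj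
  have hsurj : ∀ a, ∃ g : G, π g = a := by
    intro a
    by_contra hcon
    push Not at hcon
    obtain ⟨X, rfl⟩ := hπ a
    obtain ⟨G', h1, h2, h3⟩ := exists_subring_of_notMem p π hπ (fun r => hle (hG r)) hmax.prop
      (fun g hg => hcon ⟨g, hg⟩)
    exact hcon ⟨X, hmax.le_of_ge h3 h1 h2⟩ rfl
  let e : G ≃+* k := RingEquiv.ofBijective (π.comp G.subtype)
    ⟨(injective_iff_map_eq_zero _).2 fun x hx => Subtype.ext (hmax.prop x x.2 hx), hsurj⟩
  refine ⟨G.subtype.comp e.symm.toRingHom, fun a => e.apply_symm_apply a, fun g hg => ?_⟩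
  exact congrArg Subtype.val (e.symm_apply_apply ⟨g, hle hg⟩)

/-- The subring of p-th powers is a possible starting point: a p-th power that maps to zero has its
root in the kernel, hence vanishes. -/
theorem exists_section (hπ : Function.Surjective π) (hker : ∀ x, π x = 0 → x ^ p = 0) :
    ∃ f : k →+* E, ∀ a, π (f a) = a := by
  obtain ⟨f, hf, -⟩ := exists_section_of_subring p π hπ (G₀ := (frobenius E p).range)
    (fun r => ⟨r, rfl⟩) (by
      rintro _ ⟨r, rfl⟩ h
      refine hker r ?_
      rw [frobenius_def, map_pow] at h
      exact eq_zero_of_pow_eq_zero h)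
  exact ⟨f, hf⟩

end Sections

/-! ### Formal smoothness over the prime field, and elements with vanishing differential -/

section FormallySmooth

variable (k : Type u) [Field k] (p : ℕ) [Fact p.Prime] [CharP k p]

/-- A field of characteristic `p` is formally smooth over the prime field. -/
theorem formallySmooth_zmod [Algebra (ZMod p) k] : Algebra.FormallySmooth (ZMod p) k := by
  refine .of_comp_surjective fun C _ _ I hI g => ?_
  -- Lifts of `g` along `C → C ⧸ I` are sections of the fibre product of `C` and `k` over `C ⧸ I`.
  -- The kernel of its projection to `k` is `I`, of square zero, hence killed by the Frobenius.
  let E : Subring (C × k) := RingHom.eqLocus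
    ((Ideal.Quotient.mk I).comp (RingHom.fst C k)) (g.toRingHom.comp (RingHom.snd C k))
  let π : E →+* k := (RingHom.snd C k).comp E.subtype
  rcases subsingleton_or_nontrivial C with hC | hC
  · exact ⟨⟨⟨⟨⟨fun _ => 0, Subsingleton.elim _ _⟩, fun _ _ => Subsingleton.elim _ _⟩,
      Subsingleton.elim _ _, fun _ _ => Subsingleton.elim _ _⟩, fun _ => Subsingleton.elim _ _⟩,
      AlgHom.ext fun _ => by
        have : Subsingleton (C ⧸ I) := Ideal.Quotient.mk_surjective.subsingleton
        exact Subsingleton.elim _ _⟩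
  have : CharP C p := charP_of_injective_algebraMap (algebraMap (ZMod p) C).injective p
  have : CharP E p := ⟨fun x => by 
    rw [← CharP.cast_eq_zero_iff k p, ← map_natCast π, Subtype.ext_iff, Prod.ext_iff]
    change (x : C) = 0 ∧ (x : k) = 0 ↔ (x : k) = 0
    rw [CharP.cast_eq_zero_iff k p, CharP.cast_eq_zero_iff C p, and_self]⟩
  obtain ⟨f, hf⟩ := exists_section p π
    (fun a => by
      obtain ⟨c, hc⟩ := Ideal.Quotient.mk_surjective (g a)
      exact ⟨⟨(c, a), hc⟩, rfl⟩)
    (fun x hx => by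
      obtain ⟨⟨c, a⟩, h⟩ := x
      obtain rfl : a = 0 := hx
      have hc : c ∈ I := Ideal.Quotient.eq_zero_iff_mem.1 (h.trans (map_zero g))
      have hc2 : c ^ 2 = 0 := by
        have := Ideal.pow_mem_pow hc 2
        rwa [hI] at this
      refine Subtype.ext (Prod.ext ?_ ?_)
      · change c ^ p = 0
        exact pow_eq_zero_of_le (Fact.out : p.Prime).two_le hc2
      · change (0 : k) ^ p = 0
        exact zero_pow (Fact.out : p.Prime).ne_zero)
  let F : k →+* C := (RingHom.fst C k).comp (E.subtype.comp f)
  have hF : ∀ x : ZMod p, F (algebraMap (ZMod p) k x) = algebraMap (ZMod p) C x := fun x =>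
    congrArg (fun h : ZMod p →+* C => h x) (Subsingleton.elim (F.comp (algebraMap _ _)) _)
  refine ⟨⟨F, hF⟩, AlgHom.ext fun a => ?_⟩
  have h2 : Ideal.Quotient.mk I (f a : C × k).1 = g (f a : C × k).2 := (f a).2
  have h3 : (f a : C × k).2 = a := hf a
  rw [h3] at h2
  exact h2

variable {k} in
/-- The differential of an element that is not a `p`-th power does not vanish. -/
theorem exists_pow_eq_of_dd_eq_zero {a : k} (ha : dd a = 0) : ∃ b, b ^ p = a := by
  by_contra! hcon
  -- In the dual numbers over `k`, the element a + ε can be adjoined to the subring of p-th powers,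
  -- because a is not a p-th power. A section extending this maps a to a + ε, and its ε-part is a
  -- derivation with value 1 at a.
  let π : TrivSqZeroExt k k →+* k := (TrivSqZeroExt.fstHom k k k).toRingHom
  have : CharP (TrivSqZeroExt k k) p := charP_of_injective_ringHom
    (f := TrivSqZeroExt.inlHom k k) TrivSqZeroExt.inl_injective p
  have hπ : Function.Surjective π := fun a => ⟨TrivSqZeroExt.inl a, rfl⟩
  have hπ' (r : TrivSqZeroExt k k) : π r = r.fst := rfl
  obtain ⟨G, h1, h2, h3⟩ := exists_subring_of_notMem p π hπ (G := (frobenius (TrivSqZeroExt k k) p).range)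
    (fun r => ⟨r, rfl⟩) (by
      rintro _ ⟨r, rfl⟩ h
      rw [frobenius_def, map_pow] at h
      have h0 : r.fst = 0 := eq_zero_of_pow_eq_zero h
      have h2 : r ^ 2 = 0 := by
        rw [sq]
        ext <;> simp [h0]
      exact pow_eq_zero_of_le (Fact.out : p.Prime).two_le h2)
    (x₀ := TrivSqZeroExt.inl a + TrivSqZeroExt.inr 1) (by
      rintro _ ⟨r, rfl⟩ h
      rw [frobenius_def, map_pow] at h
      refine hcon (π r) (h.trans ?_)
      simp [hπ'])
  obtain ⟨f, hf, hfG⟩ := exists_section_of_subring p π hπ (fun r => h1 ⟨r, rfl⟩) h3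
  have hfa := hfG _ h2
  have hf' (b) : (f b).fst = b := hf b
  let D : Derivation ℤ k k := Derivation.mk'
    (AddMonoidHom.toIntLinearMap ⟨⟨fun b => (f b).snd, by simp⟩, by simp⟩) (fun b c => by
      simp only [AddMonoidHom.coe_toIntLinearMap, AddMonoidHom.coe_mk, ZeroHom.coe_mk, map_mul,
        TrivSqZeroExt.snd_mul, hf']
      simp [mul_comm])
  have hD : D a = 1 := by
    have : π (TrivSqZeroExt.inl a + TrivSqZeroExt.inr 1) = a := by simp [hπ']
    rw [this] at hfa
    change (f a).snd = 1
    rw [hfa]; simp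
  have h0 : KaehlerDifferential.D ℤ k a = 0 := ExteriorAlgebra.ι_leftInverse.injective (by
    rw [map_zero]; exact ha)
  have h4 : D.liftKaehlerDifferential (KaehlerDifferential.D ℤ k a) = D a :=
    D.liftKaehlerDifferential_comp_D a
  rw [h0, map_zero, hD] at h4
  exact zero_ne_one h4

end FormallySmooth

/-! ### Derivations of a field and differential bases -/

section Derivations

theorem derivation_iterate_mul {A : Type u} [CommRing A] (D : Derivation ℤ A A) (n : ℕ) (a b : A) :
    D^[n] (a * b) = ∑ ij ∈ Finset.HasAntidiagonal.antidiagonal n,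
      n.choose ij.1 • (D^[ij.1] a * D^[ij.2] b) := by
  induction n with
  | zero => simp
  | succ n ih =>
    rw [Finset.sum_antidiagonal_choose_succ_nsmul (M := A) (fun i j => D^[i] a * D^[j] b) n]
    simp only [Function.iterate_succ_apply', ih, map_sum, map_nsmul, Derivation.leibniz, smul_add,
      Finset.sum_add_distrib, add_right_inj, smul_eq_mul]
    refine Finset.sum_congr rfl fun ⟨i, j⟩ hij ↦ ?_
    rw [n.choose_symm_of_eq_add (Finset.HasAntidiagonal.mem_antidiagonal.1 hij).symm, mul_comm]

/-- In characteristic `p`, the `p`-th power of a derivation is a derivation. -/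
def derivationPow {A : Type u} [CommRing A] (p : ℕ) [Fact p.Prime] [CharP A p]
    (D : Derivation ℤ A A) : Derivation ℤ A A :=
  Derivation.mk' (AddMonoidHom.toIntLinearMap
    { toFun := D^[p]
      map_zero' := iterate_map_zero D p
      map_add' := iterate_map_add D p }) fun a b => by
    obtain ⟨q, hq⟩ : ∃ q, p = q + 1 :=
      ⟨p - 1, (Nat.succ_pred_eq_of_pos (Fact.out : p.Prime).pos).symm⟩
    change D^[p] (a * b) = a * D^[p] b + b * D^[p] a
    rw [derivation_iterate_mul, Finset.Nat.sum_antidiagonal_eq_sum_range_succ_mk,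
      Finset.sum_range_succ, hq, Finset.sum_range_succ', Finset.sum_eq_zero]
    · simp [mul_comm]
    · intro i hi
      have hi' := Finset.mem_range.1 hi
      have : p ∣ (q + 1).choose (i + 1) := by
        rw [← hq]
        exact (Fact.out : p.Prime).dvd_choose_self (by omega) (by omega)
      rw [nsmul_eq_mul, (CharP.cast_eq_zero_iff A p _).2 this, zero_mul]

variable {k : Type u} [Field k]

theorem derivation_eq_of_basis {I : Type*} {x : I → kˣ} (β : Module.Basis I k Ω[k⁄ℤ])
    (hβ : ∀ i, β i = dlog (x i)) {N : Type*} [AddCommGroup N] [Module k N]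
    {D D' : Derivation ℤ k N} (h : ∀ i, D (x i) = D' (x i)) : D = D' := by
  have : D.liftKaehlerDifferential = D'.liftKaehlerDifferential := β.ext fun i => by
    rw [hβ, dlog, map_smul, map_smul, D.liftKaehlerDifferential_comp_D,
      D'.liftKaehlerDifferential_comp_D, h]
  ext a
  rw [← D.liftKaehlerDifferential_comp_D, this, D'.liftKaehlerDifferential_comp_D]

variable (k) in
-- The differentials da span, so some of them form a basis. Such an a is nonzero, and dividing by it
-- makes the basis logarithmic, which is the kind of basis that the inverse Cartier operator can
-- fix.
theorem exists_dlog_basis : ∃ (I : Type u) (x : I → kˣ) (β : Module.Basis I k Ω[k⁄ℤ]),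
    ∀ i, β i = dlog (x i) := by
  have hs : ⊤ ≤ Submodule.span k (Set.range (KaehlerDifferential.D ℤ k)) := by
    rw [KaehlerDifferential.span_range_derivation]
  let b := Module.Basis.ofSpan hs
  have hb (i) : ∃ a : k, KaehlerDifferential.D ℤ k a = b i :=
    Module.Basis.ofSpan_subset hs ⟨i, rfl⟩
  choose a ha using hb
  have ha0 (i) : a i ≠ 0 := fun h => b.ne_zero i (by rw [← ha, h, map_zero])
  refine ⟨_, fun i => Units.mk0 (a i) (ha0 i),
    b.unitsSMul fun i => (Units.mk0 (a i) (ha0 i))⁻¹, fun i => ?_⟩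
  rw [Module.Basis.unitsSMul_apply, dlog, ← ha]
  rfl

/-- A ring homomorphism between algebras of forms that is semilinear along a field extension and
maps a basis of the module of differentials to a basis is injective. -/
theorem injective_of_basis {l : Type w} [Field l] (σ : k →+* l) (f : DiffAlg k →+* DiffAlg l)
    (hf : ∀ a, f (algebraMap k _ a) = algebraMap l _ (σ a)) {I : Type*}
    (β : Module.Basis I k Ω[k⁄ℤ]) (β' : Module.Basis I l Ω[l⁄ℤ])
    (h : ∀ i, f (ExteriorAlgebra.ι k (β i)) = ExteriorAlgebra.ι l (β' i)) :
    Function.Injective f := by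
  classical
  -- The order serves only to index the basis of the exterior algebra by finite subsets.
  obtain ⟨_⟩ : Nonempty (LinearOrder I) := ⟨linearOrderOfSTO WellOrderingRel⟩
  have key (s : Finset I) : f (β.ExteriorAlgebra s) = β'.ExteriorAlgebra s := by
    rw [ExteriorAlgebra.basis_apply, ExteriorAlgebra.basis_apply]
    simp only [ExteriorAlgebra.ιMulti_family, ExteriorAlgebra.ιMulti_apply, map_list_prod,
      List.map_ofFn]
    congr 2
    funext i
    exact h _
  refine (injective_iff_map_eq_zero f).2 fun z hz => ?_
  have hz' : ∑ s ∈ (β.ExteriorAlgebra.repr z).support,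
      σ (β.ExteriorAlgebra.repr z s) • β'.ExteriorAlgebra s = 0 := by
    rw [← β.ExteriorAlgebra.linearCombination_repr z, Finsupp.linearCombination_apply, Finsupp.sum,
      map_sum] at hz
    rw [← hz]
    refine Finset.sum_congr rfl fun s _ => ?_
    rw [Algebra.smul_def, Algebra.smul_def, map_mul, hf, key]
  have hli := linearIndependent_iff'.1 β'.ExteriorAlgebra.linearIndependent _ _ hz'
  have : β.ExteriorAlgebra.repr z = 0 := by
    ext s
    by_contra hs
    exact hs ((map_eq_zero σ).1 (hli s (Finsupp.mem_support_iff.2 hs)))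
  simpa using this

end Derivations

/-! ### The Cartier isomorphism -/

section Cartier

variable {k : Type u} [Field k] (p : ℕ)
  {I : Type u} {x : I → kˣ} (β : Module.Basis I k Ω[k⁄ℤ])

/-- The logarithmic partial derivative with respect to an element of a differential basis. -/
def partialD (i : I) : Derivation ℤ k k :=
  (β.coord i).compDer (KaehlerDifferential.D ℤ k)

theorem partialD_apply (i : I) (a : k) :
    partialD β i a = β.repr (KaehlerDifferential.D ℤ k a) i := rfl

theorem dd_eq_sum (hβ : ∀ i, β i = dlog (x i)) (a : k) :
    dd a = (β.repr (KaehlerDifferential.D ℤ k a)).sum fun i c => c • dlg (x i) := by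
  conv_lhs => rw [dd, ← β.linearCombination_repr (KaehlerDifferential.D ℤ k a),
    Finsupp.linearCombination_apply, Finsupp.sum, map_sum]
  refine Finset.sum_congr rfl fun i _ => ?_
  rw [map_smul, hβ]
  rfl

theorem partialD_self (hβ : ∀ i, β i = dlog (x i)) [DecidableEq I] (i j : I) :
    partialD β i (x j) = if i = j then (x j : k) else 0 := by
  have : KaehlerDifferential.D ℤ k (x j : k) = (x j : k) • β j := by
    rw [hβ, dlog, smul_smul]; simp
  rw [partialD_apply, this, map_smul, Finsupp.smul_apply, Module.Basis.repr_self,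
    Finsupp.single_apply]
  by_cases h : i = j
  · simp [h]
  · simp [h, Ne.symm h]

/-- The commutator is again a derivation, so it suffices to evaluate it on the elements `x l`, where
both derivatives act by the scalars 0 and 1. -/
theorem partialD_comm (hβ : ∀ i, β i = dlog (x i)) (i j : I) (a : k) :
    partialD β i (partialD β j a) = partialD β j (partialD β i a) := by
  classical
  have h : ⁅partialD β i, partialD β j⁆ = 0 := derivation_eq_of_basis β hβ fun l => by
    rw [Derivation.commutator_apply, partialD_self β hβ, partialD_self β hβ]
    split_ifs <;> simp_all [partialD_self β hβ]
  have := congrArg (fun D : Derivation ℤ k k => D a) h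
  simp only [Derivation.commutator_apply] at this
  exact sub_eq_zero.1 this

/-- In characteristic p the p-th iterate is a derivation too. It agrees with the derivative itself
on the elements `x l`, on which the latter acts by 0 or 1. -/
theorem partialD_iterate [Fact p.Prime] [CharP k p] (hβ : ∀ i, β i = dlog (x i)) (i : I) (a : k) :
    (partialD β i)^[p] a = partialD β i a := by
  classical
  have h : derivationPow p (partialD β i) = partialD β i := derivation_eq_of_basis β hβ fun l => by
    change (partialD β i)^[p] (x l) = _
    by_cases h : i = l
    · exact Function.iterate_fixed (by rw [partialD_self β hβ, if_pos h]) p |>.trans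
        (by rw [partialD_self β hβ, if_pos h])
    · obtain ⟨q, hq⟩ : ∃ q, p = q + 1 :=
        ⟨p - 1, (Nat.succ_pred_eq_of_pos (Fact.out : p.Prime).pos).symm⟩
      rw [hq, Function.iterate_succ_apply, partialD_self β hβ, if_neg h, iterate_map_zero]
  exact congrArg (fun D : Derivation ℤ k k => D a) h

/-- An element all of whose partial derivatives vanish is a `p`-th power. -/
theorem exists_pow_eq_of_partialD [Fact p.Prime] [CharP k p] (hβ : ∀ i, β i = dlog (x i)) {a : k}
    (ha : ∀ i, partialD β i a = 0) : ∃ b, b ^ p = a := by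
  refine exists_pow_eq_of_dd_eq_zero p ?_
  rw [dd_eq_sum β hβ, Finsupp.sum]
  exact Finset.sum_eq_zero fun i _ => by rw [← partialD_apply, ha, zero_smul]

/-- The projection onto the constants of a logarithmic partial derivative. -/
def constProj (i : I) : k →+ k where
  toFun a := a - (partialD β i)^[p - 1] a
  map_zero' := by rw [iterate_map_zero, sub_zero]
  map_add' a b := by rw [iterate_map_add]; abel

theorem constProj_apply (i : I) (a : k) : constProj p β i a = a - (partialD β i)^[p - 1] a := rfl

/-- By `partialD_iterate` the operator ∂ satisfies ∂^p = ∂, so 1 - ∂^(p-1) is the projector onto its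
kernel. -/
theorem partialD_constProj [Fact p.Prime] [CharP k p] (hβ : ∀ i, β i = dlog (x i)) (i : I) (a : k) :
    partialD β i (constProj p β i a) = 0 := by
  rw [constProj_apply, map_sub, ← Function.iterate_succ_apply' (partialD β i),
    show (p - 1).succ = p from Nat.succ_pred_eq_of_pos (Fact.out : p.Prime).pos,
    partialD_iterate p β hβ, sub_self]

theorem partialD_constProj_of_eq_zero (hβ : ∀ i, β i = dlog (x i)) (i j : I) {a : k}
    (ha : partialD β j a = 0) : partialD β j (constProj p β i a) = 0 := by
  have (n : ℕ) : partialD β j ((partialD β i)^[n] a) = 0 := by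
    induction n with
    | zero => exact ha
    | succ n h => rw [Function.iterate_succ_apply', partialD_comm β hβ, h, map_zero]
  rw [constProj_apply, map_sub, ha, this, sub_zero]

theorem constProj_of_eq_zero (i : I) {a : k} (ha : partialD β i a = 0) (hp : 2 ≤ p) :
    constProj p β i a = a := by
  obtain ⟨q, hq⟩ : ∃ q, p - 1 = q + 1 := ⟨p - 2, by omega⟩
  rw [constProj_apply, hq, Function.iterate_succ_apply, ha, iterate_map_zero, sub_zero]

/-- The iterated projection along a list of indices. -/
def constProjList (T : List I) (a : k) : k := T.foldr (fun i a => constProj p β i a) a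

theorem partialD_constProjList [Fact p.Prime] [CharP k p] (hβ : ∀ i, β i = dlog (x i)) (T : List I) (a : k) (j : I)
    (h : j ∈ T ∨ partialD β j a = 0) : partialD β j (constProjList p β T a) = 0 := by
  induction T with
  | nil => simpa [constProjList] using h
  | cons i T hT =>
    change partialD β j (constProj p β i (constProjList p β T a)) = 0
    by_cases hij : j = i
    · subst hij; exact partialD_constProj p β hβ _ _
    · exact partialD_constProj_of_eq_zero p β hβ i j (hT (by simpa [hij] using h))

/-! #### Lie derivatives -/

/-- The product of the logarithmic differentials of a list of basis elements. -/
abbrev dlogList (x : I → kˣ) (l : List I) : DiffAlg k := dlogs (l.map x)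

theorem mem_closure_dlogList (hβ : ∀ i, β i = dlog (x i)) (z : DiffAlg k) :
    z ∈ AddSubgroup.closure {y : DiffAlg k | ∃ (a : k) (l : List I), y = a • dlogList x l} := by
  set S := AddSubgroup.closure {y : DiffAlg k | ∃ (a : k) (l : List I), y = a • dlogList x l}
  have mem (a : k) (l : List I) : a • dlogList x l ∈ S := AddSubgroup.subset_closure ⟨a, l, rfl⟩
  induction z using diffAlg_induction with
  | algebraMap a => simpa [dlogList, Algebra.algebraMap_eq_smul_one] using mem a []
  | der a =>
    rw [dd_eq_sum β hβ]
    exact sum_mem fun i _ => by simpa [dlogList] using mem _ [i]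
  | add y z hy hz => exact add_mem hy hz
  | mul y z hy hz =>
    induction hy using AddSubgroup.closure_induction with
    | zero => simp
    | add y y' _ _ h h' => rw [add_mul]; exact add_mem h h'
    | neg y _ h => rw [neg_mul]; exact neg_mem h
    | mem y hy =>
      obtain ⟨a, l, rfl⟩ := hy
      induction hz using AddSubgroup.closure_induction with
      | zero => simp
      | add y y' _ _ h h' => rw [mul_add]; exact add_mem h h'
      | neg y _ h => rw [mul_neg]; exact neg_mem h
      | mem z hz =>
        obtain ⟨b, l', rfl⟩ := hz
        rw [smul_mul_assoc, mul_smul_comm, smul_smul, ← dlogs_append, ← List.map_append]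
        exact mem _ _

/-- Contraction of forms with a logarithmic partial derivative. -/
def contract (i : I) : DiffAlg k →ₗ[k] DiffAlg k :=
  CliffordAlgebra.contractLeft (Q := (0 : QuadraticForm k Ω[k⁄ℤ])) (β.coord i)

theorem contract_dd_mul (i : I) (a : k) (z : DiffAlg k) :
    contract β i (dd a * z) = partialD β i a • z - dd a * contract β i z :=
  CliffordAlgebra.contractLeft_ι_mul _ _ _

/-- The Lie derivative of forms along a logarithmic partial derivative. -/
def lieD (i : I) : DiffAlg k →+ DiffAlg k :=
  (extD k).comp (contract β i).toAddMonoidHom + (contract β i).toAddMonoidHom.comp (extD k)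

theorem lieD_apply (i : I) (z : DiffAlg k) :
    lieD β i z = extD k (contract β i z) + contract β i (extD k z) := rfl

theorem lieD_extD (i : I) (z : DiffAlg k) : lieD β i (extD k z) = extD k (lieD β i z) := by
  rw [lieD_apply, lieD_apply, extD_extD, map_zero, map_add, extD_extD, add_zero, zero_add]

/-- Contracting a product of basic logarithmic differentials gives an integral combination of
shorter products, which is closed. The Lie derivative therefore sees only the coefficient, and the
projections on functions and on forms correspond. -/
theorem lieD_smul_dlogList (hβ : ∀ i, β i = dlog (x i)) (i : I) (a : k) (l : List I) :
    lieD β i (a • dlogList x l) = partialD β i a • dlogList x l := by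
  classical
  have h (l : List I) : extD k (contract β i (dlogList x l)) = 0 := by
    induction l with
    | nil => simp [contract, dlogList]
    | cons j l h =>
      have : contract β i (dlogList x (j :: l)) =
          (if i = j then (1 : k) else 0) • dlogList x l - dlg (x j) * contract β i (dlogList x l) := by
        simp only [dlogList, List.map_cons, dlogs_cons]
        refine (CliffordAlgebra.contractLeft_ι_mul _ _ _).trans ?_
        rw [← hβ, Module.Basis.coord_apply, Module.Basis.repr_self, Finsupp.single_apply]
        simp only [eq_comm]
        rw [hβ]
        rfl
      rw [this, map_sub, extD_dlg_mul, h, mul_zero, neg_zero, sub_zero]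
      split_ifs
      · rw [one_smul, extD_dlogs]
      · simp
  rw [lieD_apply, map_smul, extD_smul, h, extD_smul_dlogs, contract_dd_mul]
  simp

/-- The projection of forms along a list of indices. -/
def formProj : List I → DiffAlg k →+ DiffAlg k
  | [] => AddMonoidHom.id _
  | i :: T =>
    { toFun := fun z => formProj T z - (lieD β i)^[p - 1] (formProj T z)
      map_zero' := by rw [map_zero, iterate_map_zero, sub_zero]
      map_add' := fun a b => by rw [map_add, iterate_map_add]; abel }

theorem formProj_cons (i : I) (T : List I) (z : DiffAlg k) :
    formProj p β (i :: T) z = formProj p β T z - (lieD β i)^[p - 1] (formProj p β T z) := rfl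

theorem formProj_smul_dlogList (hβ : ∀ i, β i = dlog (x i)) (T : List I) (a : k) (l : List I) :
    formProj p β T (a • dlogList x l) = constProjList p β T a • dlogList x l := by
  induction T with
  | nil => rfl
  | cons i T h =>
    have key (n : ℕ) (a : k) :
        (lieD β i)^[n] (a • dlogList x l) = (partialD β i)^[n] a • dlogList x l := by
      induction n with
      | zero => rfl
      | succ n h =>
        rw [Function.iterate_succ_apply', h, lieD_smul_dlogList β hβ, Function.iterate_succ_apply']
    rw [formProj_cons, h, key, ← sub_smul]
    rfl

theorem formProj_extD (T : List I) (z : DiffAlg k) :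
    formProj p β T (extD k z) = extD k (formProj p β T z) := by
  induction T with
  | nil => rfl
  | cons i T h =>
    have key (n : ℕ) (z : DiffAlg k) :
        (lieD β i)^[n] (extD k z) = extD k ((lieD β i)^[n] z) := by
      induction n with
      | zero => rfl
      | succ n h =>
        rw [Function.iterate_succ_apply', h, lieD_extD, Function.iterate_succ_apply']
    rw [formProj_cons, formProj_cons, h, key, map_sub]

/-- By Cartan's formula the Lie derivative of a closed form is exact, and it commutes with d. As p -
1 is at least 1, each projector 1 - L^(p-1) changes a closed form by an exact one. -/
theorem exists_eq_formProj_add (T : List I) {z : DiffAlg k} (hz : extD k z = 0) (hp : 2 ≤ p) :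
    ∃ η, z = formProj p β T z + extD k η := by
  induction T with
  | nil => exact ⟨0, by rw [map_zero, add_zero]; rfl⟩
  | cons i T h =>
    obtain ⟨η, hη⟩ := h
    have hc : extD k (formProj p β T z) = 0 := by rw [← formProj_extD, hz, map_zero]
    have key (n : ℕ) : ∃ ξ, (lieD β i)^[n + 1] (formProj p β T z) = extD k ξ := by
      induction n with
      | zero =>
        exact ⟨contract β i (formProj p β T z), by
          change lieD β i (formProj p β T z) = _
          rw [lieD_apply, hc, map_zero, add_zero]⟩
      | succ n h =>
        obtain ⟨ξ, hξ⟩ := h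
        exact ⟨lieD β i ξ, by rw [Function.iterate_succ_apply', hξ, lieD_extD]⟩
    obtain ⟨ξ, hξ⟩ := key (p - 2)
    refine ⟨η + ξ, ?_⟩
    rw [formProj_cons, show p - 1 = p - 2 + 1 by omega, hξ, map_add]
    nth_rewrite 1 [hη]
    abel

variable [Fact p.Prime] [CharP k p]

/-- The Frobenius-semilinear endomorphism of the module of differentials that fixes a basis. -/
def frobDiff : Ω[k⁄ℤ] →+ Ω[k⁄ℤ] :=
  (Finsupp.liftAddHom fun i => ((LinearMap.toSpanSingleton k Ω[k⁄ℤ] (β i)).toAddMonoidHom.comp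
    (frobenius k p).toAddMonoidHom)).comp β.repr.toLinearMap.toAddMonoidHom

theorem frobDiff_smul_basis (a : k) (i : I) : frobDiff p β (a • β i) = a ^ p • β i := by
  change Finsupp.liftAddHom _ (β.repr (a • β i)) = _
  rw [map_smul, Module.Basis.repr_self, Finsupp.smul_single, smul_eq_mul, mul_one,
    Finsupp.liftAddHom_apply_single]
  rfl

theorem frobDiff_basis (i : I) : frobDiff p β (β i) = β i := by
  simpa using frobDiff_smul_basis p β 1 i

theorem frobDiff_smul (a : k) (ω : Ω[k⁄ℤ]) :
    frobDiff p β (a • ω) = a ^ p • frobDiff p β ω := by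
  have hω : ω ∈ Submodule.span k (Set.range β) := β.mem_span ω
  induction hω using Submodule.closure_induction with
  | zero => simp
  | add y z _ _ hy hz => simp only [smul_add, map_add, hy, hz]
  | smul_mem c y hy =>
    obtain ⟨i, rfl⟩ := hy
    rw [smul_smul, frobDiff_smul_basis, frobDiff_smul_basis, mul_pow, smul_smul]

/-- The Frobenius endomorphism of the algebra of forms attached to a differential basis: it is a
lift of the inverse Cartier operator. -/
def frobForms : DiffAlg k →+* DiffAlg k :=
  formsLift ((algebraMap k (DiffAlg k)).comp (frobenius k p))
    (fun a _ => Algebra.commutes (R := k) (A := DiffAlg k) (a ^ p) _)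
    ((ExteriorAlgebra.ι k).toAddMonoidHom.comp ((frobDiff p β).comp
      (KaehlerDifferential.D ℤ k).toLinearMap.toAddMonoidHom))
    (fun a b => by
      change ExteriorAlgebra.ι k (frobDiff p β (KaehlerDifferential.D ℤ k (a * b))) = _
      rw [Derivation.leibniz, map_add, frobDiff_smul, frobDiff_smul, map_add, map_smul, map_smul,
        Algebra.smul_def, Algebra.smul_def]
      rfl)
    (fun a => ExteriorAlgebra.ι_sq_zero _)

omit [Fact (Nat.Prime p)] in
theorem dd_pow_char (a : k) : dd (a ^ p) = 0 := by
  rw [dd, Derivation.leibniz_pow, ← Nat.cast_smul_eq_nsmul k, CharP.cast_eq_zero, zero_smul,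
    map_zero]

theorem frobForms_algebraMap (a : k) :
    frobForms p β (algebraMap k _ a) = algebraMap k _ (a ^ p) :=
  formsLift_algebraMap _ _ _ _ _ a

theorem frobForms_smul (a : k) (z : DiffAlg k) :
    frobForms p β (a • z) = a ^ p • frobForms p β z := by
  rw [Algebra.smul_def, map_mul, frobForms_algebraMap, Algebra.smul_def]

theorem frobForms_dd (a : k) : frobForms p β (dd a) =
    ExteriorAlgebra.ι k (frobDiff p β (KaehlerDifferential.D ℤ k a)) :=
  formsLift_dd _ _ _ _ _ a

theorem frobForms_dlg (hβ : ∀ i, β i = dlog (x i)) (i : I) :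
    frobForms p β (dlg (x i)) = dlg (x i) := by
  have : KaehlerDifferential.D ℤ k (x i : k) = (x i : k) • β i := by
    rw [hβ, dlog, smul_smul]; simp
  rw [dlg_eq, frobForms_smul, frobForms_dd, this, frobDiff_smul, frobDiff_basis, map_smul, hβ,
    smul_smul, ← mul_pow]
  simp only [Units.inv_mul, one_pow, one_smul]
  exact dlg_eq (x i)

theorem frobForms_dlogList (hβ : ∀ i, β i = dlog (x i)) (l : List I) :
    frobForms p β (dlogList x l) = dlogList x l := by
  induction l with
  | nil => simp [dlogList]
  | cons i l h =>
    simp only [dlogList, List.map_cons, dlogs_cons] at h ⊢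
    rw [map_mul, h, frobForms_dlg p β hβ]

theorem frobForms_injective (hβ : ∀ i, β i = dlog (x i)) :
    Function.Injective (frobForms p β) :=
  injective_of_basis (frobenius k p) _ (frobForms_algebraMap p β) β β fun i => by
    rw [hβ]; exact frobForms_dlg p β hβ i

theorem involute_frobForms (z : DiffAlg k) :
    CliffordAlgebra.involute (frobForms p β z) = frobForms p β (CliffordAlgebra.involute z) := by
  induction z using diffAlg_induction with
  | algebraMap a => rw [frobForms_algebraMap, involute_algebraMap, involute_algebraMap,
      frobForms_algebraMap]
  | der a =>
    rw [involute_dd, map_neg, frobForms_dd]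
    exact CliffordAlgebra.involute_ι _
  | mul x y hx hy => simp only [map_mul, hx, hy]
  | add x y hx hy => simp only [map_add, hx, hy]

theorem constProjList_pow (T : List I) (c : k) : constProjList p β T (c ^ p) = c ^ p := by
  have h (i) : partialD β i (c ^ p) = 0 := by
    rw [Derivation.leibniz_pow, ← Nat.cast_smul_eq_nsmul k, CharP.cast_eq_zero, zero_smul]
  induction T with
  | nil => rfl
  | cons i T hT =>
    change constProj p β i (constProjList p β T (c ^ p)) = c ^ p
    rw [hT, constProj_of_eq_zero p β i (h i) (Fact.out : p.Prime).two_le]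

theorem formProj_frobForms (hβ : ∀ i, β i = dlog (x i)) (T : List I) (z : DiffAlg k) :
    formProj p β T (frobForms p β z) = frobForms p β z := by
  induction mem_closure_dlogList β hβ z using AddSubgroup.closure_induction with
  | zero => simp
  | add y y' _ _ h h' => simp only [map_add, h, h']
  | neg y _ h => simp only [map_neg, h]
  | mem y hy =>
    obtain ⟨a, l, rfl⟩ := hy
    rw [frobForms_smul, frobForms_dlogList p β hβ, formProj_smul_dlogList p β hβ,
      constProjList_pow]

/-- A coefficient has only finitely many nonzero partial derivatives. Projecting along the
corresponding indices makes all of them vanish, so the coefficient becomes a p-th power. -/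
theorem exists_formProj_eq (hβ : ∀ i, β i = dlog (x i)) (z : DiffAlg k) :
    ∃ T, ∃ y, formProj p β T z = frobForms p β y := by
  -- All larger lists are allowed, so that the lists found for two summands can be concatenated.
  suffices ∃ T : List I, ∀ T', T ⊆ T' → ∃ y, formProj p β T' z = frobForms p β y by
    obtain ⟨T, hT⟩ := this
    exact ⟨T, hT T (List.Subset.refl T)⟩
  induction mem_closure_dlogList β hβ z using AddSubgroup.closure_induction with
  | zero => exact ⟨[], fun T' _ => ⟨0, by simp⟩⟩
  | add y y' _ _ h h' =>
    obtain ⟨⟨T, hT⟩, T', hT'⟩ := And.intro h h'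
    refine ⟨T ++ T', fun S hS => ?_⟩
    obtain ⟨u, hu⟩ := hT S fun i hi => hS (List.mem_append_left _ hi)
    obtain ⟨u', hu'⟩ := hT' S fun i hi => hS (List.mem_append_right _ hi)
    exact ⟨u + u', by simp only [map_add, hu, hu']⟩
  | neg y _ h =>
    obtain ⟨T, hT⟩ := h
    refine ⟨T, fun S hS => ?_⟩
    obtain ⟨u, hu⟩ := hT S hS
    exact ⟨-u, by simp only [map_neg, hu]⟩
  | mem y hy =>
    obtain ⟨a, l, rfl⟩ := hy
    refine ⟨(β.repr (KaehlerDifferential.D ℤ k a)).support.toList, fun S hS => ?_⟩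
    obtain ⟨c, hc⟩ := exists_pow_eq_of_partialD p β hβ (a := constProjList p β S a) fun j =>
      partialD_constProjList p β hβ S a j (by
        by_cases h : partialD β j a = 0
        · exact Or.inr h
        · exact Or.inl (hS (by simpa [partialD_apply] using h)))
    refine ⟨c • dlogList x l, ?_⟩
    rw [formProj_smul_dlogList p β hβ, frobForms_smul, frobForms_dlogList p β hβ, hc]

theorem extD_frobForms (hβ : ∀ i, β i = dlog (x i)) (z : DiffAlg k) :
    extD k (frobForms p β z) = 0 := by
  induction mem_closure_dlogList β hβ z using AddSubgroup.closure_induction with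
  | zero => simp
  | add y y' _ _ h h' => simp only [map_add, h, h', add_zero]
  | neg y _ h => simp only [map_neg, h, neg_zero]
  | mem y hy =>
    obtain ⟨a, l, rfl⟩ := hy
    rw [frobForms_smul, frobForms_dlogList p β hβ, dlogList, extD_smul_dlogs, dd_pow_char,
      zero_mul]

/-- Injectivity of the inverse Cartier operator: project along a list that moves `η` into the image
of the Frobenius. The left side is fixed by the projection, while the right side becomes the
differential of a closed form. -/
theorem eq_zero_of_frobForms_eq_extD (hβ : ∀ i, β i = dlog (x i)) {z η : DiffAlg k}
    (h : frobForms p β z = extD k η) : z = 0 := by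
  obtain ⟨T, y, hy⟩ := exists_formProj_eq p β hβ η
  have h1 := congrArg (formProj p β T) h
  rw [formProj_frobForms p β hβ, formProj_extD, hy, extD_frobForms p β hβ] at h1
  exact (map_eq_zero_iff _ (frobForms_injective p β hβ)).1 h1

/-- Surjectivity of the inverse Cartier operator: modulo exact forms a closed form equals its
projections, and a long enough projection is in the image of the Frobenius. -/
theorem exists_eq_frobForms_add (hβ : ∀ i, β i = dlog (x i)) {z : DiffAlg k}
    (hz : extD k z = 0) : ∃ y η, z = frobForms p β y + extD k η := by
  obtain ⟨T, y, hy⟩ := exists_formProj_eq p β hβ z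
  obtain ⟨η, hη⟩ := exists_eq_formProj_add p β T hz (Fact.out : p.Prime).two_le
  exact ⟨y, η, by rw [← hy, ← hη]⟩

theorem frobForms_mem_closure (hβ : ∀ i, β i = dlog (x i)) (z : DiffAlg k) :
    frobForms p β z ∈
      AddSubgroup.closure {y : DiffAlg k | ∃ (a : k) (l : List kˣ), y = a ^ p • dlogs l} := by
  induction mem_closure_dlogList β hβ z using AddSubgroup.closure_induction with
  | zero => simp
  | add y y' _ _ h h' => rw [map_add]; exact add_mem h h'
  | neg y _ h => rw [map_neg]; exact neg_mem h
  | mem y hy =>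
    obtain ⟨a, l, rfl⟩ := hy
    rw [frobForms_smul, frobForms_dlogList p β hβ]
    exact AddSubgroup.subset_closure ⟨a, _, rfl⟩

theorem frobForms_sub_mem_relTotal (hβ : ∀ i, β i = dlog (x i)) (z : DiffAlg k) :
    frobForms p β z - z ∈ relTotal k p := by
  induction mem_closure_dlogList β hβ z using AddSubgroup.closure_induction with
  | zero => simp
  | add y y' _ _ h h' => rw [map_add, add_sub_add_comm]; exact add_mem h h'
  | neg y _ h => rw [map_neg, ← neg_sub', ]; exact neg_mem h
  | mem y hy =>
    obtain ⟨a, l, rfl⟩ := hy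
    rw [frobForms_smul, frobForms_dlogList p β hβ, ← sub_smul]
    exact pow_sub_smul_dlogs_mem_relTotal p _ _

/-- A copy of the algebra of forms with the scalars acting through the Frobenius. -/
def FrobTwist (k : Type u) [Field k] (_ : ℕ) : Type u := DiffAlg k

instance : AddCommGroup (FrobTwist k p) := inferInstanceAs (AddCommGroup (DiffAlg k))

instance : Module k (FrobTwist k p) :=
  letI : Module k (FrobTwist k p) := inferInstanceAs (Module k (DiffAlg k))
  Module.compHom (FrobTwist k p) (frobenius k p)

/-- Modulo exact forms, and with scalars acting through the Frobenius, both c ↦ c^(p-1) dc and c ↦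
Φ(dc) are derivations; additivity of the first is `exists_dd_eq`. They agree on the elements whose
logarithmic differentials form the basis, hence everywhere. -/
theorem exists_pow_smul_dd_eq (hβ : ∀ i, β i = dlog (x i)) (c : k) :
    ∃ η, c ^ (p - 1) • dd c = frobForms p β (dd c) + extD k η := by
  have hp : p.Prime := Fact.out
  -- Exact forms are stable under multiplication by p-th powers, hence a submodule for the twisted
  -- action.
  let B : Submodule k (FrobTwist k p) :=
    { carrier := {z | ∃ η, extD k η = z}
      zero_mem' := ⟨0, map_zero _⟩
      add_mem' := by
        rintro _ _ ⟨η, rfl⟩ ⟨η', rfl⟩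
        exact ⟨η + η', map_add _ _ _⟩
      smul_mem' := by
        rintro a _ ⟨η, rfl⟩
        refine ⟨a ^ p • η, ?_⟩
        rw [extD_smul, dd_pow_char, zero_mul, zero_add]
        rfl }
  let q : DiffAlg k →+ FrobTwist k p ⧸ B := B.mkQ.toAddMonoidHom
  have hq (a : k) (z : DiffAlg k) : q (a ^ p • z) = a • q z := B.mkQ.map_smul a z
  have hq0 (z : DiffAlg k) : q z = 0 ↔ ∃ η, extD k η = z := Submodule.Quotient.mk_eq_zero B
  have hpow (a : k) : a ^ p = a ^ (p - 1) * a := by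
    rw [← pow_succ, Nat.sub_add_cancel hp.pos]
  let D₁ : Derivation ℤ k (FrobTwist k p ⧸ B) := Derivation.mk' (AddMonoidHom.toIntLinearMap
    { toFun := fun c => q (c ^ (p - 1) • dd c)
      map_zero' := by rw [dd_zero, smul_zero, map_zero]
      map_add' := fun a b => by
        obtain ⟨c, hc⟩ := exists_dd_eq hp a b
        rw [hc, map_add, map_add, (hq0 (dd c)).2 ⟨algebraMap _ _ c, extD_algebraMap c⟩,
          add_zero] }) fun a b => by
    change q ((a * b) ^ (p - 1) • dd (a * b)) = a • q (b ^ (p - 1) • dd b) + b • q (a ^ (p - 1) • dd a)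
    rw [← hq, ← hq, dd_mul, smul_add, map_add, smul_smul, smul_smul, smul_smul, smul_smul,
      mul_pow, hpow a, hpow b]
    congr 3 <;> ring
  let D₂ : Derivation ℤ k (FrobTwist k p ⧸ B) := Derivation.mk' (AddMonoidHom.toIntLinearMap
    { toFun := fun c => q (frobForms p β (dd c))
      map_zero' := by rw [dd_zero, map_zero, map_zero]
      map_add' := fun a b => by rw [dd_add, map_add, map_add] }) fun a b => by
    change q (frobForms p β (dd (a * b))) = a • q (frobForms p β (dd b)) + b • q (frobForms p β (dd a))
    rw [← hq, ← hq, dd_mul, map_add, map_add, frobForms_smul, frobForms_smul]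
  have h : D₁ = D₂ := derivation_eq_of_basis β hβ fun i => by
    change q ((x i : k) ^ (p - 1) • dd (x i : k)) = q (frobForms p β (dd (x i : k)))
    rw [← smul_dlg, frobForms_smul, frobForms_dlg p β hβ, smul_smul, ← hpow]
  have hc : q (c ^ (p - 1) • dd c) = q (frobForms p β (dd c)) :=
    congrArg (fun D : Derivation ℤ k (FrobTwist k p ⧸ B) => D c) h
  rw [← sub_eq_zero, ← map_sub, hq0] at hc
  obtain ⟨η, hη⟩ := hc
  exact ⟨η, by rw [hη]; abel⟩

end Cartier

/-- The Cartier isomorphism: there is an endomorphism of the algebra of forms that lifts the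
inverse Cartier operator. -/
theorem exists_inverseCartier (k : Type u) [Field k] (p : ℕ) [Fact p.Prime] [CharP k p] :
    ∃ Φ : DiffAlg k →+* DiffAlg k,
      (∀ a, Φ (algebraMap k _ a) = algebraMap k _ (a ^ p)) ∧
      (∀ z, extD k (Φ z) = 0) ∧
      (∀ z, CliffordAlgebra.involute (Φ z) = Φ (CliffordAlgebra.involute z)) ∧
      (∀ z η, Φ z = extD k η → z = 0) ∧
      (∀ z, Φ z - z ∈ relTotal k p) ∧
      (∀ c, ∃ η, c ^ (p - 1) • dd c = Φ (dd c) + extD k η) ∧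
      (∀ z, extD k z = 0 → ∃ y η, z = Φ y + extD k η) ∧
      ∀ z, Φ z ∈ AddSubgroup.closure
        {y : DiffAlg k | ∃ (a : k) (l : List kˣ), y = a ^ p • dlogs l} := by
  obtain ⟨I, x, β, hβ⟩ := exists_dlog_basis k
  exact ⟨frobForms p β, frobForms_algebraMap p β, extD_frobForms p β hβ, involute_frobForms p β,
    fun _ _ => eq_zero_of_frobForms_eq_extD p β hβ, frobForms_sub_mem_relTotal p β hβ,
    exists_pow_smul_dd_eq p β hβ, fun _ => exists_eq_frobForms_add p β hβ,
    frobForms_mem_closure p β hβ⟩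

/-! ### Differential forms of Hahn series -/

section CoeffMap

variable {Γ : Type w} {R S : Type*}

/-- The additive map of Hahn series given by additive maps on the coefficients. -/
def coeffMap [PartialOrder Γ] [AddCommGroup R] [AddCommGroup S] (φ : Γ → R →+ S) :
    HahnSeries Γ R →+ HahnSeries Γ S where
  toFun x :=
    { coeff := fun a => φ a (x.coeff a)
      isPWO_support' := x.isPWO_support.mono fun a h h' => h (by
        simp only [h', map_zero]) }
  map_zero' := HahnSeries.ext (funext fun _ => map_zero _)
  map_add' x y := HahnSeries.ext (funext fun _ => map_add _ _ _)

@[simp] theorem coeff_coeffMap [PartialOrder Γ] [AddCommGroup R] [AddCommGroup S]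
    (φ : Γ → R →+ S) (x : HahnSeries Γ R) (a : Γ) :
    (coeffMap φ x).coeff a = φ a (x.coeff a) := rfl

theorem support_coeffMap_subset [PartialOrder Γ] [AddCommGroup R] [AddCommGroup S]
    (φ : Γ → R →+ S) (x : HahnSeries Γ R) : (coeffMap φ x).support ⊆ x.support :=
  fun a h h' => h (by rw [coeff_coeffMap, h', map_zero])

theorem coeffMap_id [PartialOrder Γ] [AddCommGroup R] (x : HahnSeries Γ R) :
    coeffMap (fun _ => AddMonoidHom.id R) x = x := rfl

/-- A Hahn series all of whose coefficients are in the image of additive maps is in the image of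
the induced map. -/
theorem exists_coeffMap_eq [PartialOrder Γ] [AddCommGroup R] [AddCommGroup S]
    (φ : Γ → R →+ S) (y : HahnSeries Γ S) (h : ∀ a, ∃ r, φ a r = y.coeff a) :
    ∃ x, coeffMap φ x = y := by
  classical
  choose r hr using h
  refine ⟨⟨fun a => if y.coeff a = 0 then 0 else r a, y.isPWO_support.mono fun a ha h' =>
    ha (if_pos h')⟩, ?_⟩
  ext a
  rw [coeff_coeffMap]
  dsimp only
  split_ifs with h
  · rw [map_zero, h]
  · exact hr a

variable [AddCommGroup Γ] [PartialOrder Γ] [IsOrderedAddMonoid Γ]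

theorem coeff_coeffMap_mul_coeffMap {R' : Type*} [AddCommGroup R] [AddCommGroup R'] [Ring S]
    (φ : Γ → R →+ S) (ψ : Γ → R' →+ S) (x : HahnSeries Γ R) (y : HahnSeries Γ R') (a : Γ) :
    (coeffMap φ x * coeffMap ψ y).coeff a =
      ∑ ij ∈ Finset.antidiagonal x.isPWO_support y.isPWO_support a,
        φ ij.1 (x.coeff ij.1) * ψ ij.2 (y.coeff ij.2) := by
  rw [HahnSeries.coeff_mul]
  refine Finset.sum_subset ?_ ?_
  · intro ij h
    rw [Finset.mem_antidiagonal] at h ⊢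
    exact ⟨support_coeffMap_subset φ x h.1, support_coeffMap_subset ψ y h.2.1, h.2.2⟩
  · intro ij h h'
    rw [Finset.mem_antidiagonal] at h h'
    by_contra h0
    exact h' ⟨fun h1 => h0 (by rw [h1, zero_mul]), fun h1 => h0 (by rw [h1, mul_zero]), h.2.2⟩

theorem coeff_coeffMap_mul [Ring R] [AddCommGroup S] (φ : Γ → R →+ S)
    (x y : HahnSeries Γ R) (a : Γ) :
    (coeffMap φ (x * y)).coeff a = ∑ ij ∈ Finset.antidiagonal x.isPWO_support y.isPWO_support a,
        φ (ij.1 + ij.2) (x.coeff ij.1 * y.coeff ij.2) := by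
  rw [coeff_coeffMap, HahnSeries.coeff_mul, map_sum]
  refine Finset.sum_congr rfl fun ij h => ?_
  rw [(Finset.mem_antidiagonal.1 h).2.2]

theorem sum_antidiagonal_swap {M : Type*} [AddCommMonoid M] {s t : Set Γ} (hs : s.IsPWO)
    (ht : t.IsPWO) (a : Γ) (f : Γ × Γ → M) :
    ∑ ij ∈ Finset.antidiagonal hs ht a, f ij.swap = ∑ ij ∈ Finset.antidiagonal ht hs a, f ij := by
  refine Finset.sum_nbij' Prod.swap Prod.swap ?_ ?_ ?_ ?_ ?_ <;>
    simp +contextual [Finset.mem_antidiagonal, add_comm, and_comm]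

end CoeffMap

/-! ### Pairs of forms as coefficients of a power of the uniformizer -/

section Pairs

variable {l : Type u} [CommRing l]

@[simp] theorem fst_add' (x y : Pairs l) : (x + y).fst = x.fst + y.fst := rfl

@[simp] theorem second_neg (x : Pairs l) : second (-x) = -second x := rfl

@[simp] theorem second_sub (x y : Pairs l) : second (x - y) = second x - second y := rfl

variable (l) in
/-- The map `x ↦ (x, 0)`. -/
def pairInl : DiffAlg l →+* Pairs l where
  toFun x := pair x 0
  map_one' := pair_ext (by simp) (by simp)
  map_zero' := pair_ext (by simp) (by simp)
  map_add' x y := pair_ext (by simp) (by simp)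
  map_mul' x y := pair_ext (by simp) (by simp)

theorem pairInl_apply (x : DiffAlg l) : pairInl l x = pair x 0 := rfl

theorem pair_algebraMap_mul_comm (a : l) (z : Pairs l) :
    pairInl l (algebraMap l _ a) * z = z * pairInl l (algebraMap l _ a) :=
  pair_ext (by simp [pairInl_apply, Algebra.commutes])
    (by simp [pairInl_apply, Algebra.commutes])

/-- The involution of the ring of pairs. -/
def pairInv : Pairs l →+* Pairs l where
  toFun z := pair (CliffordAlgebra.involute z.fst) (-CliffordAlgebra.involute (second z))
  map_one' := pair_ext (by simp) (by simp)
  map_zero' := pair_ext (by simp) (by simp)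
  map_add' x y := pair_ext (by simp) (by simp; abel)
  map_mul' x y := pair_ext (by simp) (by simp; abel)

/-- The derivative twisted by a constant: if `(x, y)` stands for the form
`t ^ c (x + dt / t ∧ y)`, then this is the exterior derivative. -/
def pairD (c : l) : Pairs l →+ Pairs l where
  toFun z := pair (extD l z.fst) (c • z.fst - extD l (second z))
  map_zero' := pair_ext (by simp) (by simp)
  map_add' x y := pair_ext (by simp) (by simp [smul_add]; abel)

theorem pairD_apply (c : l) (z : Pairs l) :
    pairD c z = pair (extD l z.fst) (c • z.fst - extD l (second z)) := rfl

theorem pairD_mul (c c' : l) (z z' : Pairs l) :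
    pairD (c + c') (z * z') = pairD c z * z' + pairInv z * pairD c' z' := by
  refine pair_ext ?_ ?_
  · simp [pairD_apply, pairInv, extD_mul]
  · simp only [pairD_apply, pairInv, RingHom.coe_mk, MonoidHom.coe_mk, OneHom.coe_mk, second_add,
      second_mul, second_pair, fst_pair, TrivSqZeroExt.fst_mul, map_add, extD_mul,
      CliffordAlgebra.involute_involute, involute_extD]
    simp only [add_smul, mul_sub, sub_mul, smul_mul_assoc, mul_smul_comm, neg_mul]
    abel

theorem pairD_pairD (c : l) (hc : dd c = 0) (z : Pairs l) :
    pairD c (pairD c z) = 0 := by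
  refine pair_ext ?_ ?_ <;> simp [pairD_apply, extD_extD, extD_smul, hc]

end Pairs

/-! ### Forms of a field of Hahn series as series of pairs -/

section Theta

variable {Γ : Type w} [AddCommGroup Γ] [LinearOrder Γ] [IsOrderedAddMonoid Γ]
  {l : Type u} [Field l] (χ : Γ →+ l)

/-- The map `x ↦ (x, 0)` on constants. -/
def pairConst : l →+ Pairs l := ((pairInl l).comp (algebraMap l (DiffAlg l))).toAddMonoidHom

theorem pairConst_apply (x : l) : pairConst x = pair (algebraMap l _ x) 0 := rfl

/-- The map `x ↦ (dx, c x)`: the logarithmic derivative of `t ^ c x`. -/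
def pairDer (c : l) : l →+ Pairs l where
  toFun f := pair (dd f) (algebraMap l _ (c * f))
  map_zero' := pair_ext (by simp [dd_zero]) (by simp)
  map_add' := fun f g => pair_ext (by simp [dd_add]) (by simp [mul_add])

theorem pairDer_apply (c x : l) : pairDer c x = pair (dd x) (algebraMap l _ (c * x)) := rfl

theorem pairDer_mul_swap (c c' x y : l) :
    pairDer c x * pairDer c' y + pairDer c' y * pairDer c x = 0 := by
  refine pair_ext ?_ ?_
  · simpa [pairDer_apply] using dd_mul_swap x y
  · simp only [pairDer_apply, second_add, second_mul, fst_pair, second_pair, involute_dd,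
      second_zero, neg_mul]
    rw [Algebra.commutes (c' * y), Algebra.commutes (c * x)]
    abel

theorem pairDer_sq (c x : l) : pairDer c x * pairDer c x = 0 := by
  refine pair_ext ?_ ?_
  · simp [pairDer_apply, dd_sq]
  · simp only [pairDer_apply, second_mul, fst_pair, second_pair, involute_dd, second_zero, neg_mul]
    rw [Algebra.commutes (c * x), neg_add_cancel]

/-- The Hahn series with the constant forms as coefficients. -/
def hahnInl : HahnSeries Γ l →+* HahnSeries Γ (Pairs l) where
  toFun := coeffMap fun _ => pairConst
  map_one' := by
    refine HahnSeries.ext (funext fun a => ?_)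
    simp only [coeff_coeffMap, HahnSeries.coeff_one]
    split_ifs
    · exact map_one ((pairInl l).comp (algebraMap l (DiffAlg l)))
    · exact map_zero _
  map_mul' x y := by
    refine HahnSeries.ext (funext fun a => ?_)
    rw [coeff_coeffMap_mul_coeffMap, coeff_coeffMap_mul]
    exact Finset.sum_congr rfl fun ij _ =>
      map_mul ((pairInl l).comp (algebraMap l (DiffAlg l))) _ _
  map_zero' := map_zero _
  map_add' := map_add _

theorem hahnInl_eq (f : HahnSeries Γ l) : hahnInl f = coeffMap (fun _ => pairConst) f := rfl

theorem coeff_hahnInl (f : HahnSeries Γ l) (a : Γ) :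
    (hahnInl f).coeff a = pair (algebraMap l _ (f.coeff a)) 0 := rfl

theorem hahnInl_mul_comm (f : HahnSeries Γ l) (x : HahnSeries Γ (Pairs l)) :
    hahnInl f * x = x * hahnInl f := by
  refine HahnSeries.ext (funext fun a => ?_)
  rw [← coeffMap_id x, hahnInl_eq, coeff_coeffMap_mul_coeffMap, coeff_coeffMap_mul_coeffMap,
    ← sum_antidiagonal_swap]
  exact Finset.sum_congr rfl fun ij _ => pair_algebraMap_mul_comm _ _

/-- The derivative of Hahn series, with `t ^ a` having logarithmic derivative `χ a dt / t`. -/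
def hahnDer : HahnSeries Γ l →+ HahnSeries Γ (Pairs l) := coeffMap fun a => pairDer (χ a)

omit [IsOrderedAddMonoid Γ] in
theorem coeff_hahnDer (f : HahnSeries Γ l) (a : Γ) :
    (hahnDer χ f).coeff a = pairDer (χ a) (f.coeff a) := rfl

theorem hahnDer_mul (f g : HahnSeries Γ l) :
    hahnDer χ (f * g) = hahnInl f * hahnDer χ g + hahnInl g * hahnDer χ f := by
  refine HahnSeries.ext (funext fun a => ?_)
  rw [hahnInl_mul_comm g, hahnDer, hahnInl_eq, hahnInl_eq, coeff_coeffMap_mul,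
    HahnSeries.coeff_add, coeff_coeffMap_mul_coeffMap,
    coeff_coeffMap_mul_coeffMap, ← Finset.sum_add_distrib]
  refine Finset.sum_congr rfl fun ij _ => pair_ext ?_ ?_
  · simp [dd_mul, pairDer_apply, pairConst_apply, Algebra.smul_def]
    rw [← Algebra.commutes]
  · simp only [second_pair, second_add, second_mul, pairDer_apply, pairConst_apply,
      fst_pair, involute_algebraMap, mul_zero, zero_mul, add_zero, zero_add]
    rw [← map_mul, ← map_mul, ← map_add, map_add χ]
    congr 1
    ring

theorem hahnDer_sq (f : HahnSeries Γ l) : hahnDer χ f * hahnDer χ f = 0 := by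
  refine HahnSeries.ext (funext fun a => ?_)
  rw [hahnDer, coeff_coeffMap_mul_coeffMap, HahnSeries.coeff_zero]
  -- The terms (i, j) and (j, i) cancel by anticommutation. Diagonal terms vanish separately, which
  -- matters in characteristic 2.
  refine Finset.sum_involution (fun ij _ => ij.swap) ?_ ?_ ?_ ?_
  · intro ij _
    exact pairDer_mul_swap _ _ _ _
  · intro ij _ h0 hs
    apply h0
    have h1 : ij.2 = ij.1 := congrArg Prod.fst hs
    rw [h1]
    exact pairDer_sq _ _
  · intro ij h
    rw [Finset.mem_antidiagonal] at h ⊢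
    exact ⟨h.2.1, h.1, by rw [add_comm]; exact h.2.2⟩
  · intro ij _; rfl

/-- The homomorphism from the forms of the field of Hahn series to the Hahn series with
coefficients in the pairs. -/
def hahnForms : DiffAlg (HahnSeries Γ l) →+* HahnSeries Γ (Pairs l) :=
  formsLift hahnInl hahnInl_mul_comm (hahnDer χ) (hahnDer_mul χ) (hahnDer_sq χ)

theorem hahnForms_algebraMap (f : HahnSeries Γ l) :
    hahnForms χ (algebraMap _ _ f) = hahnInl f := formsLift_algebraMap _ _ _ _ _ f

theorem hahnForms_dd (f : HahnSeries Γ l) : hahnForms χ (dd f) = hahnDer χ f :=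
  formsLift_dd _ _ _ _ _ f

/-- The exterior derivative on Hahn series with coefficients in the pairs. -/
def hahnD : HahnSeries Γ (Pairs l) →+ HahnSeries Γ (Pairs l) := coeffMap fun a => pairD (χ a)

omit [IsOrderedAddMonoid Γ] in
theorem coeff_hahnD (x : HahnSeries Γ (Pairs l)) (a : Γ) :
    (hahnD χ x).coeff a = pairD (χ a) (x.coeff a) := rfl

/-- The involution of Hahn series with coefficients in the pairs. -/
def hahnInv : HahnSeries Γ (Pairs l) →+ HahnSeries Γ (Pairs l) :=
  coeffMap fun _ => (pairInv (l := l)).toAddMonoidHom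

omit [AddCommGroup Γ] [IsOrderedAddMonoid Γ] in
theorem coeff_hahnInv (x : HahnSeries Γ (Pairs l)) (a : Γ) :
    (hahnInv x).coeff a = pairInv (x.coeff a) := rfl

theorem hahnD_mul (x y : HahnSeries Γ (Pairs l)) :
    hahnD χ (x * y) = hahnD χ x * y + hahnInv x * hahnD χ y := by
  refine HahnSeries.ext (funext fun a => ?_)
  nth_rewrite 2 [← coeffMap_id y]
  rw [hahnD, hahnInv, coeff_coeffMap_mul, HahnSeries.coeff_add, coeff_coeffMap_mul_coeffMap,
    coeff_coeffMap_mul_coeffMap, ← Finset.sum_add_distrib]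
  refine Finset.sum_congr rfl fun ij _ => ?_
  rw [map_add χ]
  exact pairD_mul _ _ _ _

theorem hahnInv_mul (x y : HahnSeries Γ (Pairs l)) : hahnInv (x * y) = hahnInv x * hahnInv y := by
  refine HahnSeries.ext (funext fun a => ?_)
  rw [hahnInv, coeff_coeffMap_mul, coeff_coeffMap_mul_coeffMap]
  exact Finset.sum_congr rfl fun ij _ => map_mul pairInv _ _

theorem hahnForms_involute (z : DiffAlg (HahnSeries Γ l)) :
    hahnForms χ (CliffordAlgebra.involute z) = hahnInv (hahnForms χ z) := by
  induction z using diffAlg_induction with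
  | algebraMap f =>
    rw [involute_algebraMap, hahnForms_algebraMap]
    refine HahnSeries.ext (funext fun a => ?_)
    rw [coeff_hahnInv, coeff_hahnInl]
    exact pair_ext (by simp [pairInv]) (by simp [pairInv])
  | der f =>
    rw [involute_dd, map_neg, hahnForms_dd]
    refine HahnSeries.ext (funext fun a => ?_)
    rw [coeff_hahnInv, HahnSeries.coeff_neg, coeff_hahnDer, pairDer_apply]
    exact pair_ext (by simp [pairInv, involute_dd]) (by simp [pairInv])
  | mul x y hx hy => rw [map_mul, map_mul, hx, hy, map_mul, hahnInv_mul]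
  | add x y hx hy => simp only [map_add, hx, hy]

theorem hahnForms_extD (hχ : ∀ a, dd (χ a) = 0) (z : DiffAlg (HahnSeries Γ l)) :
    hahnForms χ (extD _ z) = hahnD χ (hahnForms χ z) := by
  induction z using diffAlg_induction with
  | algebraMap f =>
    rw [extD_algebraMap, hahnForms_algebraMap, hahnForms_dd]
    refine HahnSeries.ext (funext fun a => ?_)
    rw [coeff_hahnD, coeff_hahnInl, coeff_hahnDer, pairDer_apply]
    exact pair_ext (by simp [pairD_apply, extD_algebraMap])
      (by simp [pairD_apply, Algebra.smul_def])
  | der f =>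
    rw [extD_dd, map_zero, hahnForms_dd]
    refine HahnSeries.ext (funext fun a => ?_)
    rw [coeff_hahnD, coeff_hahnDer, pairDer_apply]
    exact pair_ext (by simp [pairD_apply, extD_dd])
      (by simp only [pairD_apply, fst_pair, second_pair]
          rw [extD_algebraMap, dd_mul, hχ, smul_zero, add_zero, sub_self]; rfl)
  | mul x y hx hy => rw [extD_mul, map_add, map_mul, map_mul, hx, hy, map_mul, hahnD_mul,
      hahnForms_involute]
  | add x y hx hy => simp only [map_add, hx, hy]

end Theta

/-! ### Supports and p-th powers of Hahn series -/

section Support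

variable {Γ : Type w} [AddCommGroup Γ] [LinearOrder Γ] [IsOrderedAddMonoid Γ] {R : Type*}

theorem coeff_mul_ne_zero [Ring R] {x y : HahnSeries Γ R} {a : Γ} (h : (x * y).coeff a ≠ 0) :
    ∃ b c, x.coeff b ≠ 0 ∧ y.coeff c ≠ 0 ∧ b + c = a := by
  rw [HahnSeries.coeff_mul] at h
  obtain ⟨ij, hij, -⟩ := Finset.exists_ne_zero_of_sum_ne_zero h
  rw [Finset.mem_antidiagonal] at hij
  exact ⟨ij.1, ij.2, hij⟩

/-- A product of `p` series whose exponents are all on the same side of `a / p` has no term of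
exponent `a`. -/
theorem coeff_pow_mul_eq_zero [Ring R] (r : Γ → Γ → Prop)
    (hr : ∀ x y x' y', r x y → r x' y' → r (x + x') (y + y')) (hirr : ∀ x, ¬ r x x) {p : ℕ}
    (hp : 2 ≤ p) (a : Γ) (x y : HahnSeries Γ R) (hx : ∀ b, x.coeff b ≠ 0 → r (p • b) a)
    (hy : ∀ b, y.coeff b ≠ 0 → r (p • b) a) : (x ^ (p - 1) * y).coeff a = 0 := by
  have key (n : ℕ) : ∀ b, (x ^ (n + 1)).coeff b ≠ 0 → r (p • b) ((n + 1) • a) := by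
    induction n with
    | zero => simpa using hx
    | succ n h =>
      intro b hb
      rw [pow_succ] at hb
      obtain ⟨c, d, hc, hd, rfl⟩ := coeff_mul_ne_zero hb
      rw [smul_add, succ_nsmul]
      exact hr _ _ _ _ (h c hc) (hx d hd)
  by_contra h
  obtain ⟨c, d, hc, hd, rfl⟩ := coeff_mul_ne_zero h
  rw [show p - 1 = p - 2 + 1 by omega] at hc
  have := hr _ _ _ _ (key _ c hc) (hy d hd)
  rw [← smul_add, ← succ_nsmul, show p - 2 + 1 + 1 = p by omega] at this
  exact hirr _ this

theorem coeff_pow_mul_eq_zero_of_lt [Ring R] {p : ℕ} (hp : 2 ≤ p) (a : Γ) (x y : HahnSeries Γ R)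
    (hx : ∀ b, x.coeff b ≠ 0 → p • b < a) (hy : ∀ b, y.coeff b ≠ 0 → p • b < a) :
    (x ^ (p - 1) * y).coeff a = 0 :=
  coeff_pow_mul_eq_zero (· < ·) (fun _ _ _ _ => add_lt_add) (fun x => lt_irrefl x) hp a x y hx hy

theorem coeff_pow_mul_eq_zero_of_gt [Ring R] {p : ℕ} (hp : 2 ≤ p) (a : Γ) (x y : HahnSeries Γ R)
    (hx : ∀ b, x.coeff b ≠ 0 → a < p • b) (hy : ∀ b, y.coeff b ≠ 0 → a < p • b) :
    (x ^ (p - 1) * y).coeff a = 0 :=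
  coeff_pow_mul_eq_zero (fun x y => y < x) (fun _ _ _ _ h h' => add_lt_add h h')
    (fun x => lt_irrefl x) hp a x y hx hy

open Classical in
/-- The part of a Hahn series with exponents in a set. -/
def restrict [AddCommGroup R] (s : Set Γ) : HahnSeries Γ R →+ HahnSeries Γ R :=
  coeffMap fun a => if a ∈ s then AddMonoidHom.id R else 0

omit [AddCommGroup Γ] [IsOrderedAddMonoid Γ] in
theorem coeff_restrict_of_mem [AddCommGroup R] {s : Set Γ} (f : HahnSeries Γ R) {a : Γ}
    (ha : a ∈ s) : (restrict s f).coeff a = f.coeff a := by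
  simp [restrict, ha]

omit [AddCommGroup Γ] [IsOrderedAddMonoid Γ] in
theorem coeff_restrict_of_notMem [AddCommGroup R] {s : Set Γ} (f : HahnSeries Γ R) {a : Γ}
    (ha : a ∉ s) : (restrict s f).coeff a = 0 := by
  simp [restrict, ha]

omit [AddCommGroup Γ] [IsOrderedAddMonoid Γ] in
theorem mem_of_coeff_restrict_ne_zero [AddCommGroup R] {s : Set Γ} (f : HahnSeries Γ R) {a : Γ}
    (ha : (restrict s f).coeff a ≠ 0) : a ∈ s := by
  by_contra h
  exact ha (coeff_restrict_of_notMem f h)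

omit [IsOrderedAddMonoid Γ] in
theorem eq_restrict_add [AddCommGroup R] (f : HahnSeries Γ R) {p : ℕ} {a : Γ}
    (ha : ∀ b, p • b ≠ a) : f = restrict {b | p • b < a} f + restrict {b | a < p • b} f := by
  refine HahnSeries.ext (funext fun b => ?_)
  rw [HahnSeries.coeff_add]
  rcases lt_trichotomy (p • b) a with h | h | h
  · rw [coeff_restrict_of_mem f (show b ∈ {b | p • b < a} from h),
      coeff_restrict_of_notMem f (show b ∉ {b | a < p • b} from h.not_gt), add_zero]
  · exact absurd h (ha b)
  · rw [coeff_restrict_of_mem f (show b ∈ {b | a < p • b} from h),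
      coeff_restrict_of_notMem f (show b ∉ {b | p • b < a} from h.not_gt), zero_add]

theorem nsmul_injective {p : ℕ} (hp : p ≠ 0) : Function.Injective fun b : Γ => p • b :=
  (nsmul_right_strictMono hp).injective

theorem eq_restrict_add_single_add [AddCommGroup R] (f : HahnSeries Γ R) {p : ℕ} (hp : p ≠ 0)
    (c : Γ) : f = restrict {b | p • b < p • c} f + HahnSeries.single c (f.coeff c) +
      restrict {b | p • c < p • b} f := by
  refine HahnSeries.ext (funext fun b => ?_)
  rw [HahnSeries.coeff_add, HahnSeries.coeff_add]
  rcases lt_trichotomy (p • b) (p • c) with h | h | h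
  · rw [coeff_restrict_of_mem f (show b ∈ {b | p • b < p • c} from h),
      coeff_restrict_of_notMem f (show b ∉ {b | p • c < p • b} from h.not_gt), add_zero,
      HahnSeries.coeff_single_of_ne (by rintro rfl; exact lt_irrefl _ h), add_zero]
  · obtain rfl : b = c := nsmul_injective hp h
    rw [coeff_restrict_of_notMem f (show b ∉ {x | p • x < p • b} from lt_irrefl _),
      coeff_restrict_of_notMem f (show b ∉ {x | p • b < p • x} from lt_irrefl _),
      HahnSeries.coeff_single_same, zero_add, add_zero]
  · rw [coeff_restrict_of_mem f (show b ∈ {b | p • c < p • b} from h),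
      coeff_restrict_of_notMem f (show b ∉ {b | p • b < p • c} from h.not_gt), zero_add,
      HahnSeries.coeff_single_of_ne (by rintro rfl; exact lt_irrefl _ h), zero_add]

instance {p : ℕ} [CommRing R] [CharP R p] : CharP (HahnSeries Γ R) p :=
  charP_of_injective_ringHom HahnSeries.C_injective p

variable {p : ℕ} [Fact p.Prime] [CommRing R] [CharP R p]

/-- The Frobenius is additive on finite sums only, so the series is not expanded into terms but cut
in two at the exponent a / p. The p-th power of neither piece has a term of exponent a. For an
exponent in pΓ, `coeff_pow_nsmul` cuts out one single term besides. -/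
theorem coeff_pow_of_notMem (f : HahnSeries Γ R) {a : Γ} (ha : ∀ b, p • b ≠ a) :
    (f ^ p).coeff a = 0 := by
  have hp : p.Prime := Fact.out
  have h (x : HahnSeries Γ R) : x ^ p = x ^ (p - 1) * x := by
    rw [← pow_succ, Nat.sub_add_cancel hp.pos]
  rw [eq_restrict_add f ha, add_pow_char, HahnSeries.coeff_add, h, h,
    coeff_pow_mul_eq_zero_of_lt hp.two_le, coeff_pow_mul_eq_zero_of_gt hp.two_le, add_zero] <;>
  exact fun b hb => by have := mem_of_coeff_restrict_ne_zero f hb; exact this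

theorem coeff_pow_nsmul (f : HahnSeries Γ R) (c : Γ) : (f ^ p).coeff (p • c) = f.coeff c ^ p := by
  have hp : p.Prime := Fact.out
  have h (x : HahnSeries Γ R) : x ^ p = x ^ (p - 1) * x := by
    rw [← pow_succ, Nat.sub_add_cancel hp.pos]
  rw [eq_restrict_add_single_add f hp.ne_zero c, add_pow_char, add_pow_char,
    HahnSeries.coeff_add, HahnSeries.coeff_add, HahnSeries.single_pow,
    HahnSeries.coeff_single_same, h (restrict _ f),  h (restrict _ f),
    coeff_pow_mul_eq_zero_of_lt hp.two_le, coeff_pow_mul_eq_zero_of_gt hp.two_le, add_zero,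
    zero_add, ← eq_restrict_add_single_add f hp.ne_zero c] <;>
  exact fun b hb => by have := mem_of_coeff_restrict_ne_zero f hb; exact this

end Support

/-! ### The inverse Cartier operator on Hahn series -/

section HahnFrob

variable {Γ : Type w} [AddCommGroup Γ] [LinearOrder Γ] [IsOrderedAddMonoid Γ]
  {l : Type u} [Field l] {p : ℕ} [Fact p.Prime]

/-- The endomorphism of the ring of pairs induced by an endomorphism of the algebra of forms. -/
def pairMap (Φ : DiffAlg l →+* DiffAlg l)
    (hΦ : ∀ z, CliffordAlgebra.involute (Φ z) = Φ (CliffordAlgebra.involute z)) :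
    Pairs l →+* Pairs l where
  toFun z := pair (Φ z.fst) (Φ (second z))
  map_one' := pair_ext (by simp) (by simp)
  map_zero' := pair_ext (by simp) (by simp)
  map_add' x y := pair_ext (by simp) (by simp)
  map_mul' x y := pair_ext (by simp) (by simp [hΦ])

variable (p) (Φ : DiffAlg l →+* DiffAlg l)
  (hΦ : ∀ z, CliffordAlgebra.involute (Φ z) = Φ (CliffordAlgebra.involute z))

theorem pairMap_apply (z : Pairs l) : pairMap Φ hΦ z = pair (Φ z.fst) (Φ (second z)) := rfl

/-- The Frobenius endomorphism of the Hahn series with coefficients in the pairs: it multiplies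
the exponents by `p` and maps the coefficients through an endomorphism of the algebra of forms. -/
def hahnFrob : HahnSeries Γ (Pairs l) →+* HahnSeries Γ (Pairs l) :=
  (HahnSeries.embDomainRingHom (nsmulAddMonoidHom p)
    (nsmul_injective (Fact.out : p.Prime).ne_zero)
    (fun _ _ => (nsmul_right_strictMono (Fact.out : p.Prime).ne_zero).le_iff_le)).comp
  { toFun := coeffMap fun _ => (pairMap Φ hΦ).toAddMonoidHom
    map_one' := by
      refine HahnSeries.ext (funext fun a => ?_)
      simp only [coeff_coeffMap, HahnSeries.coeff_one]
      split_ifs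
      · exact map_one (pairMap Φ hΦ)
      · exact map_zero _
    map_mul' := fun x y => by
      refine HahnSeries.ext (funext fun a => ?_)
      rw [coeff_coeffMap_mul_coeffMap, coeff_coeffMap_mul]
      exact Finset.sum_congr rfl fun ij _ => map_mul (pairMap Φ hΦ) _ _
    map_zero' := map_zero _
    map_add' := map_add _ }

theorem coeff_hahnFrob_nsmul (x : HahnSeries Γ (Pairs l)) (c : Γ) :
    (hahnFrob p Φ hΦ x).coeff (p • c) = pairMap Φ hΦ (x.coeff c) :=
  HahnSeries.embDomain_coeff (a := c)

theorem coeff_hahnFrob_of_notMem (x : HahnSeries Γ (Pairs l)) {a : Γ} (ha : ∀ b, p • b ≠ a) :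
    (hahnFrob p Φ hΦ x).coeff a = 0 :=
  HahnSeries.embDomain_of_notMem_range (by rintro ⟨b, hb⟩; exact ha b hb)

variable [CharP l p] (χ : Γ →+ l)

omit [LinearOrder Γ] [IsOrderedAddMonoid Γ] [Fact (Nat.Prime p)] in
theorem map_nsmul_char (c : Γ) : χ (p • c) = 0 := by
  rw [map_nsmul, ← Nat.cast_smul_eq_nsmul l, CharP.cast_eq_zero, zero_smul]

theorem hahnD_hahnFrob (hd : ∀ z, extD l (Φ z) = 0) (x : HahnSeries Γ (Pairs l)) :
    hahnD χ (hahnFrob p Φ hΦ x) = 0 := by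
  refine HahnSeries.ext (funext fun a => ?_)
  rw [coeff_hahnD]
  by_cases h : ∃ b, p • b = a
  · obtain ⟨b, rfl⟩ := h
    rw [coeff_hahnFrob_nsmul, map_nsmul_char p χ]
    exact pair_ext (by simp [pairD_apply, pairMap_apply, hd])
      (by simp [pairD_apply, pairMap_apply, hd])
  · rw [coeff_hahnFrob_of_notMem p Φ hΦ x (fun b hb => h ⟨b, hb⟩), map_zero]
    rfl

omit [CharP l p] in
theorem hahnInv_hahnFrob_hahnInv (x : HahnSeries Γ (Pairs l)) :
    hahnInv (hahnFrob p Φ hΦ (hahnInv x)) = hahnFrob p Φ hΦ x := by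
  refine HahnSeries.ext (funext fun a => ?_)
  rw [coeff_hahnInv]
  by_cases h : ∃ b, p • b = a
  · obtain ⟨b, rfl⟩ := h
    rw [coeff_hahnFrob_nsmul, coeff_hahnFrob_nsmul]
    exact pair_ext (by simp [pairInv, coeff_hahnInv, pairMap_apply, hΦ])
      (by simp [pairInv, coeff_hahnInv, pairMap_apply, hΦ])
  · rw [coeff_hahnFrob_of_notMem p Φ hΦ _ (fun b hb => h ⟨b, hb⟩),
      coeff_hahnFrob_of_notMem p Φ hΦ _ (fun b hb => h ⟨b, hb⟩), map_zero]

theorem hahnForms_pow (ha : ∀ a, Φ (algebraMap l _ a) = algebraMap l _ (a ^ p))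
    (f : HahnSeries Γ l) : hahnInl (f ^ p) = hahnFrob p Φ hΦ (hahnInl f) := by
  refine HahnSeries.ext (funext fun a => ?_)
  rw [coeff_hahnInl]
  by_cases h : ∃ b, p • b = a
  · obtain ⟨b, rfl⟩ := h
    rw [coeff_hahnFrob_nsmul, coeff_pow_nsmul, coeff_hahnInl]
    exact pair_ext (by simp [pairMap_apply, ha]) (by simp [pairMap_apply])
  · rw [coeff_hahnFrob_of_notMem p Φ hΦ _ (fun b hb => h ⟨b, hb⟩),
      coeff_pow_of_notMem _ (fun b hb => h ⟨b, hb⟩)]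
    exact pair_ext (by simp) (by simp)

/-- Fix an exponent a. Since f^(p-1) df is additive in f modulo exact forms, f may be cut at a / p,
and the two outer pieces do not contribute to exponent a. What remains is the single term of
exponent a / p, if there is one, for which the claim is the hypothesis `hc` on `l`. -/
theorem exists_hahnForms_pow_smul_dd (hχ : ∀ a, χ a ^ p = χ a)
    (ha : ∀ a, Φ (algebraMap l _ a) = algebraMap l _ (a ^ p))
    (hc : ∀ c, ∃ η, c ^ (p - 1) • dd c = Φ (dd c) + extD l η) (f : HahnSeries Γ l) :
    ∃ θ, hahnForms χ (f ^ (p - 1) • dd f) =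
      hahnFrob p Φ hΦ (hahnForms χ (dd f)) + hahnD χ θ := by
  have hp : p.Prime := Fact.out
  have hχ' (a) : dd (χ a) = 0 := by rw [← hχ, dd_pow_char]
  have hw (g : HahnSeries Γ l) :
      hahnForms χ (g ^ (p - 1) • dd g) = hahnInl g ^ (p - 1) * hahnDer χ g := by
    rw [Algebra.smul_def, map_mul, hahnForms_algebraMap, hahnForms_dd, map_pow]
  have hadd (g h : HahnSeries Γ l) (a : Γ) : ∃ θ, (hahnForms χ ((g + h) ^ (p - 1) • dd (g + h))).coeff a =
      (hahnForms χ (g ^ (p - 1) • dd g)).coeff a + (hahnForms χ (h ^ (p - 1) • dd h)).coeff a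
        + pairD (χ a) θ := by
    obtain ⟨c, hc⟩ := exists_dd_eq hp g h
    refine ⟨(hahnForms χ (algebraMap _ _ c)).coeff a, ?_⟩
    rw [hc, map_add, map_add, HahnSeries.coeff_add, HahnSeries.coeff_add, ← extD_algebraMap c,
      hahnForms_extD χ hχ', coeff_hahnD]
  have hsupp {s : Set Γ} {b : Γ} (h : (hahnInl (restrict s f)).coeff b ≠ 0) : b ∈ s := by
    refine mem_of_coeff_restrict_ne_zero f fun h0 => h ?_
    rw [coeff_hahnInl, h0, map_zero]
    exact pair_ext (by simp) (by simp)
  have hsupp' {s : Set Γ} {b : Γ} (h : (hahnDer χ (restrict s f)).coeff b ≠ 0) : b ∈ s := by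
    refine mem_of_coeff_restrict_ne_zero f fun h0 => h ?_
    rw [coeff_hahnDer, h0, map_zero]
  have hlt (a : Γ) : (hahnForms χ ((restrict {b | p • b < a} f) ^ (p - 1) •
      dd (restrict {b | p • b < a} f))).coeff a = 0 := by
    rw [hw]
    exact coeff_pow_mul_eq_zero_of_lt hp.two_le _ _ _ (fun b => hsupp) (fun b => hsupp')
  have hgt (a : Γ) : (hahnForms χ ((restrict {b | a < p • b} f) ^ (p - 1) •
      dd (restrict {b | a < p • b} f))).coeff a = 0 := by
    rw [hw]
    exact coeff_pow_mul_eq_zero_of_gt hp.two_le _ _ _ (fun b => hsupp) (fun b => hsupp')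
  suffices h : ∃ θ, hahnD χ θ = hahnForms χ (f ^ (p - 1) • dd f) -
      hahnFrob p Φ hΦ (hahnForms χ (dd f)) by
    obtain ⟨θ, hθ⟩ := h
    exact ⟨θ, by rw [hθ]; abel⟩
  -- The operator `hahnD` acts on each coefficient separately, so θ may be found one exponent at a
  -- time.
  refine exists_coeffMap_eq _ _ fun a => ?_
  rw [HahnSeries.coeff_sub]
  by_cases h : ∃ b, p • b = a
  · obtain ⟨c, rfl⟩ := h
    -- For a monomial, (f t^c)^(p-1) d(f t^c) = t^(pc) (f^(p-1) df + χ(c) f^p dt/t).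
    have hsingle : (hahnForms χ (HahnSeries.single c (f.coeff c) ^ (p - 1) •
        dd (HahnSeries.single c (f.coeff c)))).coeff (p • c) =
        pair (f.coeff c ^ (p - 1) • dd (f.coeff c)) (algebraMap l _ (χ c * f.coeff c ^ p)) := by
      have h1 : hahnInl (HahnSeries.single c (f.coeff c)) =
          HahnSeries.single c (pairConst (f.coeff c)) := by
        refine HahnSeries.ext (funext fun b => ?_)
        rw [hahnInl_eq, coeff_coeffMap, HahnSeries.coeff_single, HahnSeries.coeff_single]
        split_ifs
        · rfl
        · exact map_zero _
      have h2 : hahnDer χ (HahnSeries.single c (f.coeff c)) =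
          HahnSeries.single c (pairDer (χ c) (f.coeff c)) := by
        refine HahnSeries.ext (funext fun b => ?_)
        rw [coeff_hahnDer, HahnSeries.coeff_single, HahnSeries.coeff_single]
        split_ifs with hb
        · rw [hb]
        · exact map_zero _
      have h3 : pairConst (f.coeff c) ^ (p - 1) = pairConst (f.coeff c ^ (p - 1)) :=
        (map_pow ((pairInl l).comp (algebraMap l (DiffAlg l))) _ _).symm
      rw [hw, h1, h2, HahnSeries.single_pow, HahnSeries.single_mul_single, h3, ← succ_nsmul,
        Nat.sub_add_cancel hp.pos, HahnSeries.coeff_single_same]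
      refine pair_ext ?_ ?_
      · simp [pairConst_apply, pairDer_apply, Algebra.smul_def]
      · simp only [pairConst_apply, pairDer_apply, second_mul, fst_pair, second_pair,
          involute_algebraMap, zero_mul, add_zero]
        rw [← map_mul]
        congr 1
        rw [mul_left_comm, ← pow_succ, Nat.sub_add_cancel hp.pos]
    obtain ⟨θ₁, h₁⟩ := hadd (restrict {b | p • b < p • c} f +
      HahnSeries.single c (f.coeff c)) (restrict {b | p • c < p • b} f) (p • c)
    obtain ⟨θ₂, h₂⟩ := hadd (restrict {b | p • b < p • c} f)
      (HahnSeries.single c (f.coeff c)) (p • c)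
    rw [← eq_restrict_add_single_add f hp.ne_zero c] at h₁
    obtain ⟨η, hη⟩ := hc (f.coeff c)
    refine ⟨θ₁ + θ₂ + pair η 0, ?_⟩
    rw [h₁, h₂, hlt, hgt, hsingle, coeff_hahnFrob_nsmul, hahnForms_dd, coeff_hahnDer, map_add,
      map_add, hη]
    -- At exponent pc the twist χ(pc) vanishes, so only dη remains in the first component. In the
    -- second, Φ maps χ(c) f to χ(c)^p f^p = χ(c) f^p, and nothing is left.
    have h4 : pairD (χ (p • c)) (pair η 0) = pair (Φ (dd (f.coeff c)) + extD l η)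
        (algebraMap l _ (χ c * f.coeff c ^ p)) -
        pairMap Φ hΦ (pairDer (χ c) (f.coeff c)) := by
      rw [map_nsmul_char p χ]
      refine pair_ext ?_ ?_
      · simp [pairD_apply, pairMap_apply, pairDer_apply]
      · simp only [pairD_apply, pairMap_apply, pairDer_apply, fst_pair, second_pair, second_sub,
          zero_smul, map_zero, sub_zero]
        rw [ha, mul_pow, hχ, sub_self]
    rw [h4]
    abel
  · have h' : ∀ b, p • b ≠ a := fun b hb => h ⟨b, hb⟩
    obtain ⟨θ, hθ⟩ := hadd (restrict {b | p • b < a} f) (restrict {b | a < p • b} f) a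
    rw [← eq_restrict_add f h', hlt, hgt, zero_add, zero_add] at hθ
    refine ⟨θ, ?_⟩
    rw [hθ, coeff_hahnFrob_of_notMem p Φ hΦ _ h', sub_zero]

/-- The pairs of forms of which the second one is a lift of the image of the first one under the
inverse Cartier operator form a multiplicative set. -/
def IsHahnFrob (x x' : DiffAlg (HahnSeries Γ l)) : Prop :=
  hahnD χ (hahnForms χ x') = 0 ∧
    ∃ θ, hahnForms χ x' = hahnFrob p Φ hΦ (hahnForms χ x) + hahnD χ θ

theorem IsHahnFrob.mul (hd : ∀ z, extD l (Φ z) = 0) {x x' y y' : DiffAlg (HahnSeries Γ l)}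
    (hx : IsHahnFrob p Φ hΦ χ x x') (hy : IsHahnFrob p Φ hΦ χ y y') :
    IsHahnFrob p Φ hΦ χ (x * y) (x' * y') := by
  obtain ⟨hx, θ, hθ⟩ := hx
  obtain ⟨hy, η, hη⟩ := hy
  -- An exact form times a closed form is exact. The involution in the second summand cancels the
  -- sign in the Leibniz rule.
  refine ⟨by rw [map_mul, hahnD_mul, hx, hy, zero_mul, mul_zero, add_zero],
    θ * hahnForms χ y' + hahnFrob p Φ hΦ (hahnInv (hahnForms χ x)) * η, ?_⟩
  rw [map_add, hahnD_mul, hahnD_mul, hy, mul_zero, add_zero, hahnD_hahnFrob p Φ hΦ χ hd, zero_mul,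
    zero_add, hahnInv_hahnFrob_hahnInv, map_mul, map_mul, map_mul, hθ]
  simp only [hη, add_mul, mul_add]
  abel

theorem isHahnFrob_algebraMap (hd : ∀ z, extD l (Φ z) = 0)
    (ha : ∀ a, Φ (algebraMap l _ a) = algebraMap l _ (a ^ p)) (f : HahnSeries Γ l) :
    IsHahnFrob p Φ hΦ χ (algebraMap _ _ f) (algebraMap _ _ (f ^ p)) := by
  rw [IsHahnFrob, hahnForms_algebraMap, hahnForms_algebraMap, hahnForms_pow p Φ hΦ ha]
  exact ⟨hahnD_hahnFrob p Φ hΦ χ hd _, 0, by rw [map_zero, add_zero]⟩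

theorem isHahnFrob_dd (hχ : ∀ a, χ a ^ p = χ a) (hd : ∀ z, extD l (Φ z) = 0)
    (ha : ∀ a, Φ (algebraMap l _ a) = algebraMap l _ (a ^ p))
    (hc : ∀ c, ∃ η, c ^ (p - 1) • dd c = Φ (dd c) + extD l η) (f : HahnSeries Γ l) :
    IsHahnFrob p Φ hΦ χ (dd f) (f ^ (p - 1) • dd f) := by
  obtain ⟨θ, hθ⟩ := exists_hahnForms_pow_smul_dd p Φ hΦ χ hχ ha hc f
  refine ⟨?_, θ, hθ⟩
  rw [hθ, map_add, hahnD_hahnFrob p Φ hΦ χ hd, zero_add]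
  refine HahnSeries.ext (funext fun a => ?_)
  rw [coeff_hahnD, coeff_hahnD, pairD_pairD _ (by rw [← hχ, dd_pow_char])]
  rfl

/-- Writing dlog b as (b^(-1))^p times b^(p-1) db exhibits it as a Frobenius lift of b^(-1) db,
which is dlog b itself. Logarithmic forms are thus fixed up to exact terms, whatever the units. -/
theorem isHahnFrob_dlogs (hχ : ∀ a, χ a ^ p = χ a) (hd : ∀ z, extD l (Φ z) = 0)
    (ha : ∀ a, Φ (algebraMap l _ a) = algebraMap l _ (a ^ p))
    (hc : ∀ c, ∃ η, c ^ (p - 1) • dd c = Φ (dd c) + extD l η) (L : List (HahnSeries Γ l)ˣ) :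
    IsHahnFrob p Φ hΦ χ (dlogs L) (dlogs L) := by
  induction L with
  | nil => simpa using isHahnFrob_algebraMap p Φ hΦ χ hd ha 1
  | cons b L h =>
    rw [dlogs_cons]
    refine IsHahnFrob.mul p Φ hΦ χ hd ?_ h
    have h1 : dlg b = algebraMap _ _ ((↑b⁻¹ : HahnSeries Γ l) ^ p) *
        ((b : HahnSeries Γ l) ^ (p - 1) • dd (b : HahnSeries Γ l)) := by
      rw [← Algebra.smul_def, ← smul_dlg, smul_smul, smul_smul, mul_assoc, ← pow_succ,
        Nat.sub_add_cancel (Fact.out : p.Prime).pos, ← mul_pow, Units.inv_mul, one_pow, one_smul]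
    have h2 := IsHahnFrob.mul p Φ hΦ χ hd
      (isHahnFrob_algebraMap p Φ hΦ χ hd ha (↑b⁻¹ : HahnSeries Γ l))
      (isHahnFrob_dd p Φ hΦ χ hχ hd ha hc (b : HahnSeries Γ l))
    rwa [← h1, ← Algebra.smul_def, ← dlg_eq] at h2

/-- The form a^p dlog b_1 ∧ ⋯ is a Frobenius lift of a dlog b_1 ∧ ⋯, so the Artin–Schreier relation
attached to the latter becomes Frob ξ - ξ up to an exact term. -/
theorem exists_hahnForms_eq (hχ : ∀ a, χ a ^ p = χ a) (hd : ∀ z, extD l (Φ z) = 0)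
    (ha : ∀ a, Φ (algebraMap l _ a) = algebraMap l _ (a ^ p))
    (hc : ∀ c, ∃ η, c ^ (p - 1) • dd c = Φ (dd c) + extD l η)
    {ρ : DiffAlg (HahnSeries Γ l)} (hρ : ρ ∈ relTotal (HahnSeries Γ l) p) :
    ∃ ξ θ, hahnForms χ ρ = hahnFrob p Φ hΦ ξ - ξ + hahnD χ θ := by
  have hχ' (a) : dd (χ a) = 0 := by rw [← hχ, dd_pow_char]
  induction hρ using AddSubgroup.closure_induction with
  | zero => exact ⟨0, 0, by simp⟩
  | add x y _ _ hx hy =>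
    obtain ⟨⟨ξ, θ, h⟩, ξ', θ', h'⟩ := And.intro hx hy
    exact ⟨ξ + ξ', θ + θ', by simp only [map_add, h, h']; abel⟩
  | neg x _ hx =>
    obtain ⟨ξ, θ, h⟩ := hx
    exact ⟨-ξ, -θ, by simp only [map_neg, h]; abel⟩
  | mem x hx =>
    rcases hx with ⟨j, η, hη, h⟩ | ⟨a, L, h⟩
    · exact ⟨0, hahnForms χ η, by simp [← h, hahnForms_extD χ hχ']⟩
    · obtain ⟨-, θ, hθ⟩ := IsHahnFrob.mul p Φ hΦ χ hd (isHahnFrob_algebraMap p Φ hΦ χ hd ha a)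
        (isHahnFrob_dlogs p Φ hΦ χ hχ hd ha hc L)
      refine ⟨hahnForms χ (a • dlogs L), θ, ?_⟩
      rw [h, sub_smul, map_sub, Algebra.smul_def, hθ, Algebra.smul_def]
      abel

end HahnFrob

/-! ### Lowest coefficients of relations -/

section Lead

variable {Γ : Type w} [AddCommGroup Γ] [LinearOrder Γ] [IsOrderedAddMonoid Γ]
  {l : Type u} [Field l] (p : ℕ) [Fact p.Prime] [CharP l p] (χ : Γ →+ l)

/-- The lowest coefficient of a relation between forms of the field of Hahn series. -/
theorem lead_of_mem_relTotal (hχ : ∀ a, χ a ^ p = χ a)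
    {ρ : DiffAlg (HahnSeries Γ l)} (hρ : ρ ∈ relTotal (HahnSeries Γ l) p) {m : Γ} (hm : 0 ≤ m)
    (h : ∀ a < -m, (hahnForms χ ρ).coeff a = 0) {x y : DiffAlg l}
    (hxy : (hahnForms χ ρ).coeff (-m) = pair x y) :
    (m = 0 → x ∈ relTotal l p ∧ y ∈ relTotal l p) ∧
    (0 < m → (∃ b, p • b = m) → extD l x = 0 ∧ extD l y = 0) ∧
    (0 < m → χ m ≠ 0 → y = 0 → x = 0) := by
  obtain ⟨Φ, ha, hd, hΦ, hinj, hrel, hc, -⟩ := exists_inverseCartier l p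
  obtain ⟨ξ, θ, hξ⟩ := exists_hahnForms_eq p Φ hΦ χ hχ hd ha hc hρ
  have hp : p.Prime := Fact.out
  have hneg {c : Γ} (hc : c < 0) : p • c < c := by
    have : c + (p - 1) • c < c + 0 := by
      refine add_lt_add_right ?_ c
      exact nsmul_neg hc (by have := hp.two_le; omega)
    rwa [add_zero, ← succ_nsmul', Nat.sub_add_cancel hp.pos] at this
  -- Below -m the relation has no terms. If ξ had no term at pc, the coefficient at pc would say
  -- that Φ of the components of ξ at c is exact, and injectivity of the inverse Cartier operator
  -- would kill them.
  have hstep (c : Γ) (hpc : p • c < -m) (h0 : ξ.coeff c ≠ 0) : ξ.coeff (p • c) ≠ 0 := by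
    intro h1
    apply h0
    have h2 := congrArg (fun z => HahnSeries.coeff z (p • c)) hξ
    simp only [HahnSeries.coeff_add, HahnSeries.coeff_sub] at h2
    rw [h _ hpc, h1, coeff_hahnFrob_nsmul, sub_zero, coeff_hahnD, map_nsmul_char p χ] at h2
    have h3 := congrArg TrivSqZeroExt.fst h2
    have h4 := congrArg second h2
    simp only [pairMap_apply, pairD_apply, fst_add', second_add, fst_pair, second_pair, second_zero,
      TrivSqZeroExt.fst_zero, zero_smul, zero_sub] at h3 h4
    refine pair_ext (hinj _ (-(θ.coeff (p • c)).fst) ?_) (hinj _ (second (θ.coeff (p • c))) ?_)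
    · rw [map_neg]; exact eq_neg_of_add_eq_zero_left h3.symm
    · exact (sub_eq_zero.1 (by rw [sub_eq_add_neg]; exact h4.symm))
  -- Otherwise c is negative and the exponents c, pc, p²c, … all belong to the support of ξ: an
  -- infinite descending sequence in a well-ordered set.
  have hzero (c : Γ) (hpc : p • c < -m) : ξ.coeff c = 0 := by
    by_contra h0
    have hc0 : c < 0 := by
      by_contra hc
      exact absurd (hpc.trans_le (neg_nonpos.2 hm)) (not_lt.2 (nsmul_nonneg (not_lt.1 hc) p))
    have key (n : ℕ) : ξ.coeff (p ^ n • c) ≠ 0 ∧ p • (p ^ n • c) < -m ∧ p ^ n • c < 0 := by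
      induction n with
      | zero => simpa using ⟨h0, hpc, hc0⟩
      | succ n ih =>
        obtain ⟨h1, h2, h3⟩ := ih
        rw [pow_succ', mul_smul]
        have h4 : p • p ^ n • c < 0 := (hneg h3).trans h3
        exact ⟨hstep _ h2 h1, (hneg h4).trans h2, h4⟩
    have hwf := ξ.isWF_support
    rw [Set.isWF_iff_no_descending_seq] at hwf
    refine hwf (fun n => p ^ n • c) (strictAnti_nat_of_succ_lt fun n => ?_) fun n => (key n).1
    rw [pow_succ', mul_smul]
    exact hneg (key n).2.2
  have hlead := congrArg (fun z => HahnSeries.coeff z (-m)) hξ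
  simp only [HahnSeries.coeff_add, HahnSeries.coeff_sub] at hlead
  rw [hxy, coeff_hahnD] at hlead
  refine ⟨?_, ?_, ?_⟩
  -- Exponent 0 is its own multiple by p, so both components have the form Φ ξ₀ - ξ₀ plus an exact
  -- form.
  · rintro rfl
    have h0 : (0 : Γ) = p • 0 := (smul_zero p).symm
    rw [neg_zero] at hlead
    nth_rewrite 1 [h0] at hlead
    rw [coeff_hahnFrob_nsmul, map_zero χ] at hlead
    have h3 := congrArg TrivSqZeroExt.fst hlead
    have h4 := congrArg second hlead
    simp only [pairMap_apply, pairD_apply, fst_add', second_add, fst_pair, second_pair, second_sub,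
      TrivSqZeroExt.fst_sub, zero_smul, zero_sub] at h3 h4
    rw [h3, h4, ← map_neg]
    exact ⟨add_mem (hrel _) (extD_mem_relTotal p _), add_mem (hrel _) (extD_mem_relTotal p _)⟩
  -- Here ξ has no term at -m, as p(-m) < -m, and χ(-m) = 0. The coefficient is Φ of something plus
  -- an exact form in each component.
  · rintro hm0 ⟨b, rfl⟩
    rw [hzero _ (hneg (neg_neg_of_pos hm0)), sub_zero, ← smul_neg, coeff_hahnFrob_nsmul,
      map_nsmul_char p χ] at hlead
    have h3 := congrArg TrivSqZeroExt.fst hlead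
    have h4 := congrArg second hlead
    simp only [pairMap_apply, pairD_apply, fst_add', second_add, fst_pair, second_pair,
      zero_smul, zero_sub] at h3 h4
    rw [h3, h4]
    simp [hd, extD_extD]
  -- Now -m is not a multiple of p, so the Frobenius term is absent as well, and the pair is a
  -- twisted differential: x = dα and y = χ(-m) α - dβ. If y = 0, then α is a constant times dβ,
  -- hence closed.
  · intro hm0 hχm hy
    subst hy
    have hnot : ∀ b, p • b ≠ -m := by
      intro b hb
      apply hχm
      rw [← neg_neg m, ← hb, map_neg, map_nsmul_char p χ, neg_zero]
    rw [hzero _ (hneg (neg_neg_of_pos hm0)), sub_zero, coeff_hahnFrob_of_notMem p Φ hΦ _ hnot,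
      zero_add] at hlead
    have h3 := congrArg TrivSqZeroExt.fst hlead
    have h4 := congrArg second hlead
    simp only [pairD_apply, fst_pair, second_pair] at h3 h4
    have h5 : dd (χ (-m))⁻¹ = 0 := by
      rw [← hχ, ← inv_pow, dd_pow_char]
    have hne : χ (-m) ≠ 0 := by rw [map_neg]; exact neg_ne_zero.2 hχm
    have h6 : (θ.coeff (-m)).fst = (χ (-m))⁻¹ • extD l (second (θ.coeff (-m))) := by
      rw [← sub_eq_zero.1 h4.symm, smul_smul, inv_mul_cancel₀ hne, one_smul]
    rw [h3, h6, extD_smul, h5, zero_mul, zero_add, extD_extD, smul_zero]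

end Lead

/-! ### Specialization of forms -/

section Specialization

variable {Γ : Type w} [AddCommGroup Γ] [LinearOrder Γ] [IsOrderedAddMonoid Γ]
  {l : Type u} [Field l] (χ : Γ →+ l) (R : Type*) [CommRing R] [Algebra R (HahnSeries Γ l)]
  [Algebra R l]

theorem coeff_mul_zero_of_nonneg {S : Type*} [Ring S] {x y : HahnSeries Γ S}
    (hx : ∀ a < 0, x.coeff a = 0) (hy : ∀ a < 0, y.coeff a = 0) :
    (∀ a < 0, (x * y).coeff a = 0) ∧ (x * y).coeff 0 = x.coeff 0 * y.coeff 0 := by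
  have key (a b : Γ) (h : x.coeff a * y.coeff b ≠ 0) : 0 ≤ a ∧ 0 ≤ b := by
    constructor <;> by_contra hlt
    · exact h (by rw [hx _ (not_le.1 hlt), zero_mul])
    · exact h (by rw [hy _ (not_le.1 hlt), mul_zero])
  constructor
  · intro a ha
    rw [HahnSeries.coeff_mul]
    refine Finset.sum_eq_zero fun ij h => ?_
    by_contra h0
    have h1 := key _ _ h0
    rw [← (Finset.mem_antidiagonal.1 h).2.2] at ha
    exact absurd ha (not_lt.2 (add_nonneg h1.1 h1.2))
  · rw [HahnSeries.coeff_mul]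
    refine Finset.sum_eq_single (0, 0) ?_ ?_
    · intro ij h hne
      by_contra h0
      have h1 := key _ _ h0
      have h2 := (Finset.mem_antidiagonal.1 h).2.2
      have h3 := (add_eq_zero_iff_of_nonneg h1.1 h1.2).1 h2
      exact hne (Prod.ext h3.1 h3.2)
    · intro h
      by_contra h0
      exact h (Finset.mem_antidiagonal.2 ⟨fun h1 => h0 (by rw [h1, zero_mul]),
        fun h1 => h0 (by rw [h1, mul_zero]), add_zero 0⟩)

/-- Series without negative exponents form a ring on which the coefficient at 0 is multiplicative.
The second component vanishes at exponent 0 because χ(0) = 0: a form that comes from `R` has no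
residue. -/
theorem hahnForms_formMap (h0 : ∀ r : R, (algebraMap R (HahnSeries Γ l) r).coeff 0 = algebraMap R l r)
    (hneg : ∀ (r : R), ∀ a < 0, (algebraMap R (HahnSeries Γ l) r).coeff a = 0) (z : DiffAlg R) :
    (∀ a < 0, (hahnForms χ (formMap R (HahnSeries Γ l) z)).coeff a = 0) ∧
      (hahnForms χ (formMap R (HahnSeries Γ l) z)).coeff 0 = pair (formMap R l z) 0 := by
  induction z using diffAlg_induction with
  | algebraMap r =>
    rw [formMap_algebraMap, hahnForms_algebraMap, formMap_algebraMap]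
    refine ⟨fun a ha => ?_, by rw [coeff_hahnInl, h0]⟩
    rw [coeff_hahnInl, hneg r a ha]
    exact pair_ext (by simp) (by simp)
  | der r =>
    rw [formMap_dd, hahnForms_dd, formMap_dd]
    refine ⟨fun a ha => ?_, ?_⟩
    · rw [coeff_hahnDer, hneg r a ha, map_zero]
    · rw [coeff_hahnDer, h0, pairDer_apply, map_zero, zero_mul, map_zero]
  | mul x y hx hy =>
    rw [map_mul, map_mul, map_mul]
    obtain ⟨h1, h2⟩ := coeff_mul_zero_of_nonneg hx.1 hy.1
    refine ⟨h1, ?_⟩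
    rw [h2, hx.2, hy.2]
    exact (map_mul (pairInl l) _ _).symm
  | add x y hx hy =>
    simp only [map_add, HahnSeries.coeff_add]
    refine ⟨fun a ha => by rw [hx.1 a ha, hy.1 a ha, add_zero], ?_⟩
    rw [hx.2, hy.2]
    exact (map_add (pairInl l) _ _).symm

theorem hahnForms_dlg_single (e : Γ) (t : (HahnSeries Γ l)ˣ)
    (ht : (t : HahnSeries Γ l) = HahnSeries.single e 1) :
    hahnForms χ (dlg t) = HahnSeries.single 0 (pair 0 (algebraMap l _ (χ e))) := by
  have hinv : (↑t⁻¹ : HahnSeries Γ l) = HahnSeries.single (-e) 1 := by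
    rw [← mul_one (↑t⁻¹ : HahnSeries Γ l), Units.inv_mul_eq_iff_eq_mul, ht,
      HahnSeries.single_mul_single, add_neg_cancel, mul_one]
    rfl
  have h1 : hahnInl (HahnSeries.single (-e) (1 : l)) =
      HahnSeries.single (-e) (pairConst (1 : l)) := by
    refine HahnSeries.ext (funext fun b => ?_)
    rw [hahnInl_eq, coeff_coeffMap, HahnSeries.coeff_single, HahnSeries.coeff_single]
    split_ifs
    · rfl
    · exact map_zero _
  have h2 : hahnDer χ (HahnSeries.single e 1) = HahnSeries.single e (pairDer (χ e) 1) := by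
    refine HahnSeries.ext (funext fun b => ?_)
    rw [coeff_hahnDer, HahnSeries.coeff_single, HahnSeries.coeff_single]
    split_ifs with hb
    · rw [hb]
    · exact map_zero _
  rw [dlg_eq, Algebra.smul_def, map_mul, hahnForms_algebraMap, hahnForms_dd, hinv, ht, h1, h2,
    HahnSeries.single_mul_single, neg_add_cancel]
  congr 1
  refine pair_ext ?_ ?_
  · simp [pairConst_apply, pairDer_apply, dd_one]
  · simp [pairConst_apply, pairDer_apply]

/-- The lowest coefficient of a form with a pole of order at most `m`. -/
theorem hahnForms_pole (h0 : ∀ r : R, (algebraMap R (HahnSeries Γ l) r).coeff 0 = algebraMap R l r)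
    (hneg : ∀ (r : R), ∀ a < 0, (algebraMap R (HahnSeries Γ l) r).coeff a = 0) (e : Γ)
    (t : (HahnSeries Γ l)ˣ) (ht : (t : HahnSeries Γ l) = HahnSeries.single e 1) (he : χ e = 1)
    (m : Γ) (ω ω' : DiffAlg R) (z : DiffAlg (HahnSeries Γ l))
    (hz : z = HahnSeries.single (-m) (1 : l) •
      (formMap R (HahnSeries Γ l) ω + dlg t * formMap R (HahnSeries Γ l) ω')) :
    (∀ a < -m, (hahnForms χ z).coeff a = 0) ∧
      (hahnForms χ z).coeff (-m) = pair (formMap R l ω) (formMap R l ω') := by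
  have h1 : hahnInl (HahnSeries.single (-m) (1 : l)) = HahnSeries.single (-m) 1 := by
    refine HahnSeries.ext (funext fun b => ?_)
    rw [hahnInl_eq, coeff_coeffMap, HahnSeries.coeff_single, HahnSeries.coeff_single]
    split_ifs
    · exact map_one ((pairInl l).comp (algebraMap l (DiffAlg l)))
    · exact map_zero _
  obtain ⟨h2, h3⟩ := hahnForms_formMap χ R h0 hneg ω
  obtain ⟨h4, h5⟩ := hahnForms_formMap χ R h0 hneg ω'
  have h6 (a : Γ) : (hahnForms χ z).coeff (a + -m) =
      (hahnForms χ (formMap R (HahnSeries Γ l) ω)).coeff a +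
      pair 0 1 * (hahnForms χ (formMap R (HahnSeries Γ l) ω')).coeff a := by
    rw [hz, Algebra.smul_def, map_mul, hahnForms_algebraMap, h1,
      HahnSeries.coeff_single_mul_add, one_mul, map_add, map_mul, hahnForms_dlg_single χ e t ht, he,
      HahnSeries.coeff_add, HahnSeries.coeff_single_zero_mul, map_one]
  constructor
  · intro a ha
    have := h6 (a + m)
    rw [add_neg_cancel_right] at this
    rw [this, h2 _ (lt_neg_iff_add_neg.1 ha), h4 _ (lt_neg_iff_add_neg.1 ha), mul_zero, add_zero]
  · have := h6 0
    rw [zero_add] at this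
    rw [this, h3, h5]
    exact pair_ext (by simp) (by simp)

end Specialization

/-! ### Expansions in a uniformizer -/

section Expansion

open IsLocalRing

variable (R : Type u) [CommRing R] [IsLocalRing R] (p : ℕ) [Fact p.Prime] [CharP R p]

theorem charP_residueField : CharP (ResidueField R) p :=
  (CharP.charP_iff_prime_eq_zero (Fact.out : p.Prime)).2 (by
    rw [← map_natCast (residue R), CharP.cast_eq_zero, map_zero])

omit [IsLocalRing R] in
theorem mk_evalₐ_factor (I : Ideal R) (N : ℕ) (x : AdicCompletion I R) :
    Ideal.Quotient.factor (Ideal.pow_le_pow_right (Nat.le_succ N))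
      (AdicCompletion.evalₐ I (N + 1) x) = AdicCompletion.evalₐ I N x := by
  obtain ⟨c, rfl⟩ := AdicCompletion.mk_surjective I R x
  rw [AdicCompletion.evalₐ_mk, AdicCompletion.evalₐ_mk, Ideal.Quotient.factor_mk]
  have h := c.2 (Nat.le_succ N)
  rw [SModEq.sub_mem, smul_eq_mul, Ideal.mul_top] at h
  rw [Ideal.Quotient.eq, ← neg_mem_iff, neg_sub]
  exact h

include p in
-- By formal smoothness of the residue field, the identity of `R ⧸ maximalIdeal R` lifts to a
-- homomorphism into the adic completion; its truncations are compatible coefficient fields. `R`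
-- itself need not be complete.
theorem exists_residue_sections :
    ∃ σ : ∀ N : ℕ, ResidueField R →+* R ⧸ maximalIdeal R ^ N,
      (∀ N x, Ideal.Quotient.factor (Ideal.pow_le_pow_right (Nat.le_succ N)) (σ (N + 1) x) =
        σ N x) ∧
      ∀ x r, σ 1 x = Ideal.Quotient.mk _ r → residue R r = x := by
  let _ : Algebra (ZMod p) R := ZMod.algebra R p
  have _ : CharP (ResidueField R) p := charP_residueField R p
  have _ : Algebra.FormallySmooth (ZMod p) (R ⧸ maximalIdeal R) :=
    formallySmooth_zmod (k := ResidueField R) p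
  obtain ⟨g, hg⟩ := Algebra.FormallySmooth.exists_adicCompletionEvalOneₐ_comp_eq
    (R := ZMod p) (I := maximalIdeal R) (AlgHom.id (ZMod p) (R ⧸ maximalIdeal R))
  refine ⟨fun N => (AdicCompletion.evalₐ (maximalIdeal R) N).toRingHom.comp g.toRingHom,
    fun N x => mk_evalₐ_factor R _ N _, fun x r h => ?_⟩
  have h1 := congrArg (fun f => f x) hg
  have h2 := AdicCompletion.factorₐ_evalₐ_one _ (g x)
  have h3 : AdicCompletion.evalₐ (maximalIdeal R) 1 (g x) = Ideal.Quotient.mk _ r := h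
  rw [h3] at h2
  exact h2.trans h1

variable {R} {t : R} (σ : ∀ N : ℕ, ResidueField R →+* R ⧸ maximalIdeal R ^ N) (N : ℕ)

theorem mk_uniformizer_pow (ht : maximalIdeal R = Ideal.span {t}) :
    Ideal.Quotient.mk (maximalIdeal R ^ N) t ^ N = 0 := by
  rw [← map_pow, Ideal.Quotient.eq_zero_iff_mem, ht, Ideal.span_singleton_pow]
  exact Ideal.mem_span_singleton_self _

theorem eval₂_trunc (ht : maximalIdeal R = Ideal.span {t}) (q : Polynomial (ResidueField R)) :
    (PowerSeries.trunc N (q : PowerSeries (ResidueField R))).eval₂ (σ N)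
      (Ideal.Quotient.mk _ t) = q.eval₂ (σ N) (Ideal.Quotient.mk _ t) := by
  obtain ⟨c, hc⟩ : Polynomial.X ^ N ∣
      q - PowerSeries.trunc N (q : PowerSeries (ResidueField R)) := by
    rw [Polynomial.X_pow_dvd_iff]
    intro d hd
    rw [Polynomial.coeff_sub, PowerSeries.coeff_trunc, if_pos hd, Polynomial.coeff_coe, sub_self]
  rw [← sub_eq_zero, ← neg_eq_zero, neg_sub, ← Polynomial.eval₂_sub, hc, Polynomial.eval₂_mul,
    Polynomial.eval₂_X_pow, mk_uniformizer_pow N ht, zero_mul]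

/-- Evaluation of power series over the residue field at a uniformizer. -/
def evalTrunc (ht : maximalIdeal R = Ideal.span {t}) :
    PowerSeries (ResidueField R) →+* R ⧸ maximalIdeal R ^ N where
  toFun f := (PowerSeries.trunc N f).eval₂ (σ N) (Ideal.Quotient.mk _ t)
  map_one' := by
    rw [← Polynomial.coe_one, eval₂_trunc σ N ht, Polynomial.eval₂_one]
  map_zero' := by rw [map_zero, Polynomial.eval₂_zero]
  map_add' f g := by rw [map_add, Polynomial.eval₂_add]
  map_mul' f g := by
    rw [← PowerSeries.trunc_trunc_mul_trunc, ← Polynomial.coe_mul, eval₂_trunc σ N ht,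
      Polynomial.eval₂_mul]

variable (ht : maximalIdeal R = Ideal.span {t})

theorem evalTrunc_apply (f : PowerSeries (ResidueField R)) : evalTrunc σ N ht f =
    ∑ i ∈ Finset.range N, σ N (PowerSeries.coeff i f) * Ideal.Quotient.mk _ t ^ i :=
  PowerSeries.eval₂_trunc_eq_sum_range _ _ _ _

theorem evalTrunc_C (c : ResidueField R) : evalTrunc σ N ht (PowerSeries.C c) = σ N c := by
  rw [← Polynomial.coe_C]
  exact (eval₂_trunc σ N ht _).trans (Polynomial.eval₂_C _ _)

theorem evalTrunc_X : evalTrunc σ N ht PowerSeries.X = Ideal.Quotient.mk _ t := by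
  rw [← Polynomial.coe_X]
  exact (eval₂_trunc σ N ht _).trans (Polynomial.eval₂_X _ _)

theorem factor_evalTrunc (hσ : ∀ N x, Ideal.Quotient.factor
      (Ideal.pow_le_pow_right (Nat.le_succ N)) (σ (N + 1) x) = σ N x)
    (f : PowerSeries (ResidueField R)) :
    Ideal.Quotient.factor (Ideal.pow_le_pow_right (Nat.le_succ N)) (evalTrunc σ (N + 1) ht f) =
      evalTrunc σ N ht f := by
  rw [evalTrunc_apply, evalTrunc_apply, map_sum, Finset.sum_range_succ]
  simp only [map_mul, map_pow, hσ, Ideal.Quotient.factor_mk]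
  rw [mk_uniformizer_pow N ht, mul_zero, add_zero]

include ht in
theorem mk_t_mul {N : ℕ} {u u' : R} (h : Ideal.Quotient.mk (maximalIdeal R ^ N) u =
      Ideal.Quotient.mk _ u') :
    Ideal.Quotient.mk (maximalIdeal R ^ (N + 1)) (t * u) = Ideal.Quotient.mk _ (t * u') := by
  rw [Ideal.Quotient.eq] at h ⊢
  rw [← mul_sub, pow_succ']
  exact Ideal.mul_mem_mul (ht ▸ Ideal.mem_span_singleton_self t) h

/-- Expansion digit by digit: subtract the lift of the residue, divide by `t`, and expand the
quotient to one order less. -/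
theorem exists_evalTrunc_eq (hσ : ∀ N x, Ideal.Quotient.factor
      (Ideal.pow_le_pow_right (Nat.le_succ N)) (σ (N + 1) x) = σ N x)
    (hσ1 : ∀ x r, σ 1 x = Ideal.Quotient.mk _ r → residue R r = x) (a : R) :
    ∃ f, evalTrunc σ N ht f = Ideal.Quotient.mk _ a := by
  induction N generalizing a with
  | zero => exact ⟨0, by
      have : Subsingleton (R ⧸ maximalIdeal R ^ 0) := by simp
      exact Subsingleton.elim _ _⟩
  | succ N ih =>
    obtain ⟨r, hr⟩ := Ideal.Quotient.mk_surjective (σ (N + 1) (residue R a))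
    have h1 (M : ℕ) (r : R) (x) (hr : Ideal.Quotient.mk _ r = σ (M + 1) x) : residue R r = x := by
      induction M with
      | zero => exact hσ1 _ _ hr.symm
      | succ M ih =>
        refine ih ?_
        rw [← hσ, ← hr, Ideal.Quotient.factor_mk]
    have h2 : a - r ∈ maximalIdeal R := by
      rw [← residue_eq_zero_iff, map_sub, h1 N r _ hr, sub_self]
    rw [ht, Ideal.mem_span_singleton] at h2
    obtain ⟨a', ha'⟩ := h2
    obtain ⟨f, hf⟩ := ih a'
    obtain ⟨u, hu⟩ := Ideal.Quotient.mk_surjective (evalTrunc σ (N + 1) ht f)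
    refine ⟨PowerSeries.C (residue R a) + PowerSeries.X * f, ?_⟩
    rw [map_add, map_mul, evalTrunc_C, evalTrunc_X, ← hr, ← hu, ← map_mul,
      mk_t_mul ht (u' := a'), ← map_add, ← ha', add_sub_cancel]
    rw [← hf, ← factor_evalTrunc σ N ht hσ, ← hu, Ideal.Quotient.factor_mk]

/-- Uniqueness of the digits: the constant coefficient vanishes modulo the maximal ideal, then one
factor `t` is cancelled, which is possible in a domain, and N drops by one. -/
theorem coeff_eq_zero_of_evalTrunc [IsDomain R] (h0 : t ≠ 0) (hσ : ∀ N x, Ideal.Quotient.factor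
      (Ideal.pow_le_pow_right (Nat.le_succ N)) (σ (N + 1) x) = σ N x)
    (f : PowerSeries (ResidueField R)) (hf : evalTrunc σ N ht f = 0) :
    ∀ i < N, PowerSeries.coeff i f = 0 := by
  induction N generalizing f with
  | zero => intro i hi; omega
  | succ N ih =>
    have h1 (M : ℕ) (hM : evalTrunc σ (M + 1) ht f = 0) : evalTrunc σ 1 ht f = 0 := by
      induction M with
      | zero => exact hM
      | succ M ih =>
        refine ih ?_
        rw [← factor_evalTrunc σ _ ht hσ, hM, map_zero]
    have h2 := h1 N hf
    rw [evalTrunc_apply, Finset.sum_range_one, pow_zero, mul_one] at h2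
    have hnt : Nontrivial (R ⧸ maximalIdeal R ^ 1) := by
      rw [pow_one]; exact (Ideal.Quotient.nontrivial_iff).2 (maximalIdeal.isMaximal R).ne_top
    have h3 : PowerSeries.coeff 0 f = 0 := (map_eq_zero (σ 1)).1 h2
    obtain ⟨g, rfl⟩ : PowerSeries.X ∣ f := by
      rwa [PowerSeries.X_dvd_iff, ← PowerSeries.coeff_zero_eq_constantCoeff_apply]
    obtain ⟨u, hu⟩ := Ideal.Quotient.mk_surjective (evalTrunc σ (N + 1) ht g)
    rw [map_mul, evalTrunc_X, ← hu, ← map_mul, Ideal.Quotient.eq_zero_iff_mem, ht,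
      Ideal.span_singleton_pow, Ideal.mem_span_singleton, pow_succ',
      mul_dvd_mul_iff_left h0] at hf
    have h4 : evalTrunc σ N ht g = 0 := by
      rw [← factor_evalTrunc σ _ ht hσ, ← hu, Ideal.Quotient.factor_mk,
        Ideal.Quotient.eq_zero_iff_mem, ht, Ideal.span_singleton_pow, Ideal.mem_span_singleton]
      exact hf
    intro i hi
    cases i with
    | zero => exact h3
    | succ i =>
      rw [PowerSeries.coeff_succ_X_mul]
      exact ih g h4 i (by omega)

include p ht in
/-- A local domain of characteristic `p` whose maximal ideal is generated by a nonzero element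
`t` maps to the ring of power series in `t` over its residue field. -/
theorem exists_expansion [IsDomain R] (h0 : t ≠ 0) :
    ∃ c : R →+* PowerSeries (ResidueField R),
      (∀ a, PowerSeries.constantCoeff (c a) = residue R a) ∧ c t = PowerSeries.X := by
  obtain ⟨σ, hσ, hσ1⟩ := exists_residue_sections R p
  have hex (a : R) : ∃ f, ∀ N, evalTrunc σ N ht f = Ideal.Quotient.mk _ a := by
    choose F hF using fun N => exists_evalTrunc_eq σ N ht hσ hσ1 a
    have hF' (N M : ℕ) (h : N ≤ M) : evalTrunc σ N ht (F M) = Ideal.Quotient.mk _ a := by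
      obtain ⟨d, rfl⟩ := Nat.exists_eq_add_of_le h
      clear h
      induction d generalizing N with
      | zero => exact hF N
      | succ d ih =>
        have := ih (N + 1)
        rw [show N + 1 + d = N + (d + 1) by ring] at this
        rw [← factor_evalTrunc σ N ht hσ, this, Ideal.Quotient.factor_mk]
    -- The coefficient of index i is determined by the expansion modulo the power i + 1 of the
    -- maximal ideal, so it is read off from `F (i + 1)`.
    refine ⟨PowerSeries.mk fun i => PowerSeries.coeff i (F (i + 1)), fun N => ?_⟩
    rw [← hF N, evalTrunc_apply, evalTrunc_apply]
    refine Finset.sum_congr rfl fun i hi => ?_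
    have hi' : i + 1 ≤ N := Finset.mem_range.1 hi
    have := coeff_eq_zero_of_evalTrunc σ (i + 1) ht h0 hσ (F (i + 1) - F N)
      (by rw [map_sub, hF' _ _ le_rfl, hF' _ _ hi', sub_self]) i (Nat.lt_succ_self i)
    rw [map_sub, sub_eq_zero] at this
    rw [PowerSeries.coeff_mk, this]
  have huniq {f g : PowerSeries (ResidueField R)}
      (h : ∀ N, evalTrunc σ N ht f = evalTrunc σ N ht g) : f = g := by
    ext i
    have := coeff_eq_zero_of_evalTrunc σ (i + 1) ht h0 hσ (f - g)
      (by rw [map_sub, h, sub_self]) i (Nat.lt_succ_self i)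
    rwa [map_sub, sub_eq_zero] at this
  choose c hc using hex
  refine ⟨{ toFun := c, map_one' := huniq fun N => ?_, map_zero' := huniq fun N => ?_,
            map_add' := fun a b => huniq fun N => ?_, map_mul' := fun a b => huniq fun N => ?_ },
    fun a => ?_, huniq fun N => ?_⟩
  · rw [hc, map_one, map_one]
  · rw [hc, map_mul, map_mul, hc, hc]
  · rw [hc, map_zero, map_zero]
  · rw [hc, map_add, map_add, hc, hc]
  · have h1 := hc a 1
    rw [evalTrunc_apply, Finset.sum_range_one, pow_zero, mul_one] at h1
    rw [PowerSeries.coeff_zero_eq_constantCoeff_apply] at h1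
    exact (hσ1 _ _ h1).symm
  · exact (hc t N).trans (evalTrunc_X σ N ht).symm

end Expansion

/-! ### Discretely valued fields -/

section Valued

variable {F : Type u} [Field F] (v : Valuation F ℤᵐ⁰)

theorem val_ne_zero (g : Fˣ) : v g ≠ 0 := (Valuation.ne_zero_iff v).2 g.ne_zero

/-- The unit of the valuation ring given by an element of valuation `1`. -/
def unitOfVal (g : Fˣ) (hg : v g = 1) : v.valuationSubringˣ where
  val := ⟨g, hg.le⟩
  inv := ⟨↑g⁻¹, by
    change v (↑g⁻¹ : F) ≤ 1
    rw [Units.val_inv_eq_inv_val, map_inv₀, hg, inv_one]⟩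
  val_inv := Subtype.ext (Units.mul_inv g)
  inv_val := Subtype.ext (Units.inv_mul g)

theorem toF_unitOfVal (g : Fˣ) (hg : v g = 1) : toF (unitOfVal v g hg) = g := Units.ext rfl

variable {v} {t : Fˣ} (ht : v t = WithZero.exp (-1 : ℤ))

include ht

theorem val_uniformizer_zpow (m : ℤ) : v ((t ^ m : Fˣ) : F) = WithZero.exp (-m) := by
  rw [Units.val_zpow_eq_zpow_val, map_zpow₀, ht, ← WithZero.exp_zsmul, smul_eq_mul, mul_neg_one]

theorem exists_eq_zpow_mul (g : Fˣ) : ∃ (m : ℤ) (u : v.valuationSubringˣ), g = t ^ m * toF u := by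
  have h0 := val_ne_zero v g
  obtain ⟨m, hm⟩ : ∃ m : ℤ, v g = WithZero.exp m := ⟨_, (WithZero.exp_log h0).symm⟩
  refine ⟨-m, unitOfVal v (t ^ m * g) ?_, ?_⟩
  · rw [Units.val_mul, map_mul, val_uniformizer_zpow ht, hm, ← WithZero.exp_add, neg_add_cancel,
      WithZero.exp_zero]
  · rw [toF_unitOfVal, ← mul_assoc, ← zpow_add, neg_add_cancel, zpow_zero, one_mul]

theorem exists_eq_inv_pow_mul {f : F} {i : ℕ} (hf : v f ≤ WithZero.exp (i : ℤ)) :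
    ∃ a : v.valuationSubring, f = ((t : F) ^ i)⁻¹ * (a : F) := by
  refine ⟨⟨(t : F) ^ i * f, ?_⟩, ?_⟩
  · change v _ ≤ 1
    have h := val_uniformizer_zpow ht i
    rw [zpow_natCast, Units.val_pow_eq_pow_val] at h
    rw [map_mul, h]
    refine (mul_le_mul_right hf _).trans_eq ?_
    rw [← WithZero.exp_add, neg_add_cancel, WithZero.exp_zero]
  · rw [← mul_assoc, inv_mul_cancel₀ (pow_ne_zero _ t.ne_zero), one_mul]

theorem val_inv_pow_mul (i : ℕ) (a : v.valuationSubring) :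
    v (((t : F) ^ i)⁻¹ * (a : F)) ≤ WithZero.exp (i : ℤ) := by
  have h := val_uniformizer_zpow ht (-i)
  rw [zpow_neg, zpow_natCast, Units.val_inv_eq_inv_val, Units.val_pow_eq_pow_val, neg_neg] at h
  rw [map_mul, h]
  exact (mul_le_mul_right a.2 _).trans_eq (mul_one _)

omit ht in
/-- A uniformizer as an element of the valuation ring. -/
def intUniformizer (ht : v t = WithZero.exp (-1 : ℤ)) : v.valuationSubring :=
  ⟨t, by
    change v t ≤ 1
    rw [ht, ← WithZero.exp_zero, WithZero.exp_le_exp]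
    norm_num⟩

omit ht in
theorem mem_maximalIdeal_iff (x : v.valuationSubring) :
    x ∈ IsLocalRing.maximalIdeal v.valuationSubring ↔ v (x : F) < 1 := by
  rw [IsLocalRing.mem_maximalIdeal, mem_nonunits_iff]
  constructor
  · intro h
    refine lt_of_le_of_ne x.2 fun h1 => h ?_
    have h0 : (x : F) ≠ 0 := by
      intro h0; rw [h0, map_zero] at h1; exact zero_ne_one h1
    exact (unitOfVal v (Units.mk0 _ h0) h1).isUnit
  · rintro h ⟨u, rfl⟩
    have h1 : v ((u : v.valuationSubring) : F) * v ((↑u⁻¹ : v.valuationSubring) : F) = 1 := by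
      rw [← map_mul, ← map_one v]
      exact congrArg (fun y : v.valuationSubring => v (y : F)) u.mul_inv
    have h2 : v ((↑u⁻¹ : v.valuationSubring) : F) ≤ 1 := (↑u⁻¹ : v.valuationSubring).2
    have := mul_lt_mul_of_lt_of_le_of_nonneg_of_pos h h2 zero_le zero_lt_one
    rw [h1, one_mul] at this
    exact lt_irrefl _ this

theorem maximalIdeal_eq_span :
    IsLocalRing.maximalIdeal v.valuationSubring = Ideal.span {intUniformizer ht} := by
  ext x
  rw [mem_maximalIdeal_iff, Ideal.mem_span_singleton]
  constructor
  · intro h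
    have h2 : v ((x : F) * ((t : F))⁻¹) ≤ 1 := by
      by_cases h0 : (x : F) = 0
      · simp [h0]
      · obtain ⟨m, hx⟩ : ∃ m : ℤ, v (x : F) = WithZero.exp m :=
          ⟨_, (WithZero.exp_log ((Valuation.ne_zero_iff v).2 h0)).symm⟩
        rw [hx, ← WithZero.exp_zero, WithZero.exp_lt_exp] at h
        rw [map_mul, map_inv₀, ht, hx, ← WithZero.exp_neg, ← WithZero.exp_add,
          ← WithZero.exp_zero, WithZero.exp_le_exp]
        omega
    refine ⟨⟨_, h2⟩, Subtype.ext ?_⟩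
    change (x : F) = (t : F) * ((x : F) * (t : F)⁻¹)
    rw [mul_left_comm, mul_inv_cancel₀ t.ne_zero, mul_one]
  · rintro ⟨y, rfl⟩
    change v ((t : F) * (y : F)) < 1
    rw [map_mul, ht]
    refine (mul_le_mul_right y.2 _).trans_lt ?_
    rw [mul_one, ← WithZero.exp_zero, WithZero.exp_lt_exp]
    norm_num

theorem intUniformizer_ne_zero : intUniformizer ht ≠ 0 := by
  intro h
  exact t.ne_zero (congrArg (fun y : v.valuationSubring => (y : F)) h)

omit ht in
instance {p : ℕ} [CharP F p] : CharP v.valuationSubring p :=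
  (RingHom.charP_iff (algebraMap v.valuationSubring F) Subtype.val_injective p).2 inferInstance

end Valued

/-! ### Forms with poles -/

section Pole

variable {F : Type u} [Field F] (v : Valuation F ℤᵐ⁰)

/-- The forms with a pole of order at most `i`. -/
def poleForms (i : ℕ) : AddSubgroup (DiffAlg F) :=
  AddSubgroup.closure {x | ∃ (f : F) (L : List Fˣ), v f ≤ WithZero.exp (i : ℤ) ∧ x = f • dlogs L}

theorem poleForms_mono : Monotone (poleForms v) := by
  intro i j hij
  refine AddSubgroup.closure_mono ?_
  rintro _ ⟨f, L, hf, rfl⟩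
  exact ⟨f, L, hf.trans (by simpa using hij), rfl⟩

variable (t : Fˣ) (i : ℕ)

/-- The form `t ^ (-i) (x + dt / t ∧ y)`. -/
def polar : DiffAlg v.valuationSubring × DiffAlg v.valuationSubring →+ DiffAlg F where
  toFun z := ((t : F) ^ i)⁻¹ • (formMap v.valuationSubring F z.1 +
    dlg t * formMap v.valuationSubring F z.2)
  map_zero' := by simp
  map_add' z z' := by
    rw [← smul_add, Prod.fst_add, Prod.snd_add, map_add, map_add, mul_add, add_add_add_comm]

theorem polar_apply (x y : DiffAlg v.valuationSubring) : polar v t i (x, y) =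
    ((t : F) ^ i)⁻¹ • (formMap v.valuationSubring F x + dlg t * formMap v.valuationSubring F y) :=
  rfl

theorem polar_smul_dlogs (a : v.valuationSubring) (L : List v.valuationSubringˣ) :
    polar v t i (a • dlogs L, 0) = (((t : F) ^ i)⁻¹ * (a : F)) • dlogs (L.map toF) := by
  rw [polar_apply, map_zero, mul_zero, add_zero, formMap_smul, formMap_dlogs, smul_smul]
  rfl

theorem polar_smul_dlogs' (a : v.valuationSubring) (L : List v.valuationSubringˣ) :
    polar v t i (0, a • dlogs L) = (((t : F) ^ i)⁻¹ * (a : F)) • dlogs (t :: L.map toF) := by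
  rw [polar_apply, map_zero, zero_add, formMap_smul, formMap_dlogs, mul_smul_comm, smul_smul]
  rfl

variable {v t} (ht : v t = WithZero.exp (-1 : ℤ))

include ht

theorem polar_mem_poleForms (z) : polar v t i z ∈ poleForms v i := by
  obtain ⟨x, y⟩ := z
  rw [show (x, y) = (x, 0) + (0, y) by simp, map_add]
  refine add_mem ?_ ?_
  · induction mem_closure_dlogs x using AddSubgroup.closure_induction with
    | zero => rw [← Prod.zero_eq_mk, map_zero]; exact zero_mem _
    | add x x' _ _ h h' =>
      rw [show (x + x', (0 : DiffAlg v.valuationSubring)) = (x, 0) + (x', 0) by simp, map_add]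
      exact add_mem h h'
    | neg x _ h =>
      rw [show (-x, (0 : DiffAlg v.valuationSubring)) = -(x, 0) by simp, map_neg]
      exact neg_mem h
    | mem x hx =>
      obtain ⟨a, L, rfl⟩ := hx
      rw [polar_smul_dlogs]
      exact AddSubgroup.subset_closure ⟨_, _, val_inv_pow_mul ht i a, rfl⟩
  · induction mem_closure_dlogs y using AddSubgroup.closure_induction with
    | zero => rw [← Prod.zero_eq_mk, map_zero]; exact zero_mem _
    | add x x' _ _ h h' =>
      rw [show ((0 : DiffAlg v.valuationSubring), x + x') = (0, x) + (0, x') by simp, map_add]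
      exact add_mem h h'
    | neg x _ h =>
      rw [show ((0 : DiffAlg v.valuationSubring), -x) = -(0, x) by simp, map_neg]
      exact neg_mem h
    | mem x hx =>
      obtain ⟨a, L, rfl⟩ := hx
      rw [polar_smul_dlogs']
      exact AddSubgroup.subset_closure ⟨_, _, val_inv_pow_mul ht i a, rfl⟩

/-- A factor g = t^m u contributes m dlog t + dlog u, and at most one factor dlog t survives in a
product because its square is zero. -/
theorem exists_dlogs_eq (L : List Fˣ) : ∃ x ∈ Forms v.valuationSubring L.length,
    ∃ y ∈ Forms v.valuationSubring (L.length - 1 : ℤ), dlogs L =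
      formMap v.valuationSubring F x + dlg t * formMap v.valuationSubring F y := by
  induction L with
  | nil => exact ⟨1, one_mem_forms, 0, zero_mem _, by simp⟩
  | cons g L ih =>
    obtain ⟨x, hx, y, hy, h⟩ := ih
    obtain ⟨m, u, rfl⟩ := exists_eq_zpow_mul ht g
    refine ⟨dlg u * x, ?_, m • x - dlg u * y, ?_, ?_⟩
    · rw [List.length_cons, Nat.cast_succ]
      exact ι_mul_mem_forms _ hx
    · rw [List.length_cons, Nat.cast_succ, add_sub_cancel_right]
      refine sub_mem (zsmul_mem hx m) ?_
      have := ι_mul_mem_forms (dlog u) hy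
      rwa [sub_add_cancel] at this
    · rw [dlogs_cons, h, dlg_mul, dlg_zpow, map_mul, map_sub, map_zsmul, map_mul, formMap_dlg]
      change (m • dlg t + dlg (toF u)) * _ = dlg (toF u) * _ + dlg t * (_ - dlg (toF u) * _)
      rw [add_mul, mul_add, mul_add, mul_sub, ← mul_assoc (m • dlg t), smul_mul_assoc, smul_mul_assoc, dlg_sq,
        smul_zero, zero_mul, ← mul_assoc, ← mul_assoc,
        eq_neg_of_add_eq_zero_left (dlg_mul_swap (toF u) t), mul_smul_comm, neg_mul]
      abel

theorem exists_polar_eq {z : DiffAlg F} (hz : z ∈ poleForms v i) : ∃ x, polar v t i x = z := by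
  change z ∈ (polar v t i).range
  refine (AddSubgroup.closure_le _).2 ?_ hz
  rintro _ ⟨f, L, hf, rfl⟩
  obtain ⟨a, rfl⟩ := exists_eq_inv_pow_mul ht hf
  obtain ⟨x, -, y, -, h⟩ := exists_dlogs_eq ht L
  refine ⟨(a • x, a • y), ?_⟩
  rw [polar_apply, formMap_smul, formMap_smul, h, mul_smul_comm, ← smul_add, smul_smul]
  rfl

/-- A form that reduces to zero has a smaller pole. -/
theorem polar_mem_poleForms_of_formMap_eq_zero {x y : DiffAlg v.valuationSubring}
    (hx : formMap v.valuationSubring (ResField v) x = 0)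
    (hy : formMap v.valuationSubring (ResField v) y = 0) :
    polar v t (i + 1) (x, y) ∈ poleForms v i := by
  have hdiv {a : v.valuationSubring} (ha : algebraMap v.valuationSubring (ResField v) a = 0) :
      ∃ b, a = intUniformizer ht * b := by
    have : a ∈ IsLocalRing.maximalIdeal v.valuationSubring :=
      (IsLocalRing.residue_eq_zero_iff a).1 ha
    rwa [maximalIdeal_eq_span ht, Ideal.mem_span_singleton] at this
  have hs : ((t : F) ^ (i + 1))⁻¹ * (t : F) = ((t : F) ^ i)⁻¹ := by
    rw [pow_succ, mul_inv, mul_assoc, inv_mul_cancel₀ t.ne_zero, mul_one]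
  have hdt : dd (t : F) = (t : F) • dlg t := (smul_dlg t).symm
  have htF : algebraMap v.valuationSubring F (intUniformizer ht) = (t : F) := rfl
  have hsurj : Function.Surjective (algebraMap v.valuationSubring (ResField v)) :=
    IsLocalRing.residue_surjective
  rw [show (x, y) = (x, 0) + (0, y) by simp, map_add]
  refine add_mem ?_ ?_
  · have h0 := mem_closure_of_formMap_eq_zero _ _ hsurj hx
    clear hx hy
    induction h0 using AddSubgroup.closure_induction with
    | zero => rw [← Prod.zero_eq_mk, map_zero]; exact zero_mem _
    | add x x' _ _ h h' =>
      rw [show (x + x', (0 : DiffAlg v.valuationSubring)) = (x, 0) + (x', 0) by simp, map_add]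
      exact add_mem h h'
    | neg x _ h =>
      rw [show (-x, (0 : DiffAlg v.valuationSubring)) = -(x, 0) by simp, map_neg]
      exact neg_mem h
    | mem x hx =>
      rcases hx with ⟨a, z, ha, rfl⟩ | ⟨a, z, ha, rfl⟩
      · obtain ⟨b, rfl⟩ := hdiv ha
        convert! polar_mem_poleForms i ht (b • z, 0) using 1
        simp only [polar_apply, map_zero, mul_zero, add_zero, formMap_smul, map_mul, htF]
        rw [smul_smul, smul_smul, ← mul_assoc, hs]
      -- Since dt = t dlog t, the differential of t b is t (db + b dlog t): it is divisible by t
      -- among logarithmic forms.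
      · obtain ⟨b, rfl⟩ := hdiv ha
        convert! polar_mem_poleForms i ht (dd b * z, b • z) using 1
        simp only [polar_apply, map_zero, mul_zero, add_zero, formMap_smul, map_mul, htF,
          formMap_dd]
        rw [dd_mul, hdt, add_mul, smul_add, smul_mul_assoc, smul_smul, hs, smul_mul_assoc,
          smul_mul_assoc, smul_smul _ (t : F), smul_smul, mul_comm _ (t : F), ← mul_assoc,
          hs, smul_add, mul_smul_comm, smul_smul]
  · have h0 := mem_closure_of_formMap_eq_zero _ _ hsurj hy
    clear hx hy
    induction h0 using AddSubgroup.closure_induction with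
    | zero => rw [← Prod.zero_eq_mk, map_zero]; exact zero_mem _
    | add x x' _ _ h h' =>
      rw [show ((0 : DiffAlg v.valuationSubring), x + x') = (0, x) + (0, x') by simp, map_add]
      exact add_mem h h'
    | neg x _ h =>
      rw [show ((0 : DiffAlg v.valuationSubring), -x) = -(0, x) by simp, map_neg]
      exact neg_mem h
    | mem x hx =>
      rcases hx with ⟨a, z, ha, rfl⟩ | ⟨a, z, ha, rfl⟩
      · obtain ⟨b, rfl⟩ := hdiv ha
        convert! polar_mem_poleForms i ht (0, b • z) using 1
        simp only [polar_apply, map_zero, zero_add, formMap_smul, map_mul, htF]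
        rw [mul_smul_comm, mul_smul_comm, smul_smul, smul_smul, ← mul_assoc, hs]
      -- After multiplication by dlog t, only t db remains of d(t b).
      · obtain ⟨b, rfl⟩ := hdiv ha
        convert! polar_mem_poleForms i ht (0, dd b * z) using 1
        simp only [polar_apply, map_zero, zero_add, map_mul, htF, formMap_dd]
        rw [dd_mul, hdt, add_mul, mul_add, smul_mul_assoc, smul_mul_assoc, smul_mul_assoc,
          mul_smul_comm, mul_smul_comm, mul_smul_comm, ← mul_assoc (dlg t) (dlg t), dlg_sq,
          zero_mul, smul_zero, smul_zero, add_zero, smul_smul, hs]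

end Pole

theorem formMap_formMap (A B C : Type*) [CommRing A] [CommRing B] [CommRing C] [Algebra A B]
    [Algebra B C] [Algebra A C] [IsScalarTower A B C] (z : DiffAlg A) :
    formMap B C (formMap A B z) = formMap A C z := by
  induction z using diffAlg_induction with
  | algebraMap a =>
    rw [formMap_algebraMap A B, formMap_algebraMap B C, formMap_algebraMap A C,
      ← IsScalarTower.algebraMap_apply A B C]
  | der a => rw [formMap_dd, formMap_dd, formMap_dd, ← IsScalarTower.algebraMap_apply]
  | mul x y hx hy => simp only [map_mul, hx, hy]
  | add x y hx hy => simp only [map_add, hx, hy]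

theorem formMap_id (A : Type*) [CommRing A] (z : DiffAlg A) : formMap A A z = z := by
  induction z using diffAlg_induction with
  | algebraMap a => rw [formMap_algebraMap]; rfl
  | der a => rw [formMap_dd]; rfl
  | mul x y hx hy => simp only [map_mul, hx, hy]
  | add x y hx hy => simp only [map_add, hx, hy]

/-! ### Embedding the field into series, and leading forms of relations -/

section LeadField

variable {F : Type u} [Field F] {v : Valuation F ℤᵐ⁰} {t : Fˣ}
  {Γ : Type w} [AddCommGroup Γ] [LinearOrder Γ] [IsOrderedAddMonoid Γ]
  {l : Type*} [Field l] (p : ℕ) [Fact p.Prime] [CharP l p] (χ : Γ →+ l)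

/-- The form with pole of order i becomes a series whose lowest possible exponent is -(i e), with
the reductions of x and y as its coefficient there; then `lead_of_mem_relTotal` applies. The general
group of exponents serves two purposes: Laurent series over the residue field, and the series into
which the tame closure embeds. -/
theorem lead_of_formMap_mem_relTotal [Algebra (ResField v) l]
    (hχ : ∀ a, χ a ^ p = χ a) [Algebra F (HahnSeries Γ l)] {e : Γ} (hpos : 0 < e) (he : χ e = 1)
    (hgt : algebraMap F (HahnSeries Γ l) t = HahnSeries.single e 1)
    (h0 : ∀ a : v.valuationSubring, (algebraMap F (HahnSeries Γ l) (a : F)).coeff 0 =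
      algebraMap (ResField v) l (IsLocalRing.residue _ a))
    (hneg : ∀ a : v.valuationSubring, ∀ γ < 0, (algebraMap F (HahnSeries Γ l) (a : F)).coeff γ = 0)
    (i : ℕ) (x y : DiffAlg v.valuationSubring)
    (h : formMap F (HahnSeries Γ l) (polar v t i (x, y)) ∈ relTotal (HahnSeries Γ l) p) :
    (i = 0 → formMap (ResField v) l (formMap _ (ResField v) x) ∈ relTotal l p ∧
      formMap (ResField v) l (formMap _ (ResField v) y) ∈ relTotal l p) ∧
    (0 < i → p ∣ i → extD l (formMap (ResField v) l (formMap _ (ResField v) x)) = 0 ∧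
      extD l (formMap (ResField v) l (formMap _ (ResField v) y)) = 0) ∧
    (0 < i → ¬ p ∣ i → formMap (ResField v) l (formMap _ (ResField v) y) = 0 →
      formMap (ResField v) l (formMap _ (ResField v) x) = 0) := by
  let _ : Algebra v.valuationSubring (HahnSeries Γ l) :=
    ((algebraMap F (HahnSeries Γ l)).comp (algebraMap v.valuationSubring F)).toAlgebra
  have _ : IsScalarTower v.valuationSubring F (HahnSeries Γ l) := .of_algebraMap_eq fun _ => rfl
  let _ : Algebra v.valuationSubring l :=
    ((algebraMap (ResField v) l).comp (algebraMap v.valuationSubring (ResField v))).toAlgebra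
  have _ : IsScalarTower v.valuationSubring (ResField v) l := .of_algebraMap_eq fun _ => rfl
  rw [formMap_formMap, formMap_formMap]
  have hz : formMap F (HahnSeries Γ l) (polar v t i (x, y)) =
      HahnSeries.single (-(i • e)) (1 : l) • (formMap v.valuationSubring (HahnSeries Γ l) x +
        dlg (Units.map (algebraMap F (HahnSeries Γ l) : F →* HahnSeries Γ l) t) *
          formMap v.valuationSubring (HahnSeries Γ l) y) := by
    rw [polar_apply, formMap_smul, map_add, map_mul, formMap_formMap, formMap_formMap,
      formMap_dlg, map_inv₀, map_pow, hgt, HahnSeries.single_pow, one_pow]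
    congr 1
    rw [inv_eq_iff_eq_inv, eq_comm, inv_eq_of_mul_eq_one_left]
    rw [HahnSeries.single_mul_single, add_neg_cancel, mul_one]; rfl
  obtain ⟨h1, h2⟩ := hahnForms_pole χ v.valuationSubring h0 hneg e _ hgt he (i • e) x y _ hz
  have hi : 0 < i → 0 < i • e := fun hi => nsmul_pos hpos hi.ne'
  obtain ⟨h3, h4, h5⟩ := lead_of_mem_relTotal p χ hχ h (nsmul_nonneg hpos.le i) h1 h2
  refine ⟨fun hi0 => h3 (by rw [hi0, zero_smul]), fun hi0 ⟨j, hj⟩ => h4 (hi hi0) ⟨j • e, ?_⟩,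
    fun hi0 hpi => h5 (hi hi0) ?_⟩
  · rw [hj, mul_smul]
  · rw [map_nsmul, he, nsmul_eq_mul, mul_one]
    exact fun h => hpi ((CharP.cast_eq_zero_iff l p i).1 h)

variable [CharP F p] (ht : v t = WithZero.exp (-1 : ℤ))

include ht p in
/-- The embedding of the valuation ring of a discretely valued field into a ring of power series. -/
theorem exists_injective_expansion : ∃ c : v.valuationSubring →+* PowerSeries (ResField v),
    Function.Injective c ∧ (∀ a, PowerSeries.constantCoeff (c a) = IsLocalRing.residue _ a) ∧
    c (intUniformizer ht) = PowerSeries.X := by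
  obtain ⟨c, hc, hct⟩ := exists_expansion p (maximalIdeal_eq_span ht) (intUniformizer_ne_zero ht)
  refine ⟨c, (injective_iff_map_eq_zero c).2 fun a ha => ?_, hc, hct⟩
  by_contra h0
  have h1 : (a : F) ≠ 0 := fun h => h0 (Subtype.ext h)
  obtain ⟨m, u, hm⟩ := exists_eq_zpow_mul ht (Units.mk0 _ h1)
  -- The identity a = t^m u is cleared of negative powers of t; in power series it then contradicts
  -- c(a) = 0.
  have h2 : a * intUniformizer ht ^ (-m).toNat = intUniformizer ht ^ m.toNat * u := by
    refine Subtype.ext ?_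
    have hm' : (a : F) = (t : F) ^ m * ((u : v.valuationSubring) : F) := by
      have := congrArg Units.val hm
      rwa [Units.val_mul, Units.val_zpow_eq_zpow_val] at this
    change (a : F) * (t : F) ^ (-m).toNat = (t : F) ^ m.toNat * ((u : v.valuationSubring) : F)
    rw [hm', mul_right_comm]
    congr 1
    rw [← zpow_natCast, ← zpow_natCast, ← zpow_add₀ t.ne_zero]
    congr 1
    omega
  have h3 := congrArg c h2
  rw [map_mul, ha, zero_mul, map_mul, map_pow, hct] at h3
  exact mul_ne_zero (pow_ne_zero _ PowerSeries.X_ne_zero) (u.isUnit.map c).ne_zero h3.symm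

include ht p in
/-- The embedding of a discretely valued field into a field of Laurent series. -/
theorem exists_laurent : ∃ g : F →+* HahnSeries ℤ (ResField v),
    g t = HahnSeries.single 1 1 ∧
    (∀ a : v.valuationSubring, (g (a : F)).coeff 0 = IsLocalRing.residue _ a) ∧
    ∀ a : v.valuationSubring, ∀ γ < 0, (g (a : F)).coeff γ = 0 := by
  obtain ⟨c, hcinj, hc, hct⟩ := exists_injective_expansion p ht
  let f : v.valuationSubring →+* HahnSeries ℤ (ResField v) :=
    (HahnSeries.ofPowerSeries ℤ (ResField v)).comp c
  have hf : Function.Injective f := HahnSeries.ofPowerSeries_injective.comp hcinj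
  refine ⟨IsFractionRing.lift hf, ?_, ?_, ?_⟩
  · have : IsFractionRing.lift hf (algebraMap _ F (intUniformizer ht)) = f _ :=
      IsFractionRing.lift_algebraMap hf _
    refine this.trans ?_
    change HahnSeries.ofPowerSeries ℤ (ResField v) (c (intUniformizer ht)) = _
    rw [hct, HahnSeries.ofPowerSeries_X]
  · intro a
    have : IsFractionRing.lift hf (algebraMap _ F a) = f a := IsFractionRing.lift_algebraMap hf _
    change (IsFractionRing.lift hf (algebraMap _ F a)).coeff 0 = _
    rw [this, ← hc]
    have := HahnSeries.ofPowerSeries_apply_coeff (Γ := ℤ) (c a) 0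
    rw [Nat.cast_zero, PowerSeries.coeff_zero_eq_constantCoeff_apply] at this
    exact this
  · intro a γ hγ
    have : IsFractionRing.lift hf (algebraMap _ F a) = f a := IsFractionRing.lift_algebraMap hf _
    change (IsFractionRing.lift hf (algebraMap _ F a)).coeff γ = 0
    rw [this]
    refine HahnSeries.embDomain_of_notMem_range ?_
    rintro ⟨n, hn⟩
    have : ((n : ℕ) : ℤ) = γ := hn
    omega

include ht in
theorem lead_of_mem_relTotal_field (i : ℕ) (x y : DiffAlg v.valuationSubring)
    (h : polar v t i (x, y) ∈ relTotal F p) :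
    (i = 0 → formMap _ (ResField v) x ∈ relTotal (ResField v) p ∧
      formMap _ (ResField v) y ∈ relTotal (ResField v) p) ∧
    (0 < i → p ∣ i → extD (ResField v) (formMap _ (ResField v) x) = 0 ∧
      extD (ResField v) (formMap _ (ResField v) y) = 0) ∧
    (0 < i → ¬ p ∣ i → formMap _ (ResField v) y = 0 → formMap _ (ResField v) x = 0) := by
  obtain ⟨g, hgt, h0, hneg⟩ := exists_laurent p ht
  have _ : CharP (ResField v) p := charP_residueField _ p
  let _ : Algebra F (HahnSeries ℤ (ResField v)) := g.toAlgebra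
  have key := lead_of_formMap_mem_relTotal (l := ResField v) (v := v) (t := t) p
    (Int.castAddHom (ResField v)) (fun a => by
      have h1 := (map_intCast (frobenius (ResField v) p) a)
      exact h1) (e := (1 : ℤ)) one_pos Int.cast_one hgt h0 hneg i x y
    (formMap_mem_relTotal p _ h)
  simpa only [formMap_id] using key

end LeadField

/-! ### Criteria for forms to have smaller poles -/

section Criteria

variable {F : Type u} [Field F] {v : Valuation F ℤᵐ⁰} {t : Fˣ} (p : ℕ) [Fact p.Prime] [CharP F p]
  (ht : v t = WithZero.exp (-1 : ℤ))

include ht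

omit ht in
variable (v) in
theorem exists_map_units_eq (L : List (ResField v)ˣ) : ∃ L' : List v.valuationSubringˣ,
    L'.map (Units.map
      (algebraMap v.valuationSubring (ResField v) : v.valuationSubring →* ResField v)) = L := by
  induction L with
  | nil => exact ⟨[], rfl⟩
  | cons b L ih =>
    obtain ⟨L', rfl⟩ := ih
    obtain ⟨b', rfl⟩ := IsLocalRing.surjective_units_map_of_local_ringHom
      (algebraMap v.valuationSubring (ResField v)) IsLocalRing.residue_surjective
      (inferInstanceAs (IsLocalHom (IsLocalRing.residue v.valuationSubring))) b
    exact ⟨b' :: L', rfl⟩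

omit ht [Fact p.Prime] [CharP F p] in
theorem exists_mem_relTotal_formMap_eq {z : DiffAlg (ResField v)}
    (hz : z ∈ relTotal (ResField v) p) :
    ∃ r ∈ relTotal v.valuationSubring p, formMap _ (ResField v) r = z := by
  change z ∈ (relTotal v.valuationSubring p).map
    (formMap v.valuationSubring (ResField v)).toAddMonoidHom
  refine (AddSubgroup.closure_le _).2 ?_ hz
  rintro _ (⟨n, η, -, rfl⟩ | ⟨a, L, rfl⟩)
  · obtain ⟨η, rfl⟩ := formMap_surjective v.valuationSubring _ IsLocalRing.residue_surjective η
    exact ⟨_, extD_mem_relTotal p η, (extD_formMap _ _ η).symm⟩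
  · obtain ⟨a, rfl⟩ := IsLocalRing.residue_surjective a
    obtain ⟨L', rfl⟩ := exists_map_units_eq v L
    refine ⟨_, pow_sub_smul_dlogs_mem_relTotal p a L', ?_⟩
    change formMap _ _ ((a ^ p - a) • dlogs L') = _
    rw [formMap_smul, formMap_dlogs, map_sub, map_pow]
    rfl

/-- The part with smaller pole can be absorbed: written with denominator t^(i+1), its components are
multiples of t, so x and y keep their reductions and the difference is a relation. -/
theorem lead_of_mem_sup {i : ℕ} {x y : DiffAlg v.valuationSubring}
    (h : polar v t (i + 1) (x, y) ∈ relTotal F p ⊔ poleForms v i) :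
    (p ∣ i + 1 → extD (ResField v) (formMap _ (ResField v) x) = 0 ∧
      extD (ResField v) (formMap _ (ResField v) y) = 0) ∧
    (¬ p ∣ i + 1 → formMap _ (ResField v) y = 0 → formMap _ (ResField v) x = 0) := by
  obtain ⟨ρ, hρ, z, hz, h⟩ := AddSubgroup.mem_sup.1 h
  obtain ⟨⟨x', y'⟩, rfl⟩ := exists_polar_eq i ht hz
  have hz' : polar v t (i + 1) (intUniformizer ht • x', intUniformizer ht • y') =
      polar v t i (x', y') := by
    have hs : ((t : F) ^ (i + 1))⁻¹ * (t : F) = ((t : F) ^ i)⁻¹ := by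
      rw [pow_succ, mul_inv, mul_assoc, inv_mul_cancel₀ t.ne_zero, mul_one]
    rw [polar_apply, polar_apply, formMap_smul, formMap_smul, mul_smul_comm, ← smul_add, smul_smul]
    exact congrArg (· • _) hs
  have h1 : polar v t (i + 1) (x - intUniformizer ht • x', y - intUniformizer ht • y') = ρ := by
    rw [← Prod.mk_sub_mk, map_sub, hz', ← h, add_sub_cancel_right]
  have h2 : algebraMap v.valuationSubring (ResField v) (intUniformizer ht) = 0 :=
    (IsLocalRing.residue_eq_zero_iff _).2
      (by rw [maximalIdeal_eq_span ht]; exact Ideal.mem_span_singleton_self _)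
  obtain ⟨-, h3, h4⟩ := lead_of_mem_relTotal_field p ht _ _ _ (h1 ▸ hρ)
  simp only [map_sub, formMap_smul, h2, zero_smul, sub_zero] at h3 h4
  exact ⟨h3 i.succ_pos, h4 i.succ_pos⟩

/-- Write i + 1 = p j. By the Cartier isomorphism, the reductions are sums of forms a^p dlog b_1 ∧ ⋯
and exact forms, and these lift to integral forms. As t^(-pj) is a p-th power, it has differential
zero, so the exact parts stay exact. The others are p-th powers of t^(-j) a times logarithmic forms,
and modulo a relation the p-th power may be removed, leaving a pole of order j ≤ i. -/
theorem polar_mem_sup_of_extD_eq_zero {i : ℕ} (hi : p ∣ i + 1) {x y : DiffAlg v.valuationSubring}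
    (hx : extD (ResField v) (formMap _ (ResField v) x) = 0)
    (hy : extD (ResField v) (formMap _ (ResField v) y) = 0) :
    polar v t (i + 1) (x, y) ∈ relTotal F p ⊔ poleForms v i := by
  have hp : p.Prime := Fact.out
  have _ : CharP (ResField v) p := charP_residueField _ p
  obtain ⟨Φ, -, -, -, -, -, -, hcl, hmem⟩ := exists_inverseCartier (ResField v) p
  obtain ⟨j, hj⟩ := hi
  have hji : j ≤ i := by
    have : 2 * j ≤ p * j := Nat.mul_le_mul_right j hp.two_le
    omega
  have hsurj : Function.Surjective (algebraMap v.valuationSubring (ResField v)) :=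
    IsLocalRing.residue_surjective
  have hdt : dd ((t : F) ^ (i + 1))⁻¹ = 0 := by
    rw [hj, mul_comm p j, pow_mul, ← inv_pow, dd_pow_char]
  -- every form with closed reduction is a sum of `p`-th power forms and an exact form
  have lift (x : DiffAlg v.valuationSubring)
      (hx : extD (ResField v) (formMap _ (ResField v) x) = 0) :
      ∃ c ∈ AddSubgroup.closure {y : DiffAlg v.valuationSubring |
        ∃ (a : v.valuationSubring) (L : List v.valuationSubringˣ), y = a ^ p • dlogs L},
      ∃ η κ, formMap _ (ResField v) κ = 0 ∧ x = c + extD _ η + κ := by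
    obtain ⟨y, η, hyη⟩ := hcl _ hx
    obtain ⟨η, rfl⟩ := formMap_surjective _ _ hsurj η
    have key {z : DiffAlg (ResField v)} (hz : z ∈ AddSubgroup.closure
        {y : DiffAlg (ResField v) | ∃ (a : ResField v) (L : List (ResField v)ˣ), y = a ^ p • dlogs L}) :
        ∃ c ∈ AddSubgroup.closure {y : DiffAlg v.valuationSubring |
        ∃ (a : v.valuationSubring) (L : List v.valuationSubringˣ), y = a ^ p • dlogs L},
        formMap _ (ResField v) c = z := by
      change z ∈ (AddSubgroup.closure _).map (formMap v.valuationSubring (ResField v)).toAddMonoidHom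
      rw [AddMonoidHom.map_closure]
      refine AddSubgroup.closure_mono ?_ hz
      rintro _ ⟨a, L, rfl⟩
      obtain ⟨a, rfl⟩ := hsurj a
      obtain ⟨L', rfl⟩ := exists_map_units_eq v L
      refine ⟨_, ⟨a, L', rfl⟩, ?_⟩
      change formMap _ _ (a ^ p • dlogs L') = _
      rw [formMap_smul, formMap_dlogs, map_pow]
    obtain ⟨c, hc, hcy⟩ := key (hmem y)
    refine ⟨c, hc, η, x - c - extD _ η, ?_, by abel⟩
    rw [map_sub, map_sub, hcy, ← extD_formMap, hyη]
    abel
  obtain ⟨c, hc, η, κ, hκ, rfl⟩ := lift x hx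
  obtain ⟨c', hc', η', κ', hκ', rfl⟩ := lift y hy
  have hpow (a : v.valuationSubring) (L : List Fˣ) :
      (((t : F) ^ (i + 1))⁻¹ * (a : F) ^ p) • dlogs L ∈ relTotal F p ⊔ poleForms v i := by
    have h1 : ((t : F) ^ (i + 1))⁻¹ * (a : F) ^ p = (((t : F) ^ j)⁻¹ * (a : F)) ^ p := by
      rw [mul_pow, inv_pow, ← pow_mul, mul_comm j p, hj]
    rw [h1, ← sub_add_cancel ((((t : F) ^ j)⁻¹ * (a : F)) ^ p) (((t : F) ^ j)⁻¹ * (a : F)), add_smul]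
    refine add_mem (AddSubgroup.mem_sup_left (pow_sub_smul_dlogs_mem_relTotal p _ _))
      (AddSubgroup.mem_sup_right (poleForms_mono v hji
        (AddSubgroup.subset_closure ⟨_, _, val_inv_pow_mul ht j a, rfl⟩)))
  have hl (c) (hc : c ∈ AddSubgroup.closure {y : DiffAlg v.valuationSubring |
        ∃ (a : v.valuationSubring) (L : List v.valuationSubringˣ), y = a ^ p • dlogs L}) :
      polar v t (i + 1) (c, 0) ∈ relTotal F p ⊔ poleForms v i ∧
      polar v t (i + 1) (0, c) ∈ relTotal F p ⊔ poleForms v i := by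
    induction hc using AddSubgroup.closure_induction with
    | zero => rw [← Prod.zero_eq_mk, map_zero]; exact ⟨zero_mem _, zero_mem _⟩
    | add x x' _ _ h h' =>
      rw [show (x + x', (0 : DiffAlg v.valuationSubring)) = (x, 0) + (x', 0) by simp,
        show ((0 : DiffAlg v.valuationSubring), x + x') = (0, x) + (0, x') by simp, map_add, map_add]
      exact ⟨add_mem h.1 h'.1, add_mem h.2 h'.2⟩
    | neg x _ h =>
      rw [show (-x, (0 : DiffAlg v.valuationSubring)) = -(x, 0) by simp,
        show ((0 : DiffAlg v.valuationSubring), -x) = -(0, x) by simp, map_neg, map_neg]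
      exact ⟨neg_mem h.1, neg_mem h.2⟩
    | mem x hx =>
      obtain ⟨a, L, rfl⟩ := hx
      rw [polar_smul_dlogs, polar_smul_dlogs']
      exact ⟨hpow a _, hpow a _⟩
  have hexact : polar v t (i + 1) (extD _ η, extD _ η') =
      extD F (((t : F) ^ (i + 1))⁻¹ • (formMap _ F η - dlg t * formMap _ F η')) := by
    rw [extD_smul, hdt, zero_mul, zero_add, map_sub, extD_dlg_mul, sub_neg_eq_add, extD_formMap,
      extD_formMap, polar_apply]
  have hsum : (c + extD _ η + κ, c' + extD _ η' + κ') =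
      (c, 0) + (0, c') + (extD _ η, extD _ η') + (κ, κ') := by simp
  rw [hsum, map_add, map_add, map_add, hexact]
  exact add_mem (add_mem (add_mem (hl c hc).1 (hl c' hc').2)
    (AddSubgroup.mem_sup_left (extD_mem_relTotal p _)))
    (AddSubgroup.mem_sup_right (polar_mem_poleForms_of_formMap_eq_zero i ht hκ hκ'))

omit ht in
variable (v) in
/-- The forms without poles and without residue. -/
def intForms : AddSubgroup (DiffAlg F) :=
  AddSubgroup.closure {z : DiffAlg F | ∃ (a : v.valuationSubring)
    (L : List v.valuationSubringˣ), z = (a : F) • dlogs (L.map toF)}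

omit ht [Fact p.Prime] [CharP F p] in
theorem formMap_mem_intForms (x : DiffAlg v.valuationSubring) :
    formMap v.valuationSubring F x ∈ intForms v := by
  induction mem_closure_dlogs x using AddSubgroup.closure_induction with
  | zero => rw [map_zero]; exact zero_mem _
  | add x y _ _ h h' => rw [map_add]; exact add_mem h h'
  | neg x _ h => rw [map_neg]; exact neg_mem h
  | mem x hx =>
    obtain ⟨a, L, rfl⟩ := hx
    rw [formMap_smul, formMap_dlogs]
    exact AddSubgroup.subset_closure ⟨a, L, rfl⟩

omit [Fact p.Prime] [CharP F p] in
/-- A form without pole whose residue is a relation is, up to relations, an unramified form. -/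
theorem polar_zero_mem_sup {x y : DiffAlg v.valuationSubring}
    (hy : formMap _ (ResField v) y ∈ relTotal (ResField v) p) :
    polar v t 0 (x, y) ∈ relTotal F p ⊔ intForms v := by
  obtain ⟨r, hr, hry⟩ := exists_mem_relTotal_formMap_eq p hy
  -- Multiplication by the closed form dlog t preserves both kinds of relations.
  have h1 : dlg t * formMap v.valuationSubring F r ∈ relTotal F p := by
    clear hry
    induction hr using AddSubgroup.closure_induction with
    | zero => rw [map_zero, mul_zero]; exact zero_mem _
    | add x y _ _ h h' => rw [map_add, mul_add]; exact add_mem h h'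
    | neg x _ h => rw [map_neg, mul_neg]; exact neg_mem h
    | mem x hx =>
      rcases hx with ⟨n, η, -, rfl⟩ | ⟨a, L, rfl⟩
      · rw [← extD_formMap, ← neg_neg (dlg t * _), ← extD_dlg_mul]
        exact neg_mem (extD_mem_relTotal p _)
      · rw [formMap_smul, formMap_dlogs, mul_smul_comm, ← dlogs_cons, map_sub, map_pow]
        exact pow_sub_smul_dlogs_mem_relTotal p _ _
  -- A form with zero reduction is generated by multiples of t b and d(t b). Multiplied by dlog t
  -- they give multiples of b dt and of dt ∧ db, which are integral forms without residue.
  have h2 : dlg t * formMap v.valuationSubring F (y - r) ∈ intForms v := by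
    have h0 : formMap v.valuationSubring (ResField v) (y - r) = 0 := by
      rw [map_sub, hry, sub_self]
    have hdiv {a : v.valuationSubring} (ha : algebraMap v.valuationSubring (ResField v) a = 0) :
        ∃ b, a = intUniformizer ht * b := by
      have : a ∈ IsLocalRing.maximalIdeal v.valuationSubring :=
        (IsLocalRing.residue_eq_zero_iff a).1 ha
      rwa [maximalIdeal_eq_span ht, Ideal.mem_span_singleton] at this
    have htF : algebraMap v.valuationSubring F (intUniformizer ht) = (t : F) := rfl
    have h3 := mem_closure_of_formMap_eq_zero _ _ IsLocalRing.residue_surjective h0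
    clear h0
    generalize y - r = q at h3
    induction h3 using AddSubgroup.closure_induction with
    | zero => rw [map_zero, mul_zero]; exact zero_mem _
    | add x y _ _ h h' => rw [map_add, mul_add]; exact add_mem h h'
    | neg x _ h => rw [map_neg, mul_neg]; exact neg_mem h
    | mem x hx =>
      rcases hx with ⟨a, z, ha, rfl⟩ | ⟨a, z, ha, rfl⟩
      · obtain ⟨b, rfl⟩ := hdiv ha
        convert! formMap_mem_intForms (b • (dd (intUniformizer ht) * z)) using 1
        rw [formMap_smul, formMap_smul, map_mul, map_mul, formMap_dd, htF, ← smul_dlg t,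
          mul_smul_comm, smul_mul_assoc, smul_smul, mul_comm]
      · obtain ⟨b, rfl⟩ := hdiv ha
        convert! formMap_mem_intForms (dd (intUniformizer ht) * (dd b * z)) using 1
        rw [dd_mul, add_mul, smul_mul_assoc, smul_mul_assoc, map_add, formMap_smul, formMap_smul,
          map_mul, map_mul, map_mul, map_mul, formMap_dd, formMap_dd, htF, ← smul_dlg t, mul_add,
          mul_smul_comm, mul_smul_comm, smul_mul_assoc, smul_mul_assoc, mul_smul_comm,
          ← mul_assoc (dlg t) (dlg t), dlg_sq, zero_mul, smul_zero, smul_zero, add_zero]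
  have h3 : polar v t 0 (x, y) = dlg t * formMap _ F r +
      (formMap _ F x + dlg t * formMap _ F (y - r)) := by
    rw [polar_apply, pow_zero, inv_one, one_smul, map_sub, mul_sub]
    abel
  rw [h3]
  exact add_mem (AddSubgroup.mem_sup_left h1)
    (AddSubgroup.mem_sup_right (add_mem (formMap_mem_intForms x) h2))

omit ht in
-- For a in the maximal ideal, X^p - X - a has 0 as a simple root modulo the maximal ideal, since
-- its derivative is -1. So a = c^p - c by Hensel's lemma and every multiple of a is a relation. The
-- forms da ∧ z follow from da ∧ z = d(a z) - a dz.
theorem formMap_mem_relTotal_of_henselian [HenselianLocalRing v.valuationSubring]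
    {x : DiffAlg v.valuationSubring}
    (hx : formMap _ (ResField v) x ∈ relTotal (ResField v) p) :
    formMap v.valuationSubring F x ∈ relTotal F p := by
  have hp : p.Prime := Fact.out
  refine formMap_mem_relTotal p F ?_
  have hroot {a : v.valuationSubring} (ha : algebraMap v.valuationSubring (ResField v) a = 0) :
      ∃ c, a = c ^ p - c := by
    have ha' : a ∈ IsLocalRing.maximalIdeal v.valuationSubring :=
      (IsLocalRing.residue_eq_zero_iff a).1 ha
    have hm : (Polynomial.X ^ p - (Polynomial.X + Polynomial.C a)).Monic :=
      Polynomial.monic_X_pow_sub (by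
        rw [Polynomial.degree_X_add_C]; exact_mod_cast hp.one_lt)
    obtain ⟨c, hc, -⟩ := HenselianLocalRing.is_henselian _ hm 0
      (by simpa [hp.ne_zero] using ha')
      (by simp [Polynomial.derivative_X_pow])
    refine ⟨c, ?_⟩
    have : c ^ p - (c + a) = 0 := by simpa [Polynomial.IsRoot] using hc
    linear_combination -this
  have hsmul {a : v.valuationSubring} (ha : algebraMap v.valuationSubring (ResField v) a = 0)
      (z : DiffAlg v.valuationSubring) : a • z ∈ relTotal v.valuationSubring p := by
    induction mem_closure_dlogs z using AddSubgroup.closure_induction with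
    | zero => rw [smul_zero]; exact zero_mem _
    | add x y _ _ h h' => rw [smul_add]; exact add_mem h h'
    | neg x _ h => rw [smul_neg]; exact neg_mem h
    | mem x hx =>
      obtain ⟨b, L, rfl⟩ := hx
      obtain ⟨c, hc⟩ := hroot (a := a * b) (by rw [map_mul, ha, zero_mul])
      rw [smul_smul, hc]
      exact pow_sub_smul_dlogs_mem_relTotal p _ _
  obtain ⟨r, hr, hrx⟩ := exists_mem_relTotal_formMap_eq p hx
  rw [← add_sub_cancel r x]
  refine add_mem hr ?_
  have h0 : formMap v.valuationSubring (ResField v) (x - r) = 0 := by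
    rw [map_sub, hrx, sub_self]
  have h3 := mem_closure_of_formMap_eq_zero _ _ IsLocalRing.residue_surjective h0
  clear h0
  refine (AddSubgroup.closure_le _).2 ?_ h3
  rintro _ (⟨a, z, ha, rfl⟩ | ⟨a, z, ha, rfl⟩)
  · exact hsmul ha z
  · have : dd a * z = extD _ (a • z) - a • extD _ z := by
      rw [extD_smul, add_sub_cancel_right]
    rw [this]
    exact sub_mem (extD_mem_relTotal p _) (hsmul ha _)

end Criteria

/-- The form in which the isomorphisms are obtained: both sides are quotients of one group of
integral forms, so that only two kernels have to be compared and nothing has to be well defined on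
symbols. -/
theorem exists_addEquiv_of_ker {X Y G : Type*} [AddCommGroup X] [AddCommGroup Y] [AddCommGroup G]
    (π : X →+ Y) (hπ : Function.Surjective π) (ψ : X →+ G) (hψ : Function.Surjective ψ)
    (h : ∀ x, π x = 0 ↔ ψ x = 0) : ∃ φ : Y ≃+ G, ∀ x, φ (π x) = ψ x := by
  have hker : π.ker = ψ.ker := by
    ext x
    exact h x
  let e := (QuotientAddGroup.quotientKerEquivOfSurjective π hπ).symm.trans
    ((QuotientAddGroup.quotientAddEquivOfEq hker).trans
      (QuotientAddGroup.quotientKerEquivOfSurjective ψ hψ))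
  refine ⟨e, fun x => ?_⟩
  have : (QuotientAddGroup.quotientKerEquivOfSurjective π hπ).symm (π x) = QuotientAddGroup.mk x := by
    rw [AddEquiv.symm_apply_eq]; rfl
  change QuotientAddGroup.quotientKerEquivOfSurjective ψ hψ
    (QuotientAddGroup.quotientAddEquivOfEq hker
      ((QuotientAddGroup.quotientKerEquivOfSurjective π hπ).symm (π x))) = _
  rw [this]
  rfl

/-! ### The filtration and its graded pieces -/

section Filtration

variable {F : Type u} [Field F] {v : Valuation F ℤᵐ⁰} (t : Fˣ) (p : ℕ)

theorem mem_closure_symb (x : H F p n) : x ∈ AddSubgroup.closure {x : H F p n |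
    ∃ (m : ℕ) (hm : (m : ℤ) = n) (f : F) (g : Fin m → Fˣ), x = symb p hm f g} := by
  obtain ⟨z, rfl⟩ := QuotientAddGroup.mk_surjective x
  have h := AddSubgroup.mem_map_of_mem (QuotientAddGroup.mk' (relations F p n))
    (mem_closure_logForm z)
  rw [AddMonoidHom.map_closure] at h
  refine AddSubgroup.closure_mono ?_ h
  rintro _ ⟨_, ⟨m, hm, a, b, rfl⟩, rfl⟩
  exact ⟨m, hm, a, b, rfl⟩

theorem U_mono (n : ℤ) : Monotone (U p v n) := by
  intro i j hij
  refine AddSubgroup.closure_mono ?_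
  rintro _ ⟨m, hm, f, g, hf, rfl⟩
  exact ⟨m, hm, f, g, hf.trans (by simpa using hij), rfl⟩

theorem exists_mem_U (n : ℤ) (x : H F p n) : ∃ i, x ∈ U p v n i := by
  induction mem_closure_symb p x using AddSubgroup.closure_induction with
  | zero => exact ⟨0, zero_mem _⟩
  | add x y _ _ hx hy =>
    obtain ⟨⟨i, hi⟩, j, hj⟩ := And.intro hx hy
    exact ⟨max i j, add_mem (U_mono p n (le_max_left i j) hi) (U_mono p n (le_max_right i j) hj)⟩
  | neg x _ hx =>
    obtain ⟨i, hi⟩ := hx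
    exact ⟨i, neg_mem hi⟩
  | mem x hx =>
    obtain ⟨m, hm, f, g, rfl⟩ := hx
    by_cases h0 : v f = 0
    · exact ⟨0, AddSubgroup.subset_closure ⟨m, hm, f, g, by rw [h0]; exact zero_le, rfl⟩⟩
    · refine ⟨(WithZero.log (v f)).toNat,
        AddSubgroup.subset_closure ⟨m, hm, f, g, ?_, rfl⟩⟩
      rw [← WithZero.exp_log h0, WithZero.exp_le_exp, WithZero.log_exp]
      exact Int.self_le_toNat _

theorem unramified_le_U (n : ℤ) : unramified p v n ≤ U p v n 0 := by
  refine (AddSubgroup.closure_le _).2 ?_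
  rintro _ ⟨m, hm, a, b, rfl⟩
  exact AddSubgroup.subset_closure ⟨m, hm, a, _, by
    rw [Nat.cast_zero, WithZero.exp_zero]; exact a.2, rfl⟩

/-- Together with `mem_sup_of_mk_mem_U` it turns membership in `U` into a condition in the whole
algebra of forms: being a relation plus a form with bounded pole. -/
theorem mk_mem_U {n : ℤ} {i : ℕ} {z : DiffAlg F} (hz : z ∈ Forms F n)
    (h : z ∈ relTotal F p ⊔ poleForms v i) : (QuotientAddGroup.mk ⟨z, hz⟩ : H F p n) ∈ U p v n i := by
  refine mk_mem_of_mem_sup p ?_ _ ?_ hz h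
  · rintro _ ⟨f, L, -, rfl⟩
    exact ⟨_, Submodule.smul_mem _ _ (dlogs_mem_forms L)⟩
  · rintro _ ⟨f, L, hf, rfl⟩ hg
    by_cases hj : (L.length : ℤ) = n
    · refine AddSubgroup.subset_closure ⟨L.length, hj, f, L.get, hf, ?_⟩
      refine congrArg _ (Subtype.ext ?_)
      rw [coe_logForm, List.ofFn_get]
    · convert! zero_mem (U p v n i)
      refine congrArg (QuotientAddGroup.mk' (relations F p n)) (a₂ := 0) (Subtype.ext ?_)
      exact eq_zero_of_mem_forms_of_ne hj (Submodule.smul_mem _ _ (dlogs_mem_forms L)) hg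

theorem mk_mem_unramified {n : ℤ} {z : DiffAlg F} (hz : z ∈ Forms F n)
    (h : z ∈ relTotal F p ⊔ intForms v) :
    (QuotientAddGroup.mk ⟨z, hz⟩ : H F p n) ∈ unramified p v n := by
  refine mk_mem_of_mem_sup p ?_ _ ?_ hz h
  · rintro _ ⟨f, L, rfl⟩
    exact ⟨_, Submodule.smul_mem _ _ (dlogs_mem_forms _)⟩
  · rintro _ ⟨f, L, rfl⟩ hg
    by_cases hj : (L.length : ℤ) = n
    · refine AddSubgroup.subset_closure ⟨L.length, hj, f, L.get, ?_⟩
      refine congrArg _ (Subtype.ext ?_)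
      rw [coe_logForm]
      rw [show (fun i => toF (L.get i)) = toF ∘ L.get from rfl, ← List.map_ofFn, List.ofFn_get]
    · convert! zero_mem (unramified p v n)
      refine congrArg (QuotientAddGroup.mk' (relations F p n)) (a₂ := 0) (Subtype.ext ?_)
      refine eq_zero_of_mem_forms_of_ne hj (Submodule.smul_mem _ _ ?_) hg
      simpa using dlogs_mem_forms (L.map toF)

theorem mem_sup_of_mk_mem_U {n : ℤ} {i : ℕ} {z : Forms F n}
    (h : (QuotientAddGroup.mk z : H F p n) ∈ U p v n i) :
    (z : DiffAlg F) ∈ relTotal F p ⊔ poleForms v i := by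
  have h1 : U p v n i ≤ ((relations F p n) ⊔ (poleForms v i).comap
      (Forms F n).subtype.toAddMonoidHom).map (QuotientAddGroup.mk' (relations F p n)) := by
    refine (AddSubgroup.closure_le _).2 ?_
    rintro _ ⟨m, hm, f, g, hf, rfl⟩
    refine ⟨logForm hm f g, AddSubgroup.mem_sup_right ?_, rfl⟩
    change (logForm hm f g : DiffAlg F) ∈ poleForms v i
    rw [coe_logForm]
    exact AddSubgroup.subset_closure ⟨f, _, hf, rfl⟩
  obtain ⟨y, hy, hyz⟩ := h1 h
  obtain ⟨r, hr, q, hq, rfl⟩ := AddSubgroup.mem_sup.1 hy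
  have h2 := QuotientAddGroup.eq.1 hyz
  have h3 : (z : DiffAlg F) = ((r : DiffAlg F) + (-(r + q) + z : Forms F n)) + q := by
    simp only [Submodule.coe_add, Submodule.coe_neg]
    abel
  rw [h3]
  exact add_mem (AddSubgroup.mem_sup_left (add_mem (coe_mem_relTotal p hr) (coe_mem_relTotal p h2)))
    (AddSubgroup.mem_sup_right hq)

/-- The form `t ^ (-i) (x + dt / t ∧ y)`, in a fixed degree. -/
def polarDeg (v : Valuation F ℤᵐ⁰) (t : Fˣ) (i : ℕ) (n : ℤ) :
    Forms v.valuationSubring n × Forms v.valuationSubring (n - 1) →+ Forms F n where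
  toFun z := ⟨polar v t i ((z.1 : DiffAlg v.valuationSubring), (z.2 : DiffAlg v.valuationSubring)), by
    refine Submodule.smul_mem _ _ (add_mem (formMap_mem _ _ z.1.2) ?_)
    have := ι_mul_mem_forms (dlog t) (formMap_mem v.valuationSubring F z.2.2)
    rwa [sub_add_cancel] at this⟩
  map_zero' := Subtype.ext (map_zero (polar v t i))
  map_add' z z' := Subtype.ext (map_add (polar v t i)
    ((z.1 : DiffAlg v.valuationSubring), (z.2 : DiffAlg v.valuationSubring))
    ((z'.1 : DiffAlg v.valuationSubring), (z'.2 : DiffAlg v.valuationSubring)))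

theorem coe_polarDeg (i : ℕ) (n : ℤ) (z) :
    (polarDeg v t i n z : DiffAlg F) = polar v t i ((z.1 : DiffAlg v.valuationSubring), (z.2 : DiffAlg v.valuationSubring)) := rfl

theorem mk_polarDeg_logForm (i : ℕ) {n : ℤ} {m : ℕ} (hm : (m : ℤ) = n) (a : v.valuationSubring)
    (b : Fin m → v.valuationSubringˣ) :
    (QuotientAddGroup.mk (polarDeg v t i n (logForm hm a b, 0)) : H F p n) =
      symb p hm ((a : F) / (t : F) ^ i) (fun l => toF (b l)) := by
  refine congrArg _ (Subtype.ext ?_)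
  rw [coe_polarDeg, coe_logForm]
  refine (polar_smul_dlogs v t i a _).trans ?_
  rw [coe_logForm, div_eq_inv_mul, List.map_ofFn]
  rfl

theorem mk_polarDeg_logForm' (i : ℕ) {n m : ℕ} (hm : m + 1 = n) (a : v.valuationSubring)
    (b : Fin m → v.valuationSubringˣ) :
    (QuotientAddGroup.mk (polarDeg v t i n (0, logForm (cast_pred hm) a b)) : H F p n) =
      symb p (cast_succ hm) ((a : F) / (t : F) ^ i)
        (Fin.cons t (fun l => toF (b l)) : Fin (m + 1) → Fˣ) := by
  refine congrArg _ (Subtype.ext ?_)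
  rw [coe_polarDeg, coe_logForm]
  refine (polar_smul_dlogs' v t i a _).trans ?_
  rw [coe_logForm, div_eq_inv_mul, List.map_ofFn, List.ofFn_cons]
  rfl

theorem formMapDeg_logForm {n : ℤ} {m : ℕ} (hm : (m : ℤ) = n) (a : v.valuationSubring)
    (b : Fin m → v.valuationSubringˣ) :
    formMapDeg v.valuationSubring (ResField v) n (logForm hm a b) =
      logForm hm (IsLocalRing.residue v.valuationSubring a) (fun l => toRes (b l)) :=
  Subtype.ext (formMap_logForm (ResField v) hm a b)

theorem formMapDeg_residue_surjective (n : ℤ) :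
    Function.Surjective (formMapDeg v.valuationSubring (ResField v) n) :=
  formMapDeg_surjective _ _ IsLocalRing.residue_surjective n

variable {t} (ht : v t = WithZero.exp (-1 : ℤ))

include ht

theorem mk_polarDeg_mem_U (i : ℕ) (n : ℤ) (z) :
    (QuotientAddGroup.mk (polarDeg v t i n z) : H F p n) ∈ U p v n i :=
  mk_mem_U p _ (AddSubgroup.mem_sup_right (polar_mem_poleForms i ht _))

theorem exists_mk_polarDeg_eq {i : ℕ} {n : ℤ} {x : H F p n} (hx : x ∈ U p v n i) :
    ∃ z, QuotientAddGroup.mk (polarDeg v t i n z) = x := by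
  change x ∈ ((QuotientAddGroup.mk' (relations F p n)).comp (polarDeg v t i n)).range
  refine (AddSubgroup.closure_le _).2 ?_ hx
  rintro _ ⟨m, rfl, f, g, hf, rfl⟩
  obtain ⟨a, rfl⟩ := exists_eq_inv_pow_mul ht hf
  obtain ⟨x, hx, y, hy, h⟩ := exists_dlogs_eq ht (List.ofFn g)
  rw [List.length_ofFn] at hx hy
  refine ⟨(a • ⟨x, hx⟩, a • ⟨y, hy⟩), ?_⟩
  refine congrArg _ (Subtype.ext ?_)
  rw [coe_logForm, coe_polarDeg, h]
  change polar v t i (a • x, a • y) = _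
  rw [polar_apply, formMap_smul, formMap_smul, mul_smul_comm, ← smul_add, smul_smul]
  rfl

/-- The class of the form `t ^ (-i) (x + dt / t ∧ y)` in the graded piece of the filtration. -/
def grPolar (i : ℕ) (n : ℤ) :
    Forms v.valuationSubring n × Forms v.valuationSubring (n - 1) →+ Gr p v n i :=
  (QuotientAddGroup.mk' _).comp
    (((QuotientAddGroup.mk' (relations F p n)).comp (polarDeg v t i n)).codRestrict
      (U p v n i) (mk_polarDeg_mem_U p ht i n))

theorem grPolar_apply (i : ℕ) (n : ℤ) (z) : grPolar p ht i n z =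
    QuotientAddGroup.mk ⟨QuotientAddGroup.mk (polarDeg v t i n z), mk_polarDeg_mem_U p ht i n z⟩ :=
  rfl

theorem grPolar_surjective (i : ℕ) (n : ℤ) : Function.Surjective (grPolar p ht i n) := by
  intro x
  obtain ⟨⟨x, hx⟩, rfl⟩ := QuotientAddGroup.mk_surjective x
  obtain ⟨z, rfl⟩ := exists_mk_polarDeg_eq p ht hx
  exact ⟨z, rfl⟩

theorem grPolar_eq_zero_iff (i : ℕ) (n : ℤ) (z) : grPolar p ht (i + 1) n z = 0 ↔
    polar v t (i + 1) ((z.1 : DiffAlg v.valuationSubring), (z.2 : DiffAlg v.valuationSubring)) ∈ relTotal F p ⊔ poleForms v i := by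
  rw [grPolar_apply]
  refine (QuotientAddGroup.eq_zero_iff _).trans ⟨fun h => ?_, fun h => ?_⟩
  · exact mem_sup_of_mk_mem_U p h
  · exact mk_mem_U p _ h

variable [Fact p.Prime] [CharP F p]

/-- With s = i + 1 invertible, the differential of t^(-s) y / s equals t^(-s) (dy / s - dlog t ∧ y).
So the second component y can be exchanged for dy / s in the first. -/
theorem exists_mk_polarDeg_eq_of_not_dvd {i : ℕ} (hpi : ¬ p ∣ i + 1) {n : ℤ} {x : H F p n}
    (hx : x ∈ U p v n (i + 1)) :
    ∃ z, QuotientAddGroup.mk (polarDeg v t (i + 1) n (z, 0)) = x := by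
  obtain ⟨⟨x, y⟩, rfl⟩ := exists_mk_polarDeg_eq p ht hx
  have hdy : extD v.valuationSubring y ∈ Forms v.valuationSubring n := by
    have := extD_mem_forms y.2
    rwa [sub_add_cancel] at this
  have hi0 : ((i + 1 : ℕ) : F) ≠ 0 := fun h => hpi ((CharP.cast_eq_zero_iff F p _).1 h)
  have hunit : IsUnit ((i + 1 : ℕ) : v.valuationSubring) := by
    by_contra hu
    have h1 : ((i + 1 : ℕ) : v.valuationSubring) ∈ IsLocalRing.maximalIdeal v.valuationSubring :=
      hu
    have _ : CharP (ResField v) p := charP_residueField _ p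
    rw [← IsLocalRing.residue_eq_zero_iff, map_natCast] at h1
    exact hpi ((CharP.cast_eq_zero_iff (ResField v) p _).1 h1)
  obtain ⟨u, hu⟩ := hunit
  refine ⟨x + (↑u⁻¹ : v.valuationSubring) • ⟨_, hdy⟩, ?_⟩
  rw [eq_comm, QuotientAddGroup.eq, ← map_neg, ← map_add]
  refine mem_relations p _ ?_
  have huF : algebraMap v.valuationSubring F ↑u⁻¹ * ((i + 1 : ℕ) : F) = 1 := by
    have := congrArg (algebraMap v.valuationSubring F) u.inv_mul
    rw [map_mul, hu, map_natCast, map_one] at this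
    exact this
  set c : F := algebraMap v.valuationSubring F ↑u⁻¹
  have hddc : dd c = 0 := by
    have h1 := congrArg dd huF
    have h2 : dd ((i + 1 : ℕ) : F) = 0 := by
      simp [dd]
    rw [dd_mul, h2, smul_zero, zero_add, dd_one] at h1
    exact (smul_eq_zero.1 h1).resolve_left hi0
  have hds : dd ((t : F) ^ (i + 1))⁻¹ = -(((i + 1 : ℕ) : F) * ((t : F) ^ (i + 1))⁻¹) • dlg t := by
    have h1 := smul_dlg (t ^ (-((i + 1 : ℕ) : ℤ)))
    rw [dlg_zpow] at h1
    have h2 : ((t ^ (-((i + 1 : ℕ) : ℤ)) : Fˣ) : F) = ((t : F) ^ (i + 1))⁻¹ := by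
      rw [zpow_neg, zpow_natCast, Units.val_inv_eq_inv_val, Units.val_pow_eq_pow_val]
    rw [h2] at h1
    rw [← h1, neg_smul, natCast_zsmul, ← Nat.cast_smul_eq_nsmul F, smul_neg, smul_smul, mul_comm]
    exact (neg_smul _ _).symm
  have h3 : extD F ((c * ((t : F) ^ (i + 1))⁻¹) • formMap v.valuationSubring F y) =
      polar v t (i + 1) ((↑u⁻¹ : v.valuationSubring) • extD _ (y : DiffAlg v.valuationSubring),
        -(y : DiffAlg v.valuationSubring)) := by
    rw [extD_smul, dd_mul, hddc, smul_zero, add_zero, hds, polar_apply, map_neg, mul_neg,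
      smul_add, smul_smul, formMap_smul, smul_smul, extD_formMap, smul_neg, mul_neg, ← mul_assoc,
      huF, one_mul, neg_smul, neg_mul, smul_mul_assoc, mul_comm c, add_comm]
  have h4 := extD_mem_relTotal p ((c * ((t : F) ^ (i + 1))⁻¹) • formMap v.valuationSubring F y)
  rw [h3] at h4
  convert! h4 using 2
  simp

/-- Forms without dlog t suffice to represent the classes, and by the leading form of a relation
such a form drops in the filtration only if its reduction is zero. -/
theorem exists_gr_equiv_of_not_dvd {i : ℕ} (hi : 0 < i) (hpi : ¬ p ∣ i) (n : ℕ) :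
    ∃ φ : Forms (ResField v) n ≃+ Gr p v n i,
      ∀ (a : v.valuationSubring) (b : Fin n → v.valuationSubringˣ),
        ∃ h : symb p rfl ((a : F) / (t : F) ^ i) (fun l => toF (b l)) ∈ U p v n i,
          φ (logForm rfl (IsLocalRing.residue v.valuationSubring a) (fun l => toRes (b l))) =
            QuotientAddGroup.mk ⟨_, h⟩ := by
  obtain ⟨i, rfl⟩ := Nat.exists_eq_add_of_le' hi
  have hsurj : Function.Surjective ((grPolar p ht (i + 1) (n : ℤ)).comp (AddMonoidHom.inl _ _)) := by
    rintro x
    obtain ⟨⟨x, hx⟩, rfl⟩ := QuotientAddGroup.mk_surjective x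
    obtain ⟨z, rfl⟩ := exists_mk_polarDeg_eq_of_not_dvd p ht hpi hx
    exact ⟨z, rfl⟩
  obtain ⟨φ, hφ⟩ := exists_addEquiv_of_ker (formMapDeg v.valuationSubring (ResField v) (n : ℤ))
    (formMapDeg_residue_surjective _) _ hsurj fun x => by
      change _ ↔ grPolar p ht (i + 1) (n : ℤ) (x, 0) = 0
      rw [grPolar_eq_zero_iff]
      constructor
      · intro h
        exact AddSubgroup.mem_sup_right (polar_mem_poleForms_of_formMap_eq_zero i ht
          (congrArg Subtype.val h) (map_zero _))
      · intro h
        exact Subtype.ext ((lead_of_mem_sup p ht h).2 hpi (map_zero _))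
  refine ⟨φ, fun a b => ?_⟩
  rw [← formMapDeg_logForm, hφ]
  have h := mk_polarDeg_logForm t p (i + 1) (n := (n : ℤ)) rfl a b
  refine ⟨h ▸ mk_polarDeg_mem_U p ht (i + 1) n _, ?_⟩
  exact congrArg QuotientAddGroup.mk (Subtype.ext h)

omit ht [Fact p.Prime] [CharP F p] in
variable (v) in
/-- Reduction of pairs of forms modulo closed forms. -/
def closedQuot (n : ℤ) : Forms v.valuationSubring n × Forms v.valuationSubring (n - 1) →+
    (Forms (ResField v) n ⧸ closedForms (ResField v) n) ×
      (Forms (ResField v) (n - 1) ⧸ closedForms (ResField v) (n - 1)) :=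
  AddMonoidHom.prodMap
    ((QuotientAddGroup.mk' (closedForms (ResField v) n)).comp
      (formMapDeg v.valuationSubring (ResField v) n))
    ((QuotientAddGroup.mk' (closedForms (ResField v) (n - 1))).comp
      (formMapDeg v.valuationSubring (ResField v) (n - 1)))

omit ht [Fact p.Prime] [CharP F p] in
theorem closedQuot_apply (n : ℤ) (x y) : closedQuot v n (x, y) =
    (QuotientAddGroup.mk (formMapDeg v.valuationSubring (ResField v) n x),
      QuotientAddGroup.mk (formMapDeg v.valuationSubring (ResField v) (n - 1) y)) := rfl

omit ht [Fact p.Prime] [CharP F p] in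
theorem closedQuot_surjective (n : ℤ) : Function.Surjective (closedQuot v n) := by
  rintro ⟨x, y⟩
  obtain ⟨x, rfl⟩ := QuotientAddGroup.mk_surjective x
  obtain ⟨y, rfl⟩ := QuotientAddGroup.mk_surjective y
  obtain ⟨x, rfl⟩ := formMapDeg_residue_surjective n x
  obtain ⟨y, rfl⟩ := formMapDeg_residue_surjective (n - 1) y
  exact ⟨(x, y), rfl⟩

omit ht [Fact p.Prime] [CharP F p] in
theorem closedQuot_eq_zero_iff (n : ℤ) (x : Forms v.valuationSubring n)
    (y : Forms v.valuationSubring (n - 1)) : closedQuot v n (x, y) = 0 ↔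
    extD (ResField v) (formMap _ (ResField v) (x : DiffAlg v.valuationSubring)) = 0 ∧
      extD (ResField v) (formMap _ (ResField v) (y : DiffAlg v.valuationSubring)) = 0 := by
  rw [closedQuot_apply, Prod.mk_eq_zero, QuotientAddGroup.eq_zero_iff, QuotientAddGroup.eq_zero_iff]
  rfl

omit ht [Fact p.Prime] [CharP F p] in
theorem closedQuot_logForm {n : ℤ} {m : ℕ} (hm : (m : ℤ) = n) (a : v.valuationSubring)
    (b : Fin m → v.valuationSubringˣ) : closedQuot v n (logForm hm a b, 0) =
    (QuotientAddGroup.mk (logForm hm (IsLocalRing.residue v.valuationSubring a)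
      (fun l => toRes (b l))), 0) := by
  refine Prod.ext (congrArg QuotientAddGroup.mk (formMapDeg_logForm hm a b)) ?_
  exact map_zero ((QuotientAddGroup.mk' (closedForms (ResField v) (n - 1))).comp
      (formMapDeg v.valuationSubring (ResField v) (n - 1)))

omit ht [Fact p.Prime] [CharP F p] in
theorem closedQuot_logForm' {n : ℤ} {m : ℕ} (hm : (m : ℤ) = n - 1) (a : v.valuationSubring)
    (b : Fin m → v.valuationSubringˣ) : closedQuot v n (0, logForm hm a b) =
    (0, QuotientAddGroup.mk (logForm hm (IsLocalRing.residue v.valuationSubring a)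
      (fun l => toRes (b l)))) := by
  refine Prod.ext ?_ (congrArg QuotientAddGroup.mk (formMapDeg_logForm hm a b))
  exact map_zero ((QuotientAddGroup.mk' (closedForms (ResField v) n)).comp
      (formMapDeg v.valuationSubring (ResField v) n))

set_option maxHeartbeats 1000000 in
theorem exists_gr_equiv_of_dvd {i : ℕ} (hi : 0 < i) (hpi : p ∣ i) (n : ℕ) :
    ∃ φ : ((Forms (ResField v) n ⧸ closedForms (ResField v) n) ×
        (Forms (ResField v) (n - 1) ⧸ closedForms (ResField v) (n - 1))) ≃+ Gr p v n i,
      (∀ (a : v.valuationSubring) (b : Fin n → v.valuationSubringˣ),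
        ∃ h : symb p rfl ((a : F) / (t : F) ^ i) (fun l => toF (b l)) ∈ U p v n i,
          φ (QuotientAddGroup.mk (logForm rfl (IsLocalRing.residue v.valuationSubring a)
              (fun l => toRes (b l))), 0) = QuotientAddGroup.mk ⟨_, h⟩) ∧
      (∀ (m : ℕ) (hm : m + 1 = n) (a : v.valuationSubring) (b : Fin m → v.valuationSubringˣ),
        ∃ h : symb p (cast_succ hm) ((a : F) / (t : F) ^ i)
            (Fin.cons t (fun l => toF (b l)) : Fin (m + 1) → Fˣ) ∈ U p v n i,
          φ (0, QuotientAddGroup.mk (logForm (cast_pred hm)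
              (IsLocalRing.residue v.valuationSubring a) (fun l => toRes (b l)))) =
            QuotientAddGroup.mk ⟨_, h⟩) := by
  obtain ⟨i, rfl⟩ := Nat.exists_eq_add_of_le' hi
  have hker : ∀ z, closedQuot v (n : ℤ) z = 0 ↔ grPolar p ht (i + 1) (n : ℤ) z = 0 := by
    intro z
    rw [grPolar_eq_zero_iff]
    refine (closedQuot_eq_zero_iff (n : ℤ) z.1 z.2).trans ?_
    exact ⟨fun h => polar_mem_sup_of_extD_eq_zero p ht hpi h.1 h.2,
      fun h => (lead_of_mem_sup p ht h).1 hpi⟩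
  obtain ⟨φ, hφ⟩ := exists_addEquiv_of_ker (closedQuot v (n : ℤ)) (closedQuot_surjective _)
    (grPolar p ht (i + 1) (n : ℤ)) (grPolar_surjective p ht _ _) hker
  refine ⟨φ, fun a b => ?_, fun m hm a b => ?_⟩
  · have h := mk_polarDeg_logForm t p (i + 1) (n := (n : ℤ)) rfl a b
    refine ⟨h ▸ mk_polarDeg_mem_U p ht (i + 1) n _, ?_⟩
    rw [← closedQuot_logForm, hφ]
    exact (congrArg QuotientAddGroup.mk (Subtype.ext h))
  · have h := mk_polarDeg_logForm' t p (i + 1) hm a b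
    refine ⟨h ▸ mk_polarDeg_mem_U p ht (i + 1) n _, ?_⟩
    rw [← closedQuot_logForm', hφ]
    exact (congrArg QuotientAddGroup.mk (Subtype.ext h))

end Filtration

theorem exists_addHom_of_ker_le {X Y G : Type*} [AddCommGroup X] [AddCommGroup Y] [AddCommGroup G]
    (π : X →+ Y) (hπ : Function.Surjective π) (ψ : X →+ G) (h : ∀ x, π x = 0 → ψ x = 0) :
    ∃ φ : Y →+ G, ∀ x, φ (π x) = ψ x := by
  let g : Y → X := Function.surjInv hπ
  refine ⟨π.liftOfRightInverse g (Function.rightInverse_surjInv hπ) ⟨ψ, h⟩, fun x => ?_⟩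
  exact π.liftOfRightInverse_comp_apply g (Function.rightInverse_surjInv hπ) ⟨ψ, h⟩ x

/-! ### The residue map and the unramified subgroup -/

section Residue

variable {F : Type u} [Field F] {v : Valuation F ℤᵐ⁰} {t : Fˣ} (p : ℕ)
  (ht : v t = WithZero.exp (-1 : ℤ))

include ht

/-- The map from pairs of integral forms onto the group of tame classes. -/
def tamePolar (n : ℤ) :
    Forms v.valuationSubring n × Forms v.valuationSubring (n - 1) →+ U p v n 0 :=
  ((QuotientAddGroup.mk' (relations F p n)).comp (polarDeg v t 0 n)).codRestrict
    (U p v n 0) (mk_polarDeg_mem_U p ht 0 n)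

theorem tamePolar_surjective (n : ℤ) : Function.Surjective (tamePolar p ht n) := by
  rintro ⟨x, hx⟩
  obtain ⟨z, rfl⟩ := exists_mk_polarDeg_eq p ht hx
  exact ⟨z, rfl⟩

theorem symb_eq_mk_polarDeg {n : ℤ} {m : ℕ} (hm : (m : ℤ) = n) (a : v.valuationSubring)
    (b : Fin m → v.valuationSubringˣ) :
    symb p hm (a : F) (fun l => toF (b l)) = tamePolar p ht n (logForm hm a b, 0) := by
  have := mk_polarDeg_logForm t p 0 hm a b
  rw [pow_zero, div_one] at this
  exact this.symm

/-- For another uniformizer t', dlog t' and dlog t differ by the logarithmic differential of a unit,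
which changes only the first component. So the residue, read off from the second one, does not
depend on the uniformizer. -/
theorem symb_cons_eq_mk_polarDeg {n m : ℕ} (hm : m + 1 = n) (a : v.valuationSubring)
    (b : Fin m → v.valuationSubringˣ) {t' : Fˣ} (ht' : v t' = WithZero.exp (-1 : ℤ)) :
    ∃ x : Forms v.valuationSubring n,
    symb p (cast_succ hm) (a : F) (Fin.cons t' (fun l => toF (b l)) : Fin (m + 1) → Fˣ) =
      tamePolar p ht n (x, logForm (cast_pred hm) a b) := by
  have hu : v ((t⁻¹ * t' : Fˣ) : F) = 1 := by
    rw [Units.val_mul, map_mul, Units.val_inv_eq_inv_val, map_inv₀, ht, ht']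
    exact inv_mul_cancel₀ WithZero.coe_ne_zero
  refine ⟨logForm (cast_succ hm) a (Fin.cons (unitOfVal v _ hu) b : Fin (m + 1) → _), ?_⟩
  refine congrArg _ (Subtype.ext ?_)
  have h1 : dlg t' = dlg (t⁻¹ * t') + dlg t := by
    rw [← dlg_mul, mul_comm, mul_inv_cancel_left]
  rw [coe_polarDeg, coe_logForm, coe_logForm, coe_logForm, List.ofFn_cons, List.ofFn_cons,
    polar_apply, pow_zero, inv_one, one_smul, dlogs_cons, dlogs_cons, formMap_smul, formMap_smul,
    map_mul, formMap_dlogs, formMap_dlg, mul_smul_comm, ← smul_add, List.map_ofFn, h1, add_mul]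
  rfl

variable [Fact p.Prime] [CharP F p]

/-- The residue is the reduction of y in x + dlog t ∧ y. It is well defined because for a relation
without pole the reduction of y is a relation over the residue field. -/
theorem exists_residue (n : ℕ) : ∃ res : U p v n 0 →+ H (ResField v) p (n - 1),
    ∀ x y, res (tamePolar p ht n (x, y)) =
      QuotientAddGroup.mk (formMapDeg v.valuationSubring (ResField v) (n - 1) y) := by
  suffices h : ∃ res : U p v n 0 →+ H (ResField v) p (n - 1), ∀ z, res (tamePolar p ht n z) =
      ((QuotientAddGroup.mk' (relations (ResField v) p (n - 1))).comp
      (formMapDeg v.valuationSubring (ResField v) (n - 1))) (AddMonoidHom.snd _ _ z) by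
    obtain ⟨res, h⟩ := h
    exact ⟨res, fun x y => h (x, y)⟩
  refine exists_addHom_of_ker_le _ (tamePolar_surjective p ht n)
    (((QuotientAddGroup.mk' (relations (ResField v) p (n - 1))).comp
      (formMapDeg v.valuationSubring (ResField v) (n - 1))).comp (AddMonoidHom.snd _ _)) fun z hz => ?_
  have h1 : (QuotientAddGroup.mk (polarDeg v t 0 n z) : H F p n) = 0 := congrArg Subtype.val hz
  have h2 := coe_mem_relTotal p ((QuotientAddGroup.eq_zero_iff _).1 h1)
  have h3 := ((lead_of_mem_relTotal_field p ht 0 _ _ h2).1 rfl).2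
  exact (QuotientAddGroup.eq_zero_iff _).2 (mem_relations p _ h3)

omit [Fact p.Prime] [CharP F p] in
theorem eq_mk_of_eq_on_symbols {n : ℕ} (res : U p v n 0 →+ H (ResField v) p (n - 1))
    (h1 : ∀ (a : v.valuationSubring) (b : Fin n → v.valuationSubringˣ),
      res (tamePolar p ht n (logForm rfl a b, 0)) = 0)
    (h2 : ∀ (m : ℕ) (hm : m + 1 = n) (a : v.valuationSubring) (b : Fin m → v.valuationSubringˣ),
      res (tamePolar p ht n (0, logForm (cast_pred hm) a b)) =
        symb p (cast_pred hm) (IsLocalRing.residue v.valuationSubring a) (fun l => toRes (b l)))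
    (x : Forms v.valuationSubring n) (y : Forms v.valuationSubring (n - 1)) :
    res (tamePolar p ht n (x, y)) =
      QuotientAddGroup.mk (formMapDeg v.valuationSubring (ResField v) (n - 1) y) := by
  let f₁ := (res.comp (tamePolar p ht n)).comp (AddMonoidHom.inl _ _)
  let f₂ := (res.comp (tamePolar p ht n)).comp (AddMonoidHom.inr _ _)
  have h1' : ∀ x, f₁ x = 0 := by
    intro x
    change x ∈ f₁.ker
    refine (AddSubgroup.closure_le _).2 ?_ (mem_closure_logForm x)
    rintro _ ⟨m, hm, a, b, rfl⟩
    obtain rfl : m = n := by exact_mod_cast hm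
    exact h1 a b
  have h2' : ∀ y, f₂ y = ((QuotientAddGroup.mk' (relations (ResField v) p (n - 1))).comp
      (formMapDeg v.valuationSubring (ResField v) (n - 1))) y := by
    intro y
    change y ∈ f₂.eqLocus _
    refine (AddSubgroup.closure_le _).2 ?_ (mem_closure_logForm y)
    rintro _ ⟨m, hm, a, b, rfl⟩
    have hm' : m + 1 = n := by omega
    refine (h2 m hm' a b).trans ?_
    exact (congrArg QuotientAddGroup.mk (formMapDeg_logForm hm a b)).symm
  have h3 : (x, y) = AddMonoidHom.inl _ _ x + AddMonoidHom.inr _ _ y :=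
    Prod.ext (add_zero _).symm (zero_add _).symm
  rw [h3, map_add, map_add]
  exact (congrArg₂ (· + ·) (h1' x) (h2' y)).trans (zero_add _)

set_option maxHeartbeats 1000000 in
theorem exists_isResidue {n : ℕ} (hU : U p v n 0 = tame p v n) :
    ∃ res : tame p v n →+ H (ResField v) p (n - 1),
      IsResidue p v n res ∧
      (∀ res' : tame p v n →+ H (ResField v) p (n - 1), IsResidue p v n res' → res' = res) ∧
      Function.Surjective res ∧
      res.ker = (unramified p v n).addSubgroupOf (tame p v n) := by
  obtain ⟨res, hres⟩ := exists_residue p ht n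
  unfold IsResidue
  -- The tame subgroup occurs in the types; abstracting it lets the equality `hU` replace it by `U p
  -- v n 0` everywhere.
  generalize tame p v n = T at hU
  subst hU
  refine ⟨res, ⟨fun a b => ?_, fun t' ht' m hm a b => ?_⟩, fun res' hres' => ?_, fun y => ?_, ?_⟩
  · have h := symb_eq_mk_polarDeg p ht (n := (n : ℤ)) rfl a b
    refine ⟨h ▸ SetLike.coe_mem _, ?_⟩
    refine (congrArg res (Subtype.ext h)).trans ((hres _ _).trans ?_)
    exact congrArg QuotientAddGroup.mk (map_zero (formMapDeg _ (ResField v) _))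
  · obtain ⟨x, h⟩ := symb_cons_eq_mk_polarDeg p ht hm a b ht'
    refine ⟨h ▸ SetLike.coe_mem _, ?_⟩
    refine (congrArg res (Subtype.ext h)).trans ((hres _ _).trans ?_)
    exact congrArg QuotientAddGroup.mk (formMapDeg_logForm _ a b)
  · ext x
    obtain ⟨⟨x, y⟩, rfl⟩ := tamePolar_surjective p ht n x
    rw [hres]
    refine eq_mk_of_eq_on_symbols p ht res' (fun a b => ?_) (fun m hm a b => ?_) x y
    · obtain ⟨h, h2⟩ := hres'.1 a b
      rw [← h2]
      exact congrArg res' (Subtype.ext (symb_eq_mk_polarDeg p ht rfl a b).symm)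
    · obtain ⟨h, h2⟩ := hres'.2 t ht m hm a b
      refine Eq.trans (congrArg res' (Subtype.ext ?_)) h2
      have := mk_polarDeg_logForm' t p 0 hm a b
      rw [pow_zero, div_one] at this
      exact this
  · obtain ⟨y, rfl⟩ := QuotientAddGroup.mk_surjective y
    obtain ⟨y, rfl⟩ := formMapDeg_residue_surjective _ y
    exact ⟨_, hres 0 y⟩
  · refine le_antisymm (fun x hx => ?_) (fun x hx => ?_)
    · obtain ⟨⟨x, y⟩, rfl⟩ := tamePolar_surjective p ht n x
      have h1 := (QuotientAddGroup.eq_zero_iff _).1 ((hres x y).symm.trans hx)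
      exact mk_mem_unramified p _ (polar_zero_mem_sup p ht (coe_mem_relTotal p h1))
    · have h1 : unramified p v n ≤ res.ker.map (U p v n 0).subtype := by
        refine (AddSubgroup.closure_le _).2 ?_
        rintro _ ⟨m, hm, a, b, rfl⟩
        refine ⟨tamePolar p ht n (logForm hm a b, 0), ?_, (symb_eq_mk_polarDeg p ht hm a b).symm⟩
        exact (hres _ _).trans (congrArg QuotientAddGroup.mk (map_zero (formMapDeg _ (ResField v) _)))
      obtain ⟨y, hy, h⟩ := h1 hx
      rwa [← Subtype.ext (p := fun x => x ∈ U p v n 0) h]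

omit ht [Fact p.Prime] [CharP F p] in
variable (v) in
/-- The class in the residue field of an integral form. -/
def residueClass (n : ℤ) : Forms v.valuationSubring n →+ H (ResField v) p n :=
  (QuotientAddGroup.mk' (relations (ResField v) p n)).comp
    (formMapDeg v.valuationSubring (ResField v) n)

omit ht [Fact p.Prime] [CharP F p] in
theorem residueClass_surjective (n : ℤ) : Function.Surjective (residueClass v p n) :=
  (QuotientAddGroup.mk'_surjective _).comp (formMapDeg_residue_surjective n)

omit ht [Fact p.Prime] [CharP F p] in
theorem residueClass_logForm {n : ℤ} {m : ℕ} (hm : (m : ℤ) = n) (a : v.valuationSubring)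
    (b : Fin m → v.valuationSubringˣ) : residueClass v p n (logForm hm a b) =
      symb p hm (IsLocalRing.residue v.valuationSubring a) (fun l => toRes (b l)) :=
  congrArg QuotientAddGroup.mk (formMapDeg_logForm hm a b)

omit ht [Fact p.Prime] [CharP F p] in
theorem residueClass_eq_zero_iff (n : ℤ) (x : Forms v.valuationSubring n) :
    residueClass v p n x = 0 ↔
      formMap _ (ResField v) (x : DiffAlg v.valuationSubring) ∈ relTotal (ResField v) p :=
  (QuotientAddGroup.eq_zero_iff _).trans ⟨fun h => coe_mem_relTotal p h, fun h => mem_relations p _ h⟩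

omit ht [Fact p.Prime] [CharP F p] in
variable (v) in
/-- The unramified class of an integral form. -/
def unramifiedClass (n : ℤ) : Forms v.valuationSubring n →+ unramified p v n :=
  ((QuotientAddGroup.mk' (relations F p n)).comp (formMapDeg v.valuationSubring F n)).codRestrict _
    fun x => mk_mem_unramified p _
      (AddSubgroup.mem_sup_right (formMap_mem_intForms (x : DiffAlg v.valuationSubring)))

omit ht [Fact p.Prime] [CharP F p] in
theorem unramifiedClass_logForm {n : ℤ} {m : ℕ} (hm : (m : ℤ) = n) (a : v.valuationSubring)
    (b : Fin m → v.valuationSubringˣ) : (unramifiedClass v p n (logForm hm a b) : H F p n) =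
      symb p hm (a : F) (fun l => toF (b l)) :=
  congrArg QuotientAddGroup.mk (Subtype.ext (formMap_logForm F hm a b))

omit ht [Fact p.Prime] [CharP F p] in
theorem unramifiedClass_surjective (n : ℤ) : Function.Surjective (unramifiedClass v p n) := by
  rintro ⟨x, hx⟩
  have h1 : unramified p v n ≤ (unramifiedClass v p n).range.map (unramified p v n).subtype := by
    refine (AddSubgroup.closure_le _).2 ?_
    rintro _ ⟨m, hm, a, b, rfl⟩
    exact ⟨_, ⟨logForm hm a b, rfl⟩, unramifiedClass_logForm p hm a b⟩
  obtain ⟨_, ⟨y, rfl⟩, h⟩ := h1 hx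
  exact ⟨y, Subtype.ext h⟩

omit ht [Fact p.Prime] [CharP F p] in
theorem unramifiedClass_eq_zero_iff (n : ℤ) (x : Forms v.valuationSubring n) :
    unramifiedClass v p n x = 0 ↔
      formMap _ F (x : DiffAlg v.valuationSubring) ∈ relTotal F p := by
  refine Subtype.ext_iff.trans ((QuotientAddGroup.eq_zero_iff _).trans
    ⟨fun h => coe_mem_relTotal p h, fun h => mem_relations p _ h⟩)

/-- Both groups are quotients of the integral forms. The henselian hypothesis shows that a form
which becomes a relation over the residue field is a relation over `F`; the converse is the case of
pole order 0 of the leading form of a relation. -/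
theorem exists_unramified_equiv [HenselianLocalRing v.valuationSubring] (n : ℕ) :
    ∃ φ : H (ResField v) p n ≃+ unramified p v n,
      ∀ (a : v.valuationSubring) (b : Fin n → v.valuationSubringˣ),
        ∃ h : symb p rfl (a : F) (fun l => toF (b l)) ∈ unramified p v n,
          φ (symb p rfl (IsLocalRing.residue v.valuationSubring a) (fun l => toRes (b l))) =
            ⟨_, h⟩ := by
  have hker (x : Forms v.valuationSubring n) :
      residueClass v p n x = 0 ↔ unramifiedClass v p n x = 0 := by
    rw [residueClass_eq_zero_iff, unramifiedClass_eq_zero_iff]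
    have h1 : polar v t 0 ((x : DiffAlg v.valuationSubring), 0) =
        formMap v.valuationSubring F (x : DiffAlg v.valuationSubring) := by
      rw [polar_apply, map_zero, mul_zero, add_zero, pow_zero, inv_one, one_smul]
    refine ⟨formMap_mem_relTotal_of_henselian p, fun h => ?_⟩
    exact ((lead_of_mem_relTotal_field p ht 0 (x : DiffAlg v.valuationSubring) 0 (h1 ▸ h)).1 rfl).1
  obtain ⟨φ, hφ⟩ := exists_addEquiv_of_ker (residueClass v p n) (residueClass_surjective p n)
    (unramifiedClass v p n) (unramifiedClass_surjective p n) hker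
  refine ⟨φ, fun a b => ?_⟩
  have h := unramifiedClass_logForm p (n := (n : ℤ)) rfl a b
  refine ⟨h ▸ SetLike.coe_mem _, ?_⟩
  rw [← residueClass_logForm, hφ]
  exact Subtype.ext h

end Residue

/-! ### Finite extensions of complete discretely valued fields -/

section CompleteDiscrete

variable {K : Type*} {L : Type*} [NontriviallyNormedField K] [IsUltrametricDist K]
  [CompleteSpace K] [NormedField L] [NormedAlgebra K L] [IsUltrametricDist L]
  [FiniteDimensional K L] {A : ValuationSubring K} (hA : ∀ x, x ∈ A ↔ ‖x‖ ≤ 1)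
  [Algebra A L] [IsScalarTower A K L]

include hA

/-- The unit ball of `L` is a valuation ring containing `A`, hence integrally closed. Conversely,
the norm of `L` is the spectral norm, so norm at most 1 bounds the coefficients of the minimal
polynomial by 1. -/
theorem mem_integralClosure_iff_norm_le_one (x : L) : x ∈ integralClosure A L ↔ ‖x‖ ≤ 1 := by
  constructor
  · intro hx
    let O := (NormedField.valuation (K := L)).valuationSubring
    have hO (y : L) : y ∈ O ↔ ‖y‖ ≤ 1 := by
      change NormedField.valuation y ≤ 1 ↔ _
      rw [NormedField.valuation_apply]
      exact NNReal.coe_le_coe (r₂ := 1)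
    have hAO (a : A) : algebraMap A L a ∈ O := by
      rw [hO, IsScalarTower.algebraMap_apply A K L, norm_algebraMap']
      exact (hA _).1 a.2
    let f : A →+* O := (algebraMap A L).codRestrict O hAO
    have hx' : IsIntegral O x := by
      obtain ⟨q, hq, hqx⟩ := hx
      refine ⟨q.map f, hq.map f, ?_⟩
      rw [Polynomial.eval₂_map]
      exact hqx
    obtain ⟨y, hy⟩ := IsIntegrallyClosed.isIntegral_iff.1 hx'
    rw [← hO, ← hy]
    exact y.2
  · intro hx
    have hint : IsIntegral K x := Algebra.IsIntegral.isIntegral x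
    rw [NormedAlgebra.norm_eq_spectralNorm K, spectralNorm,
      spectralValue_le_one_iff (minpoly.monic hint)] at hx
    have hl : minpoly K x ∈ Polynomial.lifts (algebraMap A K) :=
      (Polynomial.lifts_iff_coeff_lifts _).2 fun n => ⟨⟨_, (hA _).2 (hx n)⟩, rfl⟩
    obtain ⟨q, hq, -, hqm⟩ := Polynomial.lifts_and_natDegree_eq_and_monic hl (minpoly.monic hint)
    refine ⟨q, hqm, ?_⟩
    rw [IsScalarTower.algebraMap_eq A K L, ← Polynomial.eval₂_map, hq]
    exact minpoly.aeval K x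

omit hA
variable {t : K} (ht0 : t ≠ 0) (ht1 : ‖t‖ < 1) (hval : ∀ a : K, a ≠ 0 → ∃ m : ℤ, ‖a‖ = ‖t‖ ^ m)

omit [IsUltrametricDist L] in
include hval in
-- The norm of x to the power deg x is the norm of the constant coefficient of its minimal
-- polynomial. The factorial of [L : K] is a common multiple of all possible degrees, so one
-- exponent serves for all x.
theorem exists_norm_pow_eq {x : L} (hx : x ≠ 0) :
    ∃ m : ℤ, ‖x‖ ^ (Module.finrank K L).factorial = ‖t‖ ^ m := by
  have hint : IsIntegral K x := Algebra.IsIntegral.isIntegral x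
  obtain ⟨m, hm⟩ := hval _ (minpoly.coeff_zero_ne_zero hint hx)
  have hpos := minpoly.natDegree_pos hint
  obtain ⟨c, hc⟩ := Nat.dvd_factorial hpos (minpoly.natDegree_le x)
  refine ⟨m * c, ?_⟩
  rw [hc, pow_mul, zpow_mul, ← hm, NormedAlgebra.norm_eq_spectralNorm K,
    spectralNorm.spectralNorm_eq_norm_coeff_zero_rpow, one_div,
    Real.rpow_inv_natCast_pow (norm_nonneg _) hpos.ne', zpow_natCast]

include ht0 ht1 hval in
omit [IsUltrametricDist L] in
/-- A finite extension of a complete discretely valued field is discretely valued. -/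
theorem exists_norm_uniformizer : ∃ π : L, π ≠ 0 ∧ ‖π‖ < 1 ∧ ∀ x : L, ‖x‖ < 1 → ‖x‖ ≤ ‖π‖ := by
  choose! m hm using fun (x : L) (hx : x ≠ 0) => exists_norm_pow_eq (t := t) hval hx
  have hD : (Module.finrank K L).factorial ≠ 0 := Nat.factorial_ne_zero _
  have ht : 0 < ‖t‖ := norm_pos_iff.2 ht0
  have hmpos {x : L} (hx : x ≠ 0) (h1 : ‖x‖ < 1) : 0 < m x := by
    have h2 := pow_lt_one₀ (norm_nonneg _) h1 hD
    rw [hm x hx] at h2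
    exact (zpow_lt_one_iff_right_of_lt_one₀ ht ht1).1 h2
  let s : Set L := {x | x ≠ 0 ∧ ‖x‖ < 1}
  have hs : s.Nonempty := ⟨algebraMap K L t, (map_ne_zero _).2 ht0, by rwa [norm_algebraMap']⟩
  -- The exponents `m x` are positive for the elements of norm less than 1, so a least one exists,
  -- and it belongs to an element of largest norm.
  obtain ⟨π, hπ, hmin⟩ := (measure fun x : L => (m x).toNat).wf.has_min s hs
  refine ⟨π, hπ.1, hπ.2, fun x hx => ?_⟩
  rcases eq_or_ne x 0 with rfl | hx0
  · rw [norm_zero]; exact norm_nonneg _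
  have h1 : ¬ (m x).toNat < (m π).toNat := hmin x ⟨hx0, hx⟩
  have h2 := hmpos hx0 hx
  have h3 := hmpos hπ.1 hπ.2
  refine (pow_le_pow_iff_left₀ (norm_nonneg _) (norm_nonneg _) hD).1 ?_
  rw [hm x hx0, hm π hπ.1]
  exact zpow_le_zpow_right_of_le_one₀ ht ht1.le (by omega)

omit [NontriviallyNormedField K] [IsUltrametricDist K] [CompleteSpace K] [NormedAlgebra K L]
  [FiniteDimensional K L] [IsScalarTower A K L] [Algebra A L] [IsUltrametricDist L] in
theorem exists_norm_eq_zpow {π : L} (hπ0 : π ≠ 0) (hπ1 : ‖π‖ < 1)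
    (hmax : ∀ x : L, ‖x‖ < 1 → ‖x‖ ≤ ‖π‖) {x : L} (hx : x ≠ 0) : ∃ m : ℤ, ‖x‖ = ‖π‖ ^ m := by
  have hπ : 0 < ‖π‖ := norm_pos_iff.2 hπ0
  obtain ⟨m, h1, h2⟩ := exists_mem_Ico_zpow (norm_pos_iff.2 hx) ((one_lt_inv₀ hπ).2 hπ1)
  refine ⟨-m, le_antisymm ?_ ?_⟩
  · have h3 : ‖x * π ^ (m + 1)‖ < 1 := by
      rw [norm_mul, norm_zpow]
      calc _ < ‖π‖⁻¹ ^ (m + 1) * ‖π‖ ^ (m + 1) := mul_lt_mul_of_pos_right h2 (zpow_pos hπ _)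
        _ = 1 := by rw [inv_zpow, inv_mul_cancel₀ (zpow_pos hπ _).ne']
    have h4 := hmax _ h3
    rw [norm_mul, norm_zpow, zpow_add₀ hπ.ne', zpow_one, ← mul_assoc] at h4
    have h5 : ‖x‖ * ‖π‖ ^ m ≤ 1 := le_of_mul_le_mul_right (by rwa [one_mul]) hπ
    rw [zpow_neg]
    exact (le_inv_mul_iff₀' (zpow_pos hπ _)).2 h5 |>.trans_eq (mul_one _)
  · rwa [inv_zpow'] at h1

/-- Data for the unit ball of a discretely valued field. -/
structure IsUnitBall {A : Type*} [CommRing A] [Algebra A L] (B : Subalgebra A L) (ϖ : B) : Prop where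
  mem_iff : ∀ x, x ∈ B ↔ ‖x‖ ≤ 1
  ne_zero : (ϖ : L) ≠ 0
  norm_lt_one : ‖(ϖ : L)‖ < 1
  norm_le : ∀ x : L, ‖x‖ < 1 → ‖x‖ ≤ ‖(ϖ : L)‖

section UnitBall

omit [NontriviallyNormedField K] [IsUltrametricDist K] [CompleteSpace K] [NormedAlgebra K L]
  [FiniteDimensional K L] [IsScalarTower A K L] [Algebra A L] [IsUltrametricDist L]

variable {A : Type*} [CommRing A] [Algebra A L] {B : Subalgebra A L} {ϖ : B} (h : IsUnitBall B ϖ)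

include h

namespace IsUnitBall

theorem isUnit_iff (b : B) : IsUnit b ↔ ‖(b : L)‖ = 1 := by
  constructor
  · rintro ⟨u, rfl⟩
    refine le_antisymm ((h.mem_iff _).1 (u : B).2) ?_
    have h1 : ‖((u : B) : L)‖ * ‖((↑u⁻¹ : B) : L)‖ = 1 := by
      rw [← norm_mul, ← Subalgebra.coe_mul, u.mul_inv, Subalgebra.coe_one, norm_one]
    rw [← h1]
    exact mul_le_of_le_one_right (norm_nonneg _) ((h.mem_iff _).1 (↑u⁻¹ : B).2)
  · intro hb
    have hb0 : (b : L) ≠ 0 := by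
      intro h0; rw [h0, norm_zero] at hb; exact zero_ne_one hb
    refine isUnit_iff_exists_inv.2 ⟨⟨(b : L)⁻¹, (h.mem_iff _).2 ?_⟩, Subtype.ext (mul_inv_cancel₀ hb0)⟩
    rw [norm_inv, hb, inv_one]

theorem dvd_iff (b c : B) (hb : (b : L) ≠ 0) : b ∣ c ↔ ‖(c : L)‖ ≤ ‖(b : L)‖ := by
  constructor
  · rintro ⟨d, rfl⟩
    rw [Subalgebra.coe_mul, norm_mul]
    exact mul_le_of_le_one_right (norm_nonneg _) ((h.mem_iff _).1 d.2)
  · intro hbc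
    refine ⟨⟨(b : L)⁻¹ * c, (h.mem_iff _).2 ?_⟩, Subtype.ext (mul_inv_cancel_left₀ hb _).symm⟩
    rw [norm_mul, norm_inv]
    exact (inv_mul_le_one₀ (norm_pos_iff.2 hb)).2 hbc

theorem isDiscreteValuationRing : IsDiscreteValuationRing B := by
  have hπ : 0 < ‖(ϖ : L)‖ := norm_pos_iff.2 h.ne_zero
  refine IsDiscreteValuationRing.ofHasUnitMulPowIrreducibleFactorization ⟨ϖ, ⟨?_, ?_⟩, ?_⟩
  · rw [h.isUnit_iff]; exact h.norm_lt_one.ne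
  · intro a b hab
    by_contra! hne
    rw [h.isUnit_iff, h.isUnit_iff] at hne
    have h1 := h.norm_le _ (lt_of_le_of_ne ((h.mem_iff _).1 a.2) hne.1)
    have h2 := lt_of_le_of_ne ((h.mem_iff _).1 b.2) hne.2
    have h3 : ‖(ϖ : L)‖ = ‖(a : L)‖ * ‖(b : L)‖ := by
      rw [hab, Subalgebra.coe_mul, norm_mul]
    have h4 : ‖(a : L)‖ * ‖(b : L)‖ < ‖(ϖ : L)‖ :=
      (mul_le_mul_of_nonneg_right h1 (norm_nonneg _)).trans_lt (mul_lt_of_lt_one_right hπ h2)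
    exact h3.not_gt h4
  · intro x hx
    have hx0 : (x : L) ≠ 0 := fun h0 => hx (Subtype.ext h0)
    obtain ⟨m, hm⟩ := exists_norm_eq_zpow h.ne_zero h.norm_lt_one h.norm_le hx0
    have hm0 : 0 ≤ m := by
      have h1 := (h.mem_iff _).1 x.2
      rw [hm] at h1
      exact (zpow_le_one_iff_right_of_lt_one₀ hπ h.norm_lt_one).1 h1
    lift m to ℕ using hm0
    refine ⟨m, associated_of_dvd_dvd ?_ ?_⟩
    · rw [h.dvd_iff _ _ (by rw [Subalgebra.coe_pow]; exact pow_ne_zero _ h.ne_zero), hm]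
      simp
    · rw [h.dvd_iff _ _ hx0, hm]
      simp

theorem mem_maximalIdeal_iff [IsLocalRing B] (b : B) :
    b ∈ IsLocalRing.maximalIdeal B ↔ ‖(b : L)‖ < 1 := by
  rw [IsLocalRing.mem_maximalIdeal, mem_nonunits_iff, h.isUnit_iff]
  exact ⟨fun h1 => lt_of_le_of_ne ((h.mem_iff _).1 b.2) h1, fun h1 => h1.ne⟩

theorem maximalIdeal_eq [IsLocalRing B] : IsLocalRing.maximalIdeal B = Ideal.span {ϖ} := by
  ext b
  rw [h.mem_maximalIdeal_iff, Ideal.mem_span_singleton, h.dvd_iff _ _ h.ne_zero]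
  exact ⟨h.norm_le _, fun h1 => h1.trans_lt h.norm_lt_one⟩

/-- Powers of the ideal are balls, so the adic topology is that of the norm, and the closed unit
ball of a complete field is complete. -/
theorem isAdicComplete [CompleteSpace L] : IsAdicComplete (Ideal.span {ϖ}) B := by
  have hπ : 0 < ‖(ϖ : L)‖ := norm_pos_iff.2 h.ne_zero
  let _ : NormedCommRing B := SubringClass.toNormedCommRing B
  have hmem (n : ℕ) (b : B) : b ∈ Ideal.span {ϖ} ^ n ↔ ‖(b : L)‖ ≤ ‖(ϖ : L)‖ ^ n := by
    rw [Ideal.span_singleton_pow, Ideal.mem_span_singleton,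
      h.dvd_iff _ _ (by rw [Subalgebra.coe_pow]; exact pow_ne_zero _ h.ne_zero)]
    simp
  have hadic : IsAdic (Ideal.span {ϖ}) := by
    refine isAdic_iff.2 ⟨fun n => ?_, fun s hs => ?_⟩
    · refine AddSubgroup.isOpen_of_mem_nhds (Submodule.toAddSubgroup (Ideal.span {ϖ} ^ n)) (g := 0) ?_
      refine Metric.mem_nhds_iff.2 ⟨‖(ϖ : L)‖ ^ n, pow_pos hπ n, fun b hb => ?_⟩
      rw [mem_ball_zero_iff] at hb
      exact (hmem n b).2 hb.le
    · obtain ⟨ε, hε, hs⟩ := Metric.mem_nhds_iff.1 hs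
      obtain ⟨n, hn⟩ := exists_pow_lt_of_lt_one hε h.norm_lt_one
      refine ⟨n, fun b hb => hs ?_⟩
      rw [mem_ball_zero_iff]
      exact ((hmem n b).1 hb).trans_lt hn
  refine hadic.isAdicComplete_iff.2 ⟨?_, inferInstance⟩
  have hcl : IsClosed (B : Set L) := by
    have : (B : Set L) = Metric.closedBall 0 1 := by
      ext x
      rw [mem_closedBall_zero_iff]
      exact h.mem_iff x
    rw [this]
    exact Metric.isClosed_closedBall
  exact hcl.isComplete.completeSpace_coe

theorem henselianRing [CompleteSpace L] : HenselianRing B (Ideal.span {ϖ}) := by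
  have := h.isAdicComplete
  infer_instance

end IsUnitBall

end UnitBall

include hA ht0 ht1 hval in
theorem exists_isUnitBall : ∃ ϖ, IsUnitBall (integralClosure A L) ϖ := by
  obtain ⟨π, hπ0, hπ1, hmax⟩ := exists_norm_uniformizer (L := L) ht0 ht1 hval
  have hB := mem_integralClosure_iff_norm_le_one (L := L) hA
  exact ⟨⟨π, (hB π).2 hπ1.le⟩, hB, hπ0, hπ1, hmax⟩

end CompleteDiscrete

/-! ### Finite tame extensions of a complete discretely valued field -/

section Tame

variable {K : Type*} {L : Type*} [NontriviallyNormedField K] [IsUltrametricDist K]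
  [CompleteSpace K] [NormedField L] [NormedAlgebra K L] [IsUltrametricDist L]
  [FiniteDimensional K L] {A : ValuationSubring K} (hA : ∀ x, x ∈ A ↔ ‖x‖ ≤ 1)
  [Algebra A L] [IsScalarTower A K L]

include hA in
omit [IsUltrametricDist K] [CompleteSpace K] in
theorem mem_maximalIdeal_iff_norm_lt_one (a : A) :
    a ∈ IsLocalRing.maximalIdeal A ↔ ‖(a : K)‖ < 1 := by
  rw [A.valuation_lt_one_iff, lt_iff_le_not_ge, lt_iff_le_not_ge]
  have h1 : A.valuation a ≤ 1 := A.valuation_le_one a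
  have h2 : ‖(a : K)‖ ≤ 1 := (hA _).1 a.2
  simp only [h1, h2, true_and, not_iff_not]
  rcases eq_or_ne (a : K) 0 with h0 | h0
  · simp [h0]
  · rw [← inv_le_one₀ (norm_pos_iff.2 h0), ← norm_inv, ← hA, ← A.valuation_le_one_iff, map_inv₀,
      inv_le_one₀ (zero_lt_iff.2 (by simpa using h0))]

variable {t : K} (ht0 : t ≠ 0) (ht1 : ‖t‖ < 1) (hval : ∀ a : K, a ≠ 0 → ∃ m : ℤ, ‖a‖ = ‖t‖ ^ m)
  {ϖ : integralClosure A L} (h : IsUnitBall (integralClosure A L) ϖ)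

include hA in
omit [IsUltrametricDist L] [IsUltrametricDist K] [FiniteDimensional K L] [CompleteSpace K] in
theorem maximalIdeal_liesOver (h : IsUnitBall (integralClosure A L) ϖ)
    [IsLocalRing (integralClosure A L)] :
    (IsLocalRing.maximalIdeal (integralClosure A L)).LiesOver (IsLocalRing.maximalIdeal A) := by
  refine ⟨?_⟩
  ext a
  rw [Ideal.mem_comap, h.mem_maximalIdeal_iff, mem_maximalIdeal_iff_norm_lt_one hA]
  change _ ↔ ‖algebraMap A L a‖ < 1
  rw [IsScalarTower.algebraMap_apply A K L, norm_algebraMap']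
  rfl

include hA ht0 ht1 hval h in
omit [IsUltrametricDist K] [CompleteSpace K] [IsUltrametricDist L] [FiniteDimensional K L] in
-- The powers of the maximal ideal upstairs are the balls whose radii are powers of the norm of `ϖ`,
-- and t has the largest norm below 1 in `K`. So the ramification index is the exponent of the norm
-- of t.
theorem exists_ramificationIdx_eq [IsLocalRing (integralClosure A L)] :
    ∃ n : ℕ, ‖t‖ = ‖(ϖ : L)‖ ^ n ∧
      (IsLocalRing.maximalIdeal (integralClosure A L)).ramificationIdx A = n := by
  have hπ : 0 < ‖(ϖ : L)‖ := norm_pos_iff.2 h.ne_zero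
  have ht : 0 < ‖t‖ := norm_pos_iff.2 ht0
  obtain ⟨m, hm⟩ := exists_norm_eq_zpow h.ne_zero h.norm_lt_one h.norm_le
    ((map_ne_zero (algebraMap K L)).2 ht0)
  rw [norm_algebraMap'] at hm
  have hm0 : 0 ≤ m := by
    rw [hm] at ht1
    exact (zpow_lt_one_iff_right_of_lt_one₀ hπ h.norm_lt_one).1 ht1 |>.le
  lift m to ℕ using hm0
  rw [zpow_natCast] at hm
  refine ⟨m, hm, ?_⟩
  have hd := h.isDiscreteValuationRing
  have hlo := maximalIdeal_liesOver hA h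
  let tA : A := ⟨t, (hA t).2 ht1.le⟩
  have htm : tA ∈ IsLocalRing.maximalIdeal A := (mem_maximalIdeal_iff_norm_lt_one hA tA).2 ht1
  have hmem (n : ℕ) (b : integralClosure A L) :
      b ∈ IsLocalRing.maximalIdeal (integralClosure A L) ^ n ↔ ‖(b : L)‖ ≤ ‖(ϖ : L)‖ ^ n := by
    rw [h.maximalIdeal_eq, Ideal.span_singleton_pow, Ideal.mem_span_singleton,
      h.dvd_iff _ _ (by rw [Subalgebra.coe_pow]; exact pow_ne_zero _ h.ne_zero)]
    simp
  have hnorm (a : A) : ‖((algebraMap A (integralClosure A L) a : integralClosure A L) : L)‖ =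
      ‖(a : K)‖ := by
    change ‖algebraMap A L a‖ = _
    rw [IsScalarTower.algebraMap_apply A K L, norm_algebraMap']
    rfl
  have hne : (IsLocalRing.maximalIdeal A).map (algebraMap A (integralClosure A L)) ≠ ⊥ := by
    intro h0
    have h1 := Ideal.mem_map_of_mem (algebraMap A (integralClosure A L)) htm
    rw [h0, Ideal.mem_bot] at h1
    have h2 := hnorm tA
    rw [h1] at h2
    exact ht.ne ((norm_zero (E := L)).symm.trans h2)
  rw [← Ideal.ramificationIdx'_eq_ramificationIdx' (IsLocalRing.maximalIdeal A) _ hne]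
  refine Ideal.ramificationIdx'_spec ?_ ?_
  · rw [Ideal.map_le_iff_le_comap]
    intro a ha
    rw [Ideal.mem_comap, hmem, hnorm, ← hm]
    rw [mem_maximalIdeal_iff_norm_lt_one hA] at ha
    rcases eq_or_ne (a : K) 0 with h0 | h0
    · rw [h0, norm_zero]; exact ht.le
    obtain ⟨k, hk⟩ := hval _ h0
    rw [hk] at ha ⊢
    have hk0 := (zpow_lt_one_iff_right_of_lt_one₀ ht ht1).1 ha
    calc ‖t‖ ^ k ≤ ‖t‖ ^ (1 : ℤ) := zpow_le_zpow_right_of_le_one₀ ht ht1.le (by omega)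
      _ = ‖t‖ := zpow_one _
  · intro hle
    have h1 := hle (Ideal.mem_map_of_mem (algebraMap A (integralClosure A L)) htm)
    rw [hmem, hnorm] at h1
    change ‖t‖ ≤ _ at h1
    rw [hm, pow_le_pow_iff_right_of_lt_one₀ hπ h.norm_lt_one] at h1
    omega

include hA ht0 ht1 hval h in
omit [IsUltrametricDist K] [CompleteSpace K] [IsUltrametricDist L] [FiniteDimensional K L] in
-- What tameness is used for. The polynomial attached to b lifts the minimal polynomial of its
-- residue class, which is separable; for a unit b the class is nonzero, hence so is the constant
-- coefficient of that minimal polynomial.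
theorem IsFiniteTame.exists_eq (htame : IsFiniteTame A L) [IsLocalRing (integralClosure A L)] :
    (∃ n : ℕ, ‖t‖ = ‖(ϖ : L)‖ ^ n ∧ (n : IsLocalRing.ResidueField A) ≠ 0) ∧
    ∀ b : integralClosure A L, ∃ f : Polynomial A, f.Monic ∧
      (f.map (IsLocalRing.residue A)).Separable ∧
      ‖Polynomial.aeval (b : L) f‖ < 1 ∧ (‖(b : L)‖ = 1 → IsUnit (f.coeff 0)) := by
  have hlo := maximalIdeal_liesOver hA h
  obtain ⟨h1, h2⟩ := htame.2 (IsLocalRing.maximalIdeal (integralClosure A L))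
  obtain ⟨n, hn, hn'⟩ := exists_ramificationIdx_eq hA ht0 ht1 hval h
  refine ⟨⟨n, hn, hn' ▸ h2⟩, fun b => ?_⟩
  set P := IsLocalRing.maximalIdeal (integralClosure A L)
  let _ : Field (A ⧸ IsLocalRing.maximalIdeal A) :=
    inferInstanceAs (Field (IsLocalRing.ResidueField A))
  have _ : IsDomain (integralClosure A L ⧸ P) := Ideal.Quotient.isDomain P
  have hsep : IsSeparable (A ⧸ IsLocalRing.maximalIdeal A) (Ideal.Quotient.mk P b) :=
    h1.isSeparable' _
  have hint : IsIntegral (A ⧸ IsLocalRing.maximalIdeal A) (Ideal.Quotient.mk P b) :=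
    hsep.isIntegral
  have hl : minpoly (A ⧸ IsLocalRing.maximalIdeal A) (Ideal.Quotient.mk P b) ∈
      Polynomial.lifts (Ideal.Quotient.mk (IsLocalRing.maximalIdeal A)) :=
    (Polynomial.lifts_iff_coeff_lifts _).2 fun n => Ideal.Quotient.mk_surjective _
  obtain ⟨f, hf, -, hfm⟩ := Polynomial.lifts_and_natDegree_eq_and_monic hl (minpoly.monic hint)
  refine ⟨f, hfm, ?_, ?_, fun hb => ?_⟩
  · change (f.map (Ideal.Quotient.mk (IsLocalRing.maximalIdeal A))).Separable
    rw [hf]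
    exact hsep
  · have h3 : Polynomial.aeval b f ∈ P := by
      rw [← Ideal.Quotient.eq_zero_iff_mem]
      have h4 := minpoly.aeval (A ⧸ IsLocalRing.maximalIdeal A) (Ideal.Quotient.mk P b)
      rw [← hf, Polynomial.aeval_def, Polynomial.eval₂_map] at h4
      rw [← h4, Polynomial.aeval_def, Polynomial.hom_eval₂]
      rfl
    rw [h.mem_maximalIdeal_iff] at h3
    convert h3
    exact Polynomial.aeval_algebraMap_apply L b f
  · rw [← IsLocalRing.residue_ne_zero_iff_isUnit]
    have h3 : Ideal.Quotient.mk P b ≠ 0 := by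
      rw [Ne, Ideal.Quotient.eq_zero_iff_mem, h.mem_maximalIdeal_iff, hb]
      exact lt_irrefl _
    have h4 := minpoly.coeff_zero_ne_zero hint h3
    rw [← hf, Polynomial.coeff_map] at h4
    exact h4

include h in
omit [FiniteDimensional K L] [IsUltrametricDist K] [CompleteSpace K] [IsUltrametricDist L]
  [NormedAlgebra K L] [IsScalarTower A K L] in
-- Hensel's lemma: separability makes the residue class of b a simple root, so it lifts to an actual
-- root.
theorem exists_root_of_separable [CompleteSpace L] [IsLocalRing (integralClosure A L)]
    [(IsLocalRing.maximalIdeal (integralClosure A L)).LiesOver (IsLocalRing.maximalIdeal A)]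
    {f : Polynomial A} (hf : f.Monic) (hsep : (f.map (IsLocalRing.residue A)).Separable)
    {b : integralClosure A L} (hb : ‖Polynomial.aeval (b : L) f‖ < 1) :
    ∃ s : integralClosure A L, Polynomial.aeval (s : L) f = 0 ∧ ‖(b : L) - s‖ < 1 := by
  have hh := h.henselianRing
  rw [← h.maximalIdeal_eq] at hh
  have hb' : Polynomial.aeval b f ∈ IsLocalRing.maximalIdeal (integralClosure A L) := by
    rw [h.mem_maximalIdeal_iff]
    convert hb
    exact (Polynomial.aeval_algebraMap_apply L b f).symm
  set P := IsLocalRing.maximalIdeal (integralClosure A L)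
  let ψ : IsLocalRing.ResidueField A →+* integralClosure A L ⧸ P :=
    algebraMap (A ⧸ IsLocalRing.maximalIdeal A) _
  have hψ (g : Polynomial A) : (g.map (IsLocalRing.residue A)).eval₂ ψ (Ideal.Quotient.mk P b) =
      Ideal.Quotient.mk P (Polynomial.aeval b g) := by
    rw [Polynomial.aeval_def, Polynomial.hom_eval₂, Polynomial.eval₂_map]
    rfl
  have _ : Nontrivial (integralClosure A L ⧸ P) := Ideal.Quotient.nontrivial_iff.2
    (IsLocalRing.maximalIdeal.isMaximal _).ne_top
  have h1 := hsep.eval₂_derivative_ne_zero ψ (x := Ideal.Quotient.mk P b)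
    (by rw [hψ, Ideal.Quotient.eq_zero_iff_mem]; exact hb')
  rw [Polynomial.derivative_map, hψ, Ne, Ideal.Quotient.eq_zero_iff_mem,
    IsLocalRing.mem_maximalIdeal, mem_nonunits_iff, not_not] at h1
  obtain ⟨s, hs, hsb⟩ := hh.is_henselian (f.map (algebraMap A _)) (hf.map _) b
    (by rw [Polynomial.eval_map_algebraMap]; exact hb')
    (by rw [Polynomial.derivative_map, Polynomial.eval_map_algebraMap]; exact h1.map _)
  refine ⟨s, ?_, ?_⟩
  · rw [Polynomial.IsRoot, Polynomial.eval_map_algebraMap] at hs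
    have h2 := Polynomial.aeval_algebraMap_apply L s f
    rw [hs, map_zero] at h2
    exact h2
  · rw [h.mem_maximalIdeal_iff] at hsb
    rw [norm_sub_rev]
    exact hsb

include h in
omit [FiniteDimensional K L] [IsUltrametricDist K] [CompleteSpace K] [NormedAlgebra K L]
  [IsScalarTower A K L] in
theorem exists_pow_eq_of_norm_sub_one_lt [CompleteSpace L] [IsLocalRing (integralClosure A L)]
    {n : ℕ} (hn : (n : IsLocalRing.ResidueField A) ≠ 0) {w : L} (hw : ‖1 - w‖ < 1) :
    ∃ y : L, y ^ n = w ∧ ‖y‖ = 1 := by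
  have hh := h.henselianRing
  rw [← h.maximalIdeal_eq] at hh
  have hn0 : n ≠ 0 := by rintro rfl; exact hn Nat.cast_zero
  have hwB : w ∈ integralClosure A L := by
    have : 1 - (1 - w) ∈ integralClosure A L := sub_mem (one_mem _) ((h.mem_iff _).2 hw.le)
    rwa [sub_sub_cancel] at this
  have hun : IsUnit ((n : A)) := by
    rw [← IsLocalRing.residue_ne_zero_iff_isUnit, map_natCast]
    exact hn
  have hun' : IsUnit ((n : integralClosure A L)) := by
    have := hun.map (algebraMap A (integralClosure A L))
    rwa [map_natCast] at this
  obtain ⟨y, hy, hy1⟩ := hh.is_henselian (Polynomial.X ^ n - Polynomial.C ⟨w, hwB⟩)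
    (Polynomial.monic_X_pow_sub_C _ hn0) 1
    (by
      rw [Polynomial.eval_sub, Polynomial.eval_pow, Polynomial.eval_X, Polynomial.eval_C, one_pow,
        h.mem_maximalIdeal_iff]
      exact hw)
    (by
      rw [Polynomial.derivative_sub, Polynomial.derivative_C, sub_zero, Polynomial.derivative_X_pow,
        Polynomial.eval_mul, Polynomial.eval_pow, Polynomial.eval_X, one_pow, mul_one,
        Polynomial.eval_C]
      exact hun'.map _)
  refine ⟨y, ?_, ?_⟩
  · rw [Polynomial.IsRoot, Polynomial.eval_sub, Polynomial.eval_pow, Polynomial.eval_X,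
      Polynomial.eval_C, sub_eq_zero] at hy
    exact congrArg Subtype.val hy
  · rw [h.mem_maximalIdeal_iff] at hy1
    have h1 : ‖(y : L) - 1‖ < 1 := hy1
    have h2 := IsUltrametricDist.norm_add_eq_max_of_norm_ne_norm
      (x := (y : L) - 1) (y := 1) (by rw [norm_one]; exact h1.ne)
    rw [sub_add_cancel, norm_one, max_eq_right h1.le] at h2
    exact h2

include hA ht0 ht1 hval in
/-- A subextension of a finite tame extension is everything if it contains the lifts of the
separable elements of the residue field and suitable radicals of a uniformizer. -/
theorem IsFiniteTame.mem_of_radicals (htame : IsFiniteTame A L) (S : IntermediateField K L)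
    (hS : ∀ f : Polynomial A, f.Monic → (f.map (IsLocalRing.residue A)).Separable →
      ∀ s : L, Polynomial.aeval s f = 0 → s ∈ S)
    (hS' : ∀ f : Polynomial A, f.Monic → (f.map (IsLocalRing.residue A)).Separable →
      IsUnit (f.coeff 0) → ∀ s : L, Polynomial.aeval s f = 0 →
      ∀ n : ℕ, (n : IsLocalRing.ResidueField A) ≠ 0 → ∀ x : L, x ^ n * s = algebraMap K L t → x ∈ S)
    (x : L) : x ∈ S := by
  have _ : CompleteSpace L := FiniteDimensional.complete K L
  obtain ⟨ϖ, h⟩ := exists_isUnitBall (L := L) hA ht0 ht1 hval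
  have hdvr := h.isDiscreteValuationRing
  have hlo := maximalIdeal_liesOver hA h
  obtain ⟨⟨n, hn, hn0⟩, hres⟩ := htame.exists_eq hA ht0 ht1 hval h
  have hπ : 0 < ‖(ϖ : L)‖ := norm_pos_iff.2 h.ne_zero
  -- Every residue class upstairs is represented by an element of S, namely a root of a polynomial
  -- with separable reduction.
  have happ (b : L) (hb : ‖b‖ ≤ 1) : ∃ s ∈ S, ‖b - s‖ < 1 := by
    obtain ⟨f, hf, hsep, hb1, -⟩ := hres ⟨b, (h.mem_iff _).2 hb⟩
    obtain ⟨s, hs, hbs⟩ := exists_root_of_separable h hf hsep hb1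
    exact ⟨s, hS f hf hsep s hs, hbs⟩
  -- S contains a uniformizer: write t = u ϖ^n and choose a root s ∈ S with the residue class of u.
  -- Then u / s is congruent to 1 and has an n-th root y, as n is invertible, and ϖ y is a solution
  -- of x^n s = t.
  obtain ⟨π, hπS, hππ⟩ : ∃ π ∈ S, ‖π‖ = ‖(ϖ : L)‖ := by
    have htn : ‖algebraMap K L t‖ = ‖(ϖ : L)‖ ^ n := by rw [norm_algebraMap', hn]
    have hϖn : (ϖ : L) ^ n ≠ 0 := pow_ne_zero _ h.ne_zero
    have hu : ‖algebraMap K L t / (ϖ : L) ^ n‖ = 1 := by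
      rw [norm_div, htn, norm_pow, div_self (pow_ne_zero _ hπ.ne')]
    set u := algebraMap K L t / (ϖ : L) ^ n with hudef
    obtain ⟨f, hf, hsep, hb1, hf0⟩ := hres ⟨u, (h.mem_iff _).2 hu.le⟩
    obtain ⟨s, hs, hus⟩ := exists_root_of_separable h hf hsep hb1
    have hs1 : ‖(s : L)‖ = 1 := by
      have h2 := IsUltrametricDist.norm_add_eq_max_of_norm_ne_norm
        (x := (s : L) - u) (y := u) (by rw [hu, norm_sub_rev]; exact hus.ne)
      rw [sub_add_cancel, hu, norm_sub_rev, max_eq_right (le_of_lt hus)] at h2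
      exact h2
    have hs0 : (s : L) ≠ 0 := norm_pos_iff.1 (hs1 ▸ one_pos)
    obtain ⟨y, hy, hy1⟩ := exists_pow_eq_of_norm_sub_one_lt h hn0 (w := u / s) (by
      rw [← div_self hs0, ← sub_div, norm_div, hs1, div_one, norm_sub_rev]
      exact hus)
    refine ⟨ϖ * y, hS' f hf hsep (hf0 hu) s hs n hn0 _ ?_, by rw [norm_mul, hy1, mul_one]⟩
    rw [mul_pow, hy, mul_assoc, div_mul_cancel₀ _ hs0, hudef, mul_div_cancel₀ _ hϖn]
  have hπ0 : π ≠ 0 := norm_pos_iff.1 (hππ ▸ hπ)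
  -- With residue representatives and a uniformizer in S, every integral element is approximated by
  -- elements of S digit by digit.
  have happN (b : L) (hb : ‖b‖ ≤ 1) (N : ℕ) : ∃ s ∈ S, ‖b - s‖ ≤ ‖(ϖ : L)‖ ^ N := by
    induction N with
    | zero => exact ⟨0, zero_mem _, by rwa [sub_zero, pow_zero]⟩
    | succ N ih =>
      obtain ⟨s, hs, hbs⟩ := ih
      obtain ⟨r, hr, hbr⟩ := happ ((b - s) / π ^ N) (by
        rw [norm_div, norm_pow, hππ]
        exact div_le_one_of_le₀ hbs (pow_nonneg hπ.le _))
      refine ⟨s + r * π ^ N, add_mem hs (mul_mem hr (pow_mem hπS _)), ?_⟩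
      have h1 : b - (s + r * π ^ N) = ((b - s) / π ^ N - r) * π ^ N := by
        rw [sub_mul, div_mul_cancel₀ _ (pow_ne_zero _ hπ0), sub_sub]
      rw [h1, norm_mul, norm_pow, hππ, pow_succ']
      exact mul_le_mul_of_nonneg_right (h.norm_le _ hbr) (pow_nonneg hπ.le _)
  -- A subspace of a finite-dimensional space over a complete field is closed, so the approximations
  -- suffice.
  have hclosed : IsClosed (S : Set L) :=
    Submodule.closed_of_finiteDimensional (𝕜 := K) (Subalgebra.toSubmodule S.toSubalgebra)
  have hball (b : L) (hb : ‖b‖ ≤ 1) : b ∈ S := by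
    refine hclosed.closure_subset (Metric.mem_closure_iff.2 fun ε hε => ?_)
    obtain ⟨N, hN⟩ := exists_pow_lt_of_lt_one hε h.norm_lt_one
    obtain ⟨s, hs, hbs⟩ := happN b hb N
    exact ⟨s, hs, by rw [dist_eq_norm]; exact hbs.trans_lt hN⟩
  by_cases hx : ‖x‖ ≤ 1
  · exact hball x hx
  · rw [← inv_inv x]
    refine inv_mem (hball _ ?_)
    rw [norm_inv]
    exact inv_le_one_of_one_le₀ (not_le.1 hx).le

end Tame

/-! ### Roots in power series and Hahn series over a separably closed field -/

/-- A polynomial over the power series over a separably closed field with separable reduction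
splits. -/
theorem exists_powerSeries_eq_of_root {l : Type*} [Field l] [IsSepClosed l]
    {g : Polynomial (PowerSeries l)} (hg : g.Monic)
    (hsep : (g.map PowerSeries.constantCoeff).Separable) {Ω : Type*} [CommRing Ω] [IsDomain Ω]
    (φ : PowerSeries l →+* Ω) {x : Ω} (hx : g.eval₂ φ x = 0) : ∃ r, φ r = x := by
  classical
  set gb := g.map (PowerSeries.constantCoeff (R := l)) with hgb
  have hgbm : gb.Monic := hg.map _
  have hspl : gb.Splits := IsSepClosed.splits_of_separable gb hsep
  -- The reduction splits over the separably closed field, and each of its simple roots lifts to a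
  -- power series by Hensel's lemma.
  have hlift : ∀ a ∈ gb.roots.toFinset, ∃ r : PowerSeries l, g.IsRoot r ∧
      PowerSeries.constantCoeff r = a := by
    intro a ha
    rw [Multiset.mem_toFinset, Polynomial.mem_roots hgbm.ne_zero] at ha
    have hev (q : Polynomial (PowerSeries l)) : PowerSeries.constantCoeff (q.eval (PowerSeries.C a)) =
        (q.map PowerSeries.constantCoeff).eval a := by
      rw [Polynomial.eval_map, ← Polynomial.eval₂_id, Polynomial.hom_eval₂, RingHom.comp_id,
        PowerSeries.constantCoeff_C]
    obtain ⟨r, hr, hra⟩ := HenselianRing.is_henselian (I := Ideal.span {(PowerSeries.X : PowerSeries l)})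
      g hg (PowerSeries.C a)
      (by rw [Ideal.mem_span_singleton, PowerSeries.X_dvd_iff, hev]; exact ha)
      (by
        refine IsUnit.map _ ?_
        rw [PowerSeries.isUnit_iff_constantCoeff, hev, isUnit_iff_ne_zero,
          ← Polynomial.derivative_map]
        exact hsep.eval₂_derivative_ne_zero (RingHom.id l) (x := a)
          (by rw [Polynomial.eval₂_id]; exact ha))
    refine ⟨r, hr, ?_⟩
    rwa [Ideal.mem_span_singleton, PowerSeries.X_dvd_iff, map_sub, PowerSeries.constantCoeff_C,
      sub_eq_zero] at hra
  choose! r hr hrc using hlift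
  have hinj : Set.InjOn r gb.roots.toFinset := fun a ha b hb hab => by
    rw [← hrc a ha, ← hrc b hb, hab]
  have hle : (gb.roots.toFinset.image r).val ≤ g.roots := by
    rw [Multiset.le_iff_subset (Finset.nodup _)]
    intro y hy
    obtain ⟨a, ha, rfl⟩ := Finset.mem_image.1 hy
    exact (Polynomial.mem_roots hg.ne_zero).2 (hr a ha)
  -- The lifted roots are distinct and as many as the degree, so `g` has no other root in any domain
  -- containing its coefficients' images.
  have hcard : g.roots.card = g.natDegree := by
    refine le_antisymm (Polynomial.card_roots' g) ?_
    calc g.natDegree = gb.natDegree := (hg.natDegree_map _).symm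
      _ = gb.roots.card := hspl.natDegree_eq_card_roots
      _ = gb.roots.toFinset.card :=
        (Multiset.toFinset_card_of_nodup (Polynomial.nodup_roots hsep)).symm
      _ = (gb.roots.toFinset.image r).card := (Finset.card_image_of_injOn hinj).symm
      _ ≤ g.roots.card := Multiset.card_le_card hle
  have hprod := Polynomial.prod_multiset_X_sub_C_of_monic_of_roots_card_eq hg hcard
  rw [← hprod, Polynomial.eval₂_multiset_prod, Multiset.prod_eq_zero_iff, Multiset.map_map] at hx
  obtain ⟨a, -, ha⟩ := Multiset.mem_map.1 hx
  refine ⟨a, ?_⟩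
  rw [Function.comp_apply, Polynomial.eval₂_sub, Polynomial.eval₂_X, Polynomial.eval₂_C,
    sub_eq_zero] at ha
  exact ha.symm

/-! ### Series with rational exponents of denominator prime to p -/

section PIntegral

variable (p : ℕ) [Fact p.Prime]

/-- The ring of rational numbers with denominator prime to `p`. -/
def pIntegral : Subring ℚ := (PadicInt.subring p).comap (Rat.castHom ℚ_[p])

/-- Reduction modulo `p` of the rational numbers with denominator prime to `p`. -/
def pIntegralToZMod : pIntegral p →+* ZMod p :=
  PadicInt.toZMod.comp (((Rat.castHom ℚ_[p]).comp (pIntegral p).subtype).codRestrict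
    (PadicInt.subring p) fun x => x.2)

theorem inv_mem_pIntegral {n : ℕ} (hn : ¬ p ∣ n) : ((n : ℚ)⁻¹) ∈ pIntegral p := by
  change ‖(((n : ℚ)⁻¹ : ℚ) : ℚ_[p])‖ ≤ 1
  rw [Rat.cast_inv, Rat.cast_natCast, norm_inv, Padic.norm_natCast_eq_one_iff.2, inv_one]
  exact (Nat.Prime.coprime_iff_not_dvd Fact.out).2 hn

end PIntegral

section Hahn

variable {K : Type*} [Field K] {A : ValuationSubring K} (p : ℕ) [Fact p.Prime]
  {l : Type*} [Field l] [Algebra (IsLocalRing.ResidueField A) l]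

/-- The field of Hahn series with exponents prime to `p`. -/
abbrev TameHahn (l : Type*) [Field l] : Type _ := HahnSeries (pIntegral p) l

theorem exists_tameHahn_hom {c : A →+* PowerSeries (IsLocalRing.ResidueField A)}
    (hcinj : Function.Injective c) :
    ∃ g : K →+* TameHahn p l, ∀ a : A, g a = HahnSeries.ofPowerSeries (pIntegral p) l
      ((PowerSeries.map (algebraMap _ l)) (c a)) := by
  have hinj : Function.Injective ⇑((HahnSeries.ofPowerSeries (pIntegral p) l).comp
      ((PowerSeries.map (algebraMap (IsLocalRing.ResidueField A) l)).comp c)) := by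
    exact HahnSeries.ofPowerSeries_injective.comp
      ((PowerSeries.map_injective _ (algebraMap (IsLocalRing.ResidueField A) l).injective).comp hcinj)
  exact ⟨IsFractionRing.lift hinj, fun a => IsFractionRing.lift_algebraMap hinj a⟩

end Hahn

/-! ### Embedding the tame closure into Hahn series -/

section TameClosure

variable {K : Type u} [NontriviallyNormedField K] [IsUltrametricDist K] [CompleteSpace K]
  {A : ValuationSubring K} (hA : ∀ x, x ∈ A ↔ ‖x‖ ≤ 1) (p : ℕ) [Fact p.Prime]
  {l : Type w} [Field l] [CharP l p] [IsSepClosed l] [Algebra (IsLocalRing.ResidueField A) l]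
  {c : A →+* PowerSeries (IsLocalRing.ResidueField A)}
  (hc : ∀ a, PowerSeries.constantCoeff (c a) = IsLocalRing.residue A a)
  {t : A} (ht0 : t ≠ 0) (ht1 : ‖(t : K)‖ < 1)
  (hval : ∀ a : K, a ≠ 0 → ∃ m : ℤ, ‖a‖ = ‖(t : K)‖ ^ m)
  (htX : c t = PowerSeries.X) [Algebra K (TameHahn p l)]
  (halg : ∀ a : A, algebraMap K (TameHahn p l) a = HahnSeries.ofPowerSeries (pIntegral p) l
    ((PowerSeries.map (algebraMap _ l)) (c a)))

include hc halg in
omit [IsUltrametricDist K] [CompleteSpace K] [CharP l p] in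
-- Expanding the coefficients gives a polynomial over power series whose reduction is still
-- separable, so all its roots are power series. A unit constant coefficient excludes 0 as a root of
-- the reduction.
theorem exists_eq_of_aeval_eq_zero {Ω : Type*} [Field Ω] [Algebra K Ω] [Algebra (TameHahn p l) Ω]
    [IsScalarTower K (TameHahn p l) Ω] {f : Polynomial A} (hf : f.Monic)
    (hsep : (f.map (IsLocalRing.residue A)).Separable) {x : Ω}
    (hx : f.eval₂ ((algebraMap K Ω).comp (algebraMap A K)) x = 0) :
    ∃ r : PowerSeries l, algebraMap (TameHahn p l) Ω (HahnSeries.ofPowerSeries (pIntegral p) l r) = x ∧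
      (IsUnit (f.coeff 0) → PowerSeries.constantCoeff r ≠ 0) := by
  let ψ : A →+* PowerSeries l := (PowerSeries.map (algebraMap (IsLocalRing.ResidueField A) l)).comp c
  let φ : PowerSeries l →+* Ω := (algebraMap (TameHahn p l) Ω).comp
    (HahnSeries.ofPowerSeries (pIntegral p) l)
  have hφ : Function.Injective φ :=
    (algebraMap (TameHahn p l) Ω).injective.comp HahnSeries.ofPowerSeries_injective
  have hφψ : φ.comp ψ = (algebraMap K Ω).comp (algebraMap A K) := by
    ext a
    change algebraMap (TameHahn p l) Ω (HahnSeries.ofPowerSeries (pIntegral p) l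
      ((PowerSeries.map (algebraMap _ l)) (c a))) = algebraMap K Ω a
    rw [← halg, ← IsScalarTower.algebraMap_apply]
  have hψ : (PowerSeries.constantCoeff).comp ψ =
      (algebraMap (IsLocalRing.ResidueField A) l).comp (IsLocalRing.residue A) := by
    ext a
    change PowerSeries.constantCoeff (PowerSeries.map _ (c a)) = _
    rw [← PowerSeries.coeff_zero_eq_constantCoeff_apply, PowerSeries.coeff_map,
      PowerSeries.coeff_zero_eq_constantCoeff_apply, hc]
    rfl
  have hmap : (f.map ψ).map PowerSeries.constantCoeff =
      (f.map (IsLocalRing.residue A)).map (algebraMap (IsLocalRing.ResidueField A) l) := by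
    rw [Polynomial.map_map, Polynomial.map_map, hψ]
  have hx' : (f.map ψ).eval₂ φ x = 0 := by rwa [Polynomial.eval₂_map, hφψ]
  obtain ⟨r, rfl⟩ := exists_powerSeries_eq_of_root (hf.map ψ)
    (by rw [hmap]; exact hsep.map) φ hx'
  refine ⟨r, rfl, fun hu h0 => ?_⟩
  rw [Polynomial.eval₂_at_apply, ← map_zero φ] at hx'
  have h1 := congrArg PowerSeries.constantCoeff (hφ hx')
  rw [map_zero, ← Polynomial.eval₂_at_apply, h0, ← Polynomial.eval_map, hmap,
    ← Polynomial.coeff_zero_eq_eval_zero, Polynomial.coeff_map, Polynomial.coeff_map,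
    map_eq_zero] at h1
  exact (IsLocalRing.residue_ne_zero_iff_isUnit _).2 hu h1

include ht0 htX halg in
omit [IsUltrametricDist K] [CompleteSpace K] in
-- The exponent 1 / n is allowed because n is prime to p, so t has the n-th root τ among the series.
-- Then τ / x is an n-th root of the unit `r`, and X^n - r has separable reduction, so this root is
-- a power series.
theorem exists_eq_of_pow_mul_eq {Ω : Type*} [Field Ω] [Algebra K Ω] [Algebra (TameHahn p l) Ω]
    [IsScalarTower K (TameHahn p l) Ω] {r : PowerSeries l} (hr : PowerSeries.constantCoeff r ≠ 0)
    {n : ℕ} (hn : (n : l) ≠ 0) {x : Ω} (hx : x ^ n * algebraMap (TameHahn p l) Ω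
      (HahnSeries.ofPowerSeries (pIntegral p) l r) = algebraMap K Ω t) :
    ∃ y, algebraMap (TameHahn p l) Ω y = x := by
  let φ : PowerSeries l →+* Ω := (algebraMap (TameHahn p l) Ω).comp
    (HahnSeries.ofPowerSeries (pIntegral p) l)
  have hn0 : n ≠ 0 := by rintro rfl; exact hn Nat.cast_zero
  have hpn : ¬ p ∣ n := fun h => hn ((CharP.cast_eq_zero_iff l p n).2 h)
  let γ : pIntegral p := ⟨(n : ℚ)⁻¹, inv_mem_pIntegral p hpn⟩
  have hγ : n • γ = 1 := by
    refine Subtype.ext ?_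
    change n • (n : ℚ)⁻¹ = 1
    rw [nsmul_eq_mul, mul_inv_cancel₀ (Nat.cast_ne_zero.2 hn0)]
  let τ : TameHahn p l := HahnSeries.single γ 1
  have hτ : τ ^ n = algebraMap K (TameHahn p l) t := by
    rw [halg, htX, PowerSeries.map_X, HahnSeries.ofPowerSeries_X, HahnSeries.single_pow, one_pow, hγ]
  have ht0' : algebraMap K Ω t ≠ 0 := (map_ne_zero _).2 fun h => ht0 (Subtype.ext h)
  have hx0 : x ≠ 0 := by
    rintro rfl
    rw [zero_pow hn0, zero_mul] at hx
    exact ht0' hx.symm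
  have hy : ((Polynomial.X ^ n - Polynomial.C r : Polynomial (PowerSeries l))).eval₂ φ
      (algebraMap (TameHahn p l) Ω τ / x) = 0 := by
    rw [Polynomial.eval₂_sub, Polynomial.eval₂_pow, Polynomial.eval₂_X, Polynomial.eval₂_C, div_pow,
      ← map_pow, hτ, ← IsScalarTower.algebraMap_apply, ← hx, mul_div_cancel_left₀ _ (pow_ne_zero _ hx0)]
    exact sub_self _
  obtain ⟨s, hs⟩ := exists_powerSeries_eq_of_root (Polynomial.monic_X_pow_sub_C r hn0) (by
    rw [Polynomial.map_sub, Polynomial.map_pow, Polynomial.map_X, Polynomial.map_C]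
    exact Polynomial.separable_X_pow_sub_C _ hn hr) φ hy
  refine ⟨τ / HahnSeries.ofPowerSeries (pIntegral p) l s, ?_⟩
  rw [map_div₀]
  change _ / φ s = x
  rw [hs, div_div_cancel₀]
  rw [Ne, map_eq_zero]
  exact HahnSeries.single_ne_zero one_ne_zero

include hA hc ht0 ht1 hval htX halg in
/-- The maximal tamely ramified extension embeds into a field of Hahn series. -/
theorem exists_tameClosure_hom : Nonempty (tameClosure A →ₐ[K] TameHahn p l) := by
  let Ω := AlgebraicClosure (TameHahn p l)
  let j : AlgebraicClosure K →ₐ[K] Ω := IsAlgClosed.lift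
  -- Inside an algebraic closure of the field of series it suffices that each finite tame extension
  -- lands in the field of series itself. For this only the generators of
  -- `IsFiniteTame.mem_of_radicals` have to be checked.
  let R : IntermediateField K Ω := (IsScalarTower.toAlgHom K (TameHahn p l) Ω).fieldRange
  have hle : tameClosure A ≤ R.comap j := by
    refine sSup_le fun L hL => ?_
    have _ : FiniteDimensional K L := hL.1
    intro x hx
    let _ : NormedField L := spectralNorm.normedField K L
    let _ : NormedAlgebra K L := spectralNorm.normedAlgebra K L
    have _ : IsUltrametricDist L := IsUltrametricDist.isUltrametricDist_of_isNonarchimedean_norm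
      (isNonarchimedean_spectralNorm (K := K) (L := L))
    have haeval (f : Polynomial A) (s : L) (hs : Polynomial.aeval s f = 0) :
        f.eval₂ ((algebraMap K Ω).comp (algebraMap A K)) (j.comp L.val s) = 0 := by
      have h1 := congrArg (j.comp L.val) hs
      rw [map_zero, Polynomial.aeval_def] at h1
      rw [← h1]
      refine Eq.trans ?_ (Polynomial.hom_eval₂ f (algebraMap A L) (j.comp L.val : L →+* Ω) s).symm
      congr 1
      ext a
      exact ((j.comp L.val).commutes (a : K)).symm
    have h := IsFiniteTame.mem_of_radicals (L := L) hA (t := (t : K))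
      (fun h => ht0 (Subtype.ext h)) ht1 hval hL (R.comap (j.comp L.val)) ?_ ?_ ⟨x, hx⟩
    · exact h
    · intro f hf hsep s hs
      obtain ⟨r, hr, -⟩ := exists_eq_of_aeval_eq_zero p hc halg hf hsep (haeval f s hs)
      exact ⟨_, hr⟩
    · intro f hf hsep hu s hs n hn y hy
      obtain ⟨r, hr, hr0⟩ := exists_eq_of_aeval_eq_zero p hc halg hf hsep (haeval f s hs)
      have hn' : (n : l) ≠ 0 := by
        rw [← map_natCast (algebraMap (IsLocalRing.ResidueField A) l)]
        exact (map_ne_zero _).2 hn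
      obtain ⟨z, hz⟩ := exists_eq_of_pow_mul_eq p ht0 htX halg (hr0 hu) hn'
        (x := j.comp L.val y) (by
          rw [hr, ← map_pow]
          change (j.comp L.val) (y ^ n) * (j.comp L.val) s = _
          rw [← map_mul, hy, AlgHom.commutes])
      exact ⟨z, hz⟩
  let e : TameHahn p l ≃ₐ[K] R :=
    AlgEquiv.ofInjectiveField (IsScalarTower.toAlgHom K (TameHahn p l) Ω)
  exact ⟨(e.symm : R →ₐ[K] TameHahn p l).comp
    ((j.comp (tameClosure A).val).codRestrict R.toSubalgebra fun x => hle x.2)⟩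

end TameClosure

/-! ### The completion and the expansion of its tame closure -/

section Completion

variable {F : Type u} [Field F] (v : Valuation F ℤᵐ⁰)

/-- The valuation of the completion. -/
abbrev completionVal : Valuation v.Completion ℤᵐ⁰ := Valued.v

theorem completionVal_toCompletion (a : F) : completionVal v (toCompletion v a) = v a :=
  Valued.valuedCompletion_apply ((WithVal.equiv v).symm a)

instance {p : ℕ} [CharP F p] : CharP v.Completion p :=
  (RingHom.charP_iff (toCompletion v) (toCompletion v).injective p).1 inferInstance

/-- The map of valuation rings from a discretely valued field to its completion. -/
def toCompletionInt : v.valuationSubring →+* completionInt v :=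
  ((toCompletion v).comp v.valuationSubring.subtype).codRestrict _ fun a => by
    change completionVal v (toCompletion v a) ≤ 1
    rw [completionVal_toCompletion]
    exact a.2

instance : IsLocalHom (toCompletionInt v) := by
  refine (IsLocalRing.local_hom_TFAE (toCompletionInt v)).out 0 4 |>.2 ?_
  ext a
  rw [Ideal.mem_comap, mem_maximalIdeal_iff, mem_maximalIdeal_iff]
  change completionVal v (toCompletion v a) < 1 ↔ _
  rw [completionVal_toCompletion]

variable {v} {t : Fˣ} (ht : v t = WithZero.exp (-1 : ℤ))

include ht in
theorem completionVal_uniformizer :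
    completionVal v (Units.map (toCompletion v : F →* v.Completion) t) = WithZero.exp (-1 : ℤ) :=
  (completionVal_toCompletion v t).trans ht

include ht in
/-- The valuation of the completion has rank one. -/
@[reducible]
def completionRankOne : (completionVal v).RankOne where
  hom' := (WithZeroMulInt.toNNReal (e := 2) two_ne_zero).comp
    MonoidWithZeroHom.ValueGroup₀.embedding
  strictMono' := (WithZeroMulInt.toNNReal_strictMono one_lt_two).comp
    MonoidWithZeroHom.ValueGroup₀.embedding_strictMono
  exists_val_nontrivial := ⟨_, by
    rw [completionVal_uniformizer ht]
    exact WithZero.coe_ne_zero, by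
    rw [completionVal_uniformizer ht, ← WithZero.exp_zero, Ne, WithZero.exp_inj]
    norm_num⟩

include ht in
-- By density an integral element of the completion is at distance less than 1 from an element of
-- the field, which is then integral with the same residue class.
theorem residueField_map_surjective :
    Function.Surjective (IsLocalRing.ResidueField.map (toCompletionInt v)) := by
  intro x
  obtain ⟨a, rfl⟩ := IsLocalRing.residue_surjective x
  let _ := completionRankOne ht
  let _ : NormedField v.Completion := Valued.toNormedField v.Completion ℤᵐ⁰
  obtain ⟨b, hb⟩ := (UniformSpace.Completion.denseRange_coe (α := WithVal v)).exists_dist_lt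
    (a : v.Completion) one_pos
  rw [dist_eq_norm, Valued.toNormedField.norm_lt_one_iff] at hb
  have hb1 : v (WithVal.equiv v b) ≤ 1 := by
    have h1 : completionVal v (b : v.Completion) ≤ 1 := by
      have h2 := (completionVal v).map_sub a ((a : v.Completion) - b)
      rw [sub_sub_cancel] at h2
      exact h2.trans (max_le a.2 hb.le)
    exact (Valued.valuedCompletion_apply b).symm.trans_le h1
  refine ⟨IsLocalRing.residue _ ⟨WithVal.equiv v b, hb1⟩, ?_⟩
  rw [IsLocalRing.ResidueField.map_residue, eq_comm, ← sub_eq_zero, ← map_sub,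
    IsLocalRing.residue_eq_zero_iff, mem_maximalIdeal_iff]
  exact hb

variable (p : ℕ) [Fact p.Prime] [CharP F p]

include ht in
-- The expansion of the completed valuation ring makes the series an algebra over the completion.
-- The norm attached to the valuation, which has rank one, brings the results on normed fields to
-- bear, and integral elements expand without negative exponents.
theorem exists_tameHahn_of_isSepClosed {l : Type w} [Field l] [CharP l p] [IsSepClosed l]
    [Algebra (ResField (completionVal v)) l] :
    ∃ g : tameClosure (completionInt v) →+* TameHahn p l,
    g (algebraMap v.Completion _ (toCompletion v t)) = HahnSeries.single 1 1 ∧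
    (∀ a : v.valuationSubring, (g (algebraMap v.Completion _ (toCompletion v a))).coeff 0 =
      algebraMap (ResField (completionVal v)) l (IsLocalRing.residue _ (toCompletionInt v a))) ∧
    ∀ a : v.valuationSubring, ∀ γ < 0,
      (g (algebraMap v.Completion _ (toCompletion v a))).coeff γ = 0 := by
  have htK := completionVal_uniformizer ht
  obtain ⟨c, hcinj, hc, hcX⟩ := exists_injective_expansion p htK
  obtain ⟨g₀, hg₀⟩ := exists_tameHahn_hom p (l := l) hcinj
  let _ : Algebra v.Completion (TameHahn p l) := g₀.toAlgebra
  let _ := completionRankOne ht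
  let _ : NontriviallyNormedField v.Completion := Valued.toNontriviallyNormedField v.Completion ℤᵐ⁰
  have ht1 : ‖(intUniformizer htK : v.Completion)‖ < 1 := by
    refine Valued.toNormedField.norm_lt_one_iff.2 (htK.trans_lt ?_)
    rw [← WithZero.exp_zero, WithZero.exp_lt_exp]
    norm_num
  have hA (x : v.Completion) : x ∈ completionInt v ↔ ‖x‖ ≤ 1 :=
    (Valued.toNormedField.norm_le_one_iff (x := x)).symm
  have hval (a : v.Completion) (ha : a ≠ 0) :
      ∃ m : ℤ, ‖a‖ = ‖(intUniformizer htK : v.Completion)‖ ^ m := by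
    have ha0 : completionVal v a ≠ 0 := (Valuation.ne_zero_iff _).2 ha
    refine ⟨-WithZero.log (completionVal v a), ?_⟩
    have h1 := val_uniformizer_zpow htK (-WithZero.log (completionVal v a))
    rw [neg_neg, WithZero.exp_log ha0, Units.val_zpow_eq_zpow_val] at h1
    rw [← norm_zpow]
    exact le_antisymm (Valued.toNormedField.norm_le_iff.2 h1.ge)
      (Valued.toNormedField.norm_le_iff.2 h1.le)
  obtain ⟨g⟩ := exists_tameClosure_hom (K := v.Completion) (A := completionInt v)
    hA p (l := l) hc
    (intUniformizer_ne_zero htK) ht1 hval hcX hg₀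
  have hga (a : v.valuationSubring) : g (algebraMap v.Completion _ (toCompletion v a)) =
      HahnSeries.ofPowerSeries (pIntegral p) l
        ((PowerSeries.map (algebraMap (ResField (completionVal v)) l)) (c (toCompletionInt v a))) := by
    rw [AlgHom.commutes]
    exact hg₀ (toCompletionInt v a)
  refine ⟨g, ?_, fun a => ?_, fun a γ hγ => ?_⟩
  · have h1 := hga (intUniformizer ht)
    refine h1.trans ?_
    have h2 : toCompletionInt v (intUniformizer ht) = intUniformizer htK := rfl
    rw [h2, hcX, PowerSeries.map_X, HahnSeries.ofPowerSeries_X]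
  · change (g (algebraMap v.Completion _ (toCompletion v a))).coeff 0 = _
    rw [hga]
    have := HahnSeries.ofPowerSeries_apply_coeff (Γ := pIntegral p)
      ((PowerSeries.map (algebraMap (ResField (completionVal v)) l)) (c (toCompletionInt v a))) 0
    rw [Nat.cast_zero, PowerSeries.coeff_map, PowerSeries.coeff_zero_eq_constantCoeff_apply, hc] at this
    exact this
  · change (g (algebraMap v.Completion _ (toCompletion v a))).coeff γ = 0
    rw [hga]
    refine HahnSeries.embDomain_of_notMem_range ?_
    rintro ⟨n, hn⟩
    have : ((n : ℕ) : pIntegral p) = γ := hn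
    exact (Nat.cast_nonneg n).not_gt (this ▸ hγ)

theorem exists_isSepClosed_extension (κ : Type u) [Field κ] : ∃ (l : Type u) (_ : Field l)
    (_ : Algebra κ l), IsSepClosed l ∧ Algebra.IsSeparable κ l :=
  ⟨SeparableClosure κ, inferInstance, inferInstance, inferInstance, inferInstance⟩

include ht in
/-- The maximal tamely ramified extension of the completion maps to a field of Hahn series over a
separable extension of the residue field. -/
theorem exists_tameHahn : ∃ (l : Type u) (_ : Field l) (_ : CharP l p) (_ : Algebra (ResField v) l)
    (_ : Algebra.IsSeparable (ResField v) l)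
    (g : tameClosure (completionInt v) →+* TameHahn p l),
    g (algebraMap v.Completion _ (toCompletion v t)) = HahnSeries.single 1 1 ∧
    (∀ a : v.valuationSubring, (g (algebraMap v.Completion _ (toCompletion v a))).coeff 0 =
      algebraMap (ResField v) l (IsLocalRing.residue _ a)) ∧
    ∀ a : v.valuationSubring, ∀ γ < 0,
      (g (algebraMap v.Completion _ (toCompletion v a))).coeff γ = 0 := by
  have hsurj := residueField_map_surjective ht
  obtain ⟨l, _, _, _, hs⟩ := exists_isSepClosed_extension (ResField (completionVal v))
  have _ : CharP (ResField (completionVal v)) p := charP_residueField _ p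
  have _ : CharP l p := (RingHom.charP_iff (algebraMap (ResField (completionVal v)) l)
    (algebraMap (ResField (completionVal v)) l).injective p).1 inferInstance
  obtain ⟨g, hg⟩ := exists_tameHahn_of_isSepClosed ht p (l := l)
  let _ : Algebra (ResField v) (ResField (completionVal v)) :=
    (IsLocalRing.ResidueField.map (toCompletionInt v)).toAlgebra
  let _ : Algebra (ResField v) l := ((algebraMap (ResField (completionVal v)) l).comp
    (IsLocalRing.ResidueField.map (toCompletionInt v))).toAlgebra
  have _ : IsScalarTower (ResField v) (ResField (completionVal v)) l := .of_algebraMap_eq fun _ => rfl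
  have hsep : Algebra.IsSeparable (ResField v) (ResField (completionVal v)) := ⟨fun x => by
    obtain ⟨y, rfl⟩ := hsurj x
    exact isSeparable_algebraMap y⟩
  have hsep' : Algebra.IsSeparable (ResField v) l :=
    Algebra.IsSeparable.trans (ResField v) (ResField (completionVal v)) l
  exact ⟨l, inferInstance, inferInstance, inferInstance, hsep', g, hg⟩

end Completion

open scoped TensorProduct in
/-- Forms inject along separable algebraic extensions. -/
theorem formMap_injective_of_isSeparable {k : Type u} {l : Type w} [Field k] [Field l] [Algebra k l]
    [Algebra.IsSeparable k l] : Function.Injective (formMap k l) := by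
  -- A separable algebraic extension is formally étale, so base change carries a basis of
  -- differentials to a basis.
  have : Algebra.FormallyEtale k l := Algebra.FormallyEtale.of_isSeparable k l
  let β := Module.Basis.ofVectorSpace k Ω[k⁄ℤ]
  refine injective_of_basis (algebraMap k l) (formMap k l).toRingHom (formMap_algebraMap k l) β
    ((β.baseChange l).map (KaehlerDifferential.tensorKaehlerEquivOfFormallyEtale ℤ k l)) fun i => ?_
  refine (formMap_ι k l _).trans ?_
  rw [Module.Basis.map_apply, Module.Basis.baseChange_apply]
  simp

/-! ### Functoriality of the cohomology groups -/

section MapH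

variable (p : ℕ) {A B C : Type*} [CommRing A] [CommRing B] [CommRing C]

theorem mapH_mk (f : A →+* B) (n : ℤ) (x : Forms A n) :
    mapH p f n (QuotientAddGroup.mk x) =
      letI := f.toAlgebra
      QuotientAddGroup.mk (formMapDeg A B n x) := rfl

theorem mapH_mk_eq_zero_iff (f : A →+* B) (n : ℤ) (x : Forms A n) :
    mapH p f n (QuotientAddGroup.mk x) = 0 ↔
      letI := f.toAlgebra
      formMap A B (x : DiffAlg A) ∈ relTotal B p := by
  rw [mapH_mk]
  exact (QuotientAddGroup.eq_zero_iff _).trans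
    ⟨fun h => coe_mem_relTotal p h, fun h => mem_relations p _ h⟩

theorem mapH_mapH (f : A →+* B) (g : B →+* C) (n : ℤ) (x : H A p n) :
    mapH p g n (mapH p f n x) = mapH p (g.comp f) n x := by
  obtain ⟨x, rfl⟩ := QuotientAddGroup.mk_surjective x
  let _ := f.toAlgebra
  let _ := g.toAlgebra
  let _ := (g.comp f).toAlgebra
  have _ : IsScalarTower A B C := .of_algebraMap_eq fun _ => rfl
  exact congrArg QuotientAddGroup.mk (Subtype.ext (formMap_formMap A B C (x : DiffAlg A)))

theorem mapH_symb (f : A →+* B) {n : ℤ} {m : ℕ} (hm : (m : ℤ) = n) (a : A) (b : Fin m → Aˣ) :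
    mapH p f n (symb p hm a b) = symb p hm (f a) (fun i => Units.map (f : A →* B) (b i)) := by
  let _ := f.toAlgebra
  exact congrArg QuotientAddGroup.mk (Subtype.ext (formMap_logForm B hm a b))

theorem symb_pow_sub_self {n : ℤ} {m : ℕ} (hm : (m : ℤ) = n) (a : A) (b : Fin m → Aˣ) :
    symb p hm (a ^ p - a) b = 0 :=
  (QuotientAddGroup.eq_zero_iff _).2 (AddSubgroup.subset_closure (Or.inr ⟨m, hm, a, b, rfl⟩))

end MapH

/-! ### Tame classes have no poles -/

section TameLe

variable {F : Type u} [Field F] {v : Valuation F ℤᵐ⁰} {t : Fˣ} (ht : v t = WithZero.exp (-1 : ℤ))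
  (p : ℕ) [Fact p.Prime] [CharP F p]

omit [Fact p.Prime] [CharP F p] in
theorem mapH_eq_zero_of_mem_tame {n : ℤ} {x : H F p n} (hx : x ∈ tame p v n) {C : Type*}
    [CommRing C] (g : tameClosure (completionInt v) →+* C) :
    mapH p (g.comp ((algebraMap v.Completion _).comp (toCompletion v))) n x = 0 := by
  have h1 : mapH p (algebraMap v.Completion (tameClosure (completionInt v))) n
    (mapH p (toCompletion v) n x) = 0 := hx
  refine (mapH_mapH p _ g n x).symm.trans ?_
  refine Eq.trans (congrArg (mapH p g n) ?_) (map_zero (mapH p g n))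
  exact (mapH_mapH p _ _ n x).symm.trans h1

include ht in
-- A tame class vanishes over the field of Hahn series, which determines the leading form of a
-- representative after extension to `l`. As `l` is separable over the residue field, forms inject
-- and the conclusion descends: the reductions are closed, or zero if the pole order is prime to p.
-- In both cases the class has a smaller pole.
theorem mem_U_of_mem_tame {n : ℤ} {i : ℕ} {x : H F p n} (hx : x ∈ tame p v n)
    (hi : x ∈ U p v n (i + 1)) : x ∈ U p v n i := by
  obtain ⟨l, _, _, _, _, g, hgt, h0, hneg⟩ := exists_tameHahn ht p
  -- The exponents act on t through their reduction modulo p, which is defined because their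
  -- denominators are prime to p; its values are fixed by the Frobenius.
  let f : F →+* TameHahn p l := g.comp ((algebraMap v.Completion _).comp (toCompletion v))
  let _ : Algebra F (TameHahn p l) := f.toAlgebra
  let χ : pIntegral p →+ l := ((ZMod.castHom dvd_rfl l).comp (pIntegralToZMod p)).toAddMonoidHom
  have hχ (a : pIntegral p) : χ a ^ p = χ a := by
    change (ZMod.castHom dvd_rfl l (pIntegralToZMod p a)) ^ p = _
    rw [← map_pow, ZMod.pow_card]
    rfl
  have hχ1 : χ 1 = 1 := map_one ((ZMod.castHom dvd_rfl l).comp (pIntegralToZMod p))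
  have hker : mapH p f n x = 0 := mapH_eq_zero_of_mem_tame p hx g
  have hinj := formMap_injective_of_isSeparable (k := ResField v) (l := l)
  have hclosed {z : DiffAlg (ResField v)} (hz : extD l (formMap (ResField v) l z) = 0) :
      extD (ResField v) z = 0 := by
    rw [extD_formMap] at hz
    exact hinj (hz.trans (map_zero _).symm)
  by_cases hpi : p ∣ i + 1
  · obtain ⟨z, rfl⟩ := exists_mk_polarDeg_eq p ht hi
    have h1 := (mapH_mk_eq_zero_iff p f n _).1 hker
    have h2 := (lead_of_formMap_mem_relTotal (l := l) p χ hχ one_pos hχ1 hgt h0 hneg (i + 1)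
      (z.1 : DiffAlg v.valuationSubring) (z.2 : DiffAlg v.valuationSubring) h1).2.1
      (Nat.succ_pos i) hpi
    exact mk_mem_U p _ (polar_mem_sup_of_extD_eq_zero p ht hpi (hclosed h2.1) (hclosed h2.2))
  · obtain ⟨z, rfl⟩ := exists_mk_polarDeg_eq_of_not_dvd p ht hpi hi
    have h1 := (mapH_mk_eq_zero_iff p f n _).1 hker
    have h2 := (lead_of_formMap_mem_relTotal (l := l) p χ hχ one_pos hχ1 hgt h0 hneg (i + 1)
      (z : DiffAlg v.valuationSubring) 0 h1).2.2
      (Nat.succ_pos i) hpi (by rw [map_zero, map_zero])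
    exact mk_mem_U p _ (AddSubgroup.mem_sup_right (polar_mem_poleForms_of_formMap_eq_zero i ht
      (hinj (h2.trans (map_zero _).symm)) (map_zero _)))

include ht in
theorem tame_le_U_zero (n : ℤ) : tame p v n ≤ U p v n 0 := by
  intro x hx
  obtain ⟨i, hi⟩ := exists_mem_U (v := v) p n x
  induction i with
  | zero => exact hi
  | succ i ih => exact ih (mem_U_of_mem_tame ht p hx hi)

end TameLe

/-! ### Artin–Schreier extensions -/

theorem derivation_pow_eq_zero {R A M : Type*} [CommRing R] [CommRing A] [Algebra R A]
    [AddCommGroup M] [Module A M] [Module R M] (D : Derivation R A M) {p : ℕ}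
    (hp : (p : A) = 0) (a : A) : D (a ^ p) = 0 := by
  rw [Derivation.leibniz_pow, ← Nat.cast_smul_eq_nsmul A, hp, zero_smul]

section ArtinSchreier

open Polynomial

variable {K : Type*} {L : Type*} [Field K] [Field L] [Algebra K L] {O : ValuationSubring K} [Algebra O L]
  [IsScalarTower O K L] (p : ℕ) [Fact p.Prime] [CharP K p] {a : O}

omit [Fact p.Prime] in
theorem artinSchreier_separable (a : K) : (X ^ p - X - C a : K[X]).Separable := by
  have : derivative (X ^ p - X - C a : K[X]) = -1 := by
    rw [derivative_sub, derivative_sub, derivative_X_pow, derivative_X, derivative_C,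
      CharP.cast_eq_zero, C_0, zero_mul, zero_sub, sub_zero]
  rw [separable_def, this]
  exact isCoprime_one_right.neg_right

variable {x : L} (hx : x ^ p - x = algebraMap O L a)

include hx

omit [CharP K p] [Algebra K L] [IsScalarTower O K L] in
theorem isIntegral_of_artinSchreier : IsIntegral O x := by
  have hp : 1 < p := (Fact.out : p.Prime).one_lt
  refine ⟨X ^ p - (X + C a), monic_X_pow_sub ?_, ?_⟩
  · rw [degree_X_add_C]
    exact_mod_cast hp
  · rw [eval₂_sub, eval₂_pow, eval₂_X, eval₂_add, eval₂_X, eval₂_C, ← hx]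
    ring

omit [Fact p.Prime] in
theorem isSeparable_of_artinSchreier : IsSeparable K x := by
  refine (artinSchreier_separable p (a : K)).of_dvd (minpoly.dvd K x ?_)
  rw [map_sub, map_sub, map_pow, aeval_X, aeval_C, hx, IsScalarTower.algebraMap_apply O K L]
  exact sub_self _

/-- The ring of integers of an Artin–Schreier extension of an integral element. -/
theorem mem_adjoin_of_artinSchreier [Algebra.IsSeparable K L] [FiniteDimensional K L]
    (pb : PowerBasis K L) (hgen : pb.gen = x) {z : L} (hz : IsIntegral O z) :
    z ∈ Algebra.adjoin O {x} := by
  have hxi := isIntegral_of_artinSchreier p hx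
  have : Module.IsTorsionFree O L := .trans_faithfulSMul O K L
  subst hgen
  have hg : aeval pb.gen (X ^ p - X - C a : O[X]) = 0 := by
    rw [map_sub, map_sub, map_pow, aeval_X, aeval_C, hx, sub_self]
  obtain ⟨q, hq⟩ := minpoly.isIntegrallyClosed_dvd hxi hg
  have hcast : ((p : ℕ) : O) = 0 := Subtype.ext (CharP.cast_eq_zero K p)
  -- The polynomial X^p - X - a has derivative -1. Differentiating its factorization by the minimal
  -- polynomial at x shows that the derivative of the minimal polynomial at x is a unit.
  have hder : aeval pb.gen (derivative (minpoly O pb.gen)) * aeval pb.gen q = -1 := by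
    have h1 := congrArg (fun g => aeval pb.gen (derivative g)) hq
    simp only [derivative_X_pow, derivative_X, derivative_C, derivative_mul, hcast,
      map_add, map_mul, map_sub, map_zero, zero_mul, minpoly.aeval, add_zero, zero_sub,
      sub_zero] at h1
    rw [← h1, map_neg, map_one]
  have hmin : minpoly K pb.gen = (minpoly O pb.gen).map (algebraMap O K) :=
    minpoly.isIntegrallyClosed_eq_field_fractions K L hxi
  have hd := Algebra.discr_powerBasis_eq_norm K pb
  rw [hmin, derivative_map, aeval_map_algebraMap] at hd
  set N1 := Algebra.norm K (aeval pb.gen (derivative (minpoly O pb.gen)))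
  set N2 := Algebra.norm K (aeval pb.gen q) with hN2
  have hNN : N1 * N2 = Algebra.norm K (-1 : L) := by rw [← map_mul, hder]
  have hN1 : Algebra.norm K (-1 : L) * Algebra.norm K (-1 : L) = 1 := by
    rw [← map_mul, neg_one_mul, neg_neg, map_one]
  have hint2 : IsIntegral O (aeval pb.gen q) := IsIntegral.of_mem_of_fg _ (hxi.fg_adjoin_singleton) _
    (aeval_mem_adjoin_singleton _ _)
  have hNint : IsIntegral O N2 := Algebra.isIntegral_norm K hint2
  set e : K := (-1) ^ (Module.finrank K L * (Module.finrank K L - 1) / 2) with he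
  have hee : e * e = 1 := by rw [he, ← mul_pow, neg_one_mul, neg_neg, one_pow]
  -- Up to sign the discriminant is the norm of that derivative, so its inverse is integral and lies
  -- in O. Since the discriminant multiplies integral elements into O[x], all integral elements are
  -- in O[x].
  have hinv : (e * N2 * Algebra.norm K (-1 : L)) * Algebra.discr K pb.basis = 1 := by
    rw [hd]
    calc _ = (e * e) * (N1 * N2) * Algebra.norm K (-1 : L) := by ring
      _ = 1 := by rw [hee, hNN, one_mul, hN1]
  have hint3 : IsIntegral O (e * N2 * Algebra.norm K (-1 : L)) := by
    refine ((IsIntegral.pow (isIntegral_one.neg) _).mul hNint).mul ?_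
    exact Algebra.isIntegral_norm K isIntegral_one.neg
  obtain ⟨r, hr⟩ := IsIntegrallyClosed.isIntegral_iff.1 hint3
  have h1 := Algebra.discr_mul_isIntegral_mem_adjoin K hxi hz
  have h2 := Subalgebra.smul_mem _ h1 r
  rwa [← algebraMap_smul K r, smul_smul, hr, hinv, one_smul] at h2

theorem adjoin_eq_top_of_artinSchreier [Algebra.IsSeparable K L] [FiniteDimensional K L]
    (pb : PowerBasis K L) (hgen : pb.gen = x) :
    Algebra.adjoin O {(⟨x, isIntegral_of_artinSchreier p hx⟩ : integralClosure O L)} = ⊤ := by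
  refine eq_top_iff.2 fun z _ => ?_
  have h1 := mem_adjoin_of_artinSchreier p hx pb hgen z.2
  have h2 : Algebra.adjoin O {x} = (Algebra.adjoin O
      {(⟨x, isIntegral_of_artinSchreier p hx⟩ : integralClosure O L)}).map
      (integralClosure O L).val := by
    rw [AlgHom.map_adjoin, Set.image_singleton]
    rfl
  rw [h2] at h1
  obtain ⟨y, hy, hyz⟩ := h1
  exact (Subtype.ext hyz : y = z) ▸ hy

/-- The integral closure is generated by a root y, and y = y^p - a has differential zero in
characteristic p. -/
theorem formallyUnramified_of_artinSchreier [Algebra.IsSeparable K L] [FiniteDimensional K L]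
    (pb : PowerBasis K L) (hgen : pb.gen = x) :
    Algebra.FormallyUnramified O (integralClosure O L) := by
  set B := integralClosure O L
  set y : B := ⟨x, isIntegral_of_artinSchreier p hx⟩
  have hy : y ^ p - y = algebraMap O B a := Subtype.ext hx
  have hcast : ((p : ℕ) : B) = 0 := by
    have hO : ((p : ℕ) : O) = 0 := Subtype.ext (CharP.cast_eq_zero K p)
    rw [← map_natCast (algebraMap O B), hO, map_zero]
  have hD : KaehlerDifferential.D O B y = 0 := by
    have h1 := congrArg (KaehlerDifferential.D O B) hy
    rw [map_sub, derivation_pow_eq_zero _ hcast, Derivation.map_algebraMap, zero_sub,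
      neg_eq_zero] at h1
    exact h1
  have h0 : KaehlerDifferential.D O B = 0 :=
    Derivation.ext_of_adjoin_eq_top _ (adjoin_eq_top_of_artinSchreier p hx pb hgen)
      fun z hz => by rw [Set.mem_singleton_iff.1 hz, hD, Derivation.zero_apply]
  refine ⟨(subsingleton_iff_forall_eq 0).2 fun w => ?_⟩
  have hw : w ∈ Submodule.span B (Set.range (KaehlerDifferential.D O B)) := by
    rw [KaehlerDifferential.span_range_derivation]
    trivial
  refine (Submodule.mem_bot B).1 (Submodule.span_le.2 ?_ hw)
  rintro _ ⟨z, rfl⟩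
  rw [h0]
  rfl

/-- The integral closure is unramified over O: its residue extensions are separable and the
ramification index is 1. -/
theorem isFiniteTame_of_artinSchreier [Algebra.IsSeparable K L] [FiniteDimensional K L]
    (pb : PowerBasis K L) (hgen : pb.gen = x) : IsFiniteTame O L := by
  refine ⟨inferInstance, fun P _ _ => ?_⟩
  have : Algebra.FormallyUnramified O (integralClosure O L) :=
    formallyUnramified_of_artinSchreier p hx pb hgen
  have : Algebra.FiniteType O (integralClosure O L) :=
    ⟨⟨{_}, by rw [Finset.coe_singleton]; exact adjoin_eq_top_of_artinSchreier p hx pb hgen⟩⟩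
  let _ : Field (O ⧸ IsLocalRing.maximalIdeal O) :=
    inferInstanceAs (Field (IsLocalRing.ResidueField O))
  let _ : Field (integralClosure O L ⧸ P) := Ideal.Quotient.field P
  constructor
  · have : Algebra.FormallyUnramified O (integralClosure O L ⧸ P) :=
      .comp _ (integralClosure O L) _
    have : Algebra.EssFiniteType O (integralClosure O L ⧸ P) := .comp _ (integralClosure O L) _
    have : Algebra.FormallyUnramified (O ⧸ IsLocalRing.maximalIdeal O)
      (integralClosure O L ⧸ P) := .of_restrictScalars O _ _
    have : Algebra.EssFiniteType (O ⧸ IsLocalRing.maximalIdeal O)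
      (integralClosure O L ⧸ P) := .of_comp O _ _
    exact Algebra.FormallyUnramified.isSeparable _ _
  · rw [P.ramificationIdx_eq_one O, Nat.cast_one]
    exact one_ne_zero

end ArtinSchreier

/-! ### Classes without poles are tame -/

section UZero

theorem exists_artinSchreier_mem_tameClosure {K : Type*} [Field K] (O : ValuationSubring K)
    (p : ℕ) [Fact p.Prime] [CharP K p] (a : O) :
    ∃ c : tameClosure O, c ^ p - c = algebraMap K (tameClosure O) a := by
  obtain ⟨c, hc⟩ := IsAlgClosed.exists_root
    ((Polynomial.X ^ p - Polynomial.X - Polynomial.C (a : K)).map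
      (algebraMap K (AlgebraicClosure K))) (by
        rw [Polynomial.degree_map, sub_sub, Polynomial.degree_sub_eq_left_of_degree_lt,
          Polynomial.degree_X_pow]
        · exact_mod_cast (Fact.out : p.Prime).ne_zero
        · rw [Polynomial.degree_X_add_C, Polynomial.degree_X_pow]
          exact_mod_cast (Fact.out : p.Prime).one_lt)
  have hc' : c ^ p - c = algebraMap K (AlgebraicClosure K) a := by
    simpa [sub_eq_zero] using hc
  have hsep : IsSeparable K c := isSeparable_of_artinSchreier (O := O) p (a := a) hc'
  have hint : IsIntegral K c := hsep.isIntegral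
  have : Algebra.IsSeparable K (IntermediateField.adjoin K {c}) :=
    (IntermediateField.isSeparable_adjoin_simple_iff_isSeparable _ _).2 hsep
  have : FiniteDimensional K (IntermediateField.adjoin K {c}) :=
    IntermediateField.adjoin.finiteDimensional hint
  have htame : IsFiniteTame O (IntermediateField.adjoin K {c}) :=
    isFiniteTame_of_artinSchreier p (a := a) (x := IntermediateField.AdjoinSimple.gen K c)
      (Subtype.ext hc') (IntermediateField.adjoin.powerBasis hint)
      (IntermediateField.adjoin.powerBasis_gen hint)
  have hle : IntermediateField.adjoin K {c} ≤ tameClosure O := le_sSup htame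
  exact ⟨⟨c, hle (IntermediateField.mem_adjoin_simple_self K c)⟩, Subtype.ext hc'⟩

variable {F : Type*} [Field F] (p : ℕ) [Fact p.Prime] [CharP F p] (v : Valuation F ℤᵐ⁰)

/-- An integral f has the form c^p - c in the tame closure of the completion, so a symbol with first
entry f becomes one of the defining relations. -/
theorem U_zero_le_tame (n : ℤ) : U p v n 0 ≤ tame p v n := by
  refine (AddSubgroup.closure_le _).2 ?_
  rintro _ ⟨m, hm, f, g, hf, rfl⟩
  have hmem : toCompletion v f ∈ completionInt v := by
    refine (Valuation.mem_valuationSubring_iff _ _).2 ?_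
    refine (completionVal_toCompletion v f).trans_le (hf.trans_eq ?_)
    rw [Nat.cast_zero, WithZero.exp_zero]
  obtain ⟨c, hc⟩ := exists_artinSchreier_mem_tameClosure (completionInt v) p ⟨_, hmem⟩
  have h1 : mapH p (toCompletion v) n (symb p hm f g) = _ := mapH_symb p _ hm f g
  change mapH p (algebraMap v.Completion (tameClosure (completionInt v))) n
    (mapH p (toCompletion v) n (symb p hm f g)) = 0
  refine (congrArg _ h1).trans ((mapH_symb p _ hm _ _).trans ?_)
  refine (congrArg (fun a => symb p hm a _) hc.symm).trans ?_
  exact symb_pow_sub_self p hm c _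

theorem U_zero_eq_tame {t : Fˣ} (ht : v t = WithZero.exp (-1 : ℤ)) (n : ℤ) :
    U p v n 0 = tame p v n :=
  le_antisymm (U_zero_le_tame p v n) (tame_le_U_zero ht p n)

end UZero

end ModPCohomology

end

/-! ### The theorem -/

theorem mainTheorem3 {F : Type*} [Field F] (p : ℕ) [Fact p.Prime] [CharP F p]
    (v : Valuation F ℤᵐ⁰) (hv : Function.Surjective v) (n : ℕ) :
    -- the subgroups `U i` form an increasing sequence with union `H^{n+1,n}(F)`
    Monotone (U p v n) ∧
    (∀ x : H F p n, ∃ i : ℕ, x ∈ U p v n i) ∧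
    -- the graded pieces, for a choice of uniformizer `t`
    (∀ (t : Fˣ), v t = WithZero.exp (-1 : ℤ) → ∀ i : ℕ, 0 < i →
      (¬ p ∣ i →
        ∃ φ : Forms (ResField v) n ≃+ Gr p v n i,
          ∀ (a : v.valuationSubring) (b : Fin n → v.valuationSubringˣ),
            ∃ h : symb p rfl ((a : F) / (t : F) ^ i)
                (fun l => toF (b l)) ∈ U p v n i,
              φ (logForm rfl (IsLocalRing.residue v.valuationSubring a)
                (fun l => toRes (b l))) = QuotientAddGroup.mk ⟨_, h⟩) ∧
      (p ∣ i →
        ∃ φ : ((Forms (ResField v) n ⧸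
              closedForms (ResField v) n) ×
            (Forms (ResField v) (n - 1) ⧸
              closedForms (ResField v) (n - 1))) ≃+
            Gr p v n i,
          (∀ (a : v.valuationSubring) (b : Fin n → v.valuationSubringˣ),
            ∃ h : symb p rfl ((a : F) / (t : F) ^ i)
                (fun l => toF (b l)) ∈ U p v n i,
              φ (QuotientAddGroup.mk (logForm rfl
                  (IsLocalRing.residue v.valuationSubring a)
                  (fun l => toRes (b l))), 0) = QuotientAddGroup.mk ⟨_, h⟩) ∧
          (∀ (m : ℕ) (hm : m + 1 = n) (a : v.valuationSubring)
            (b : Fin m → v.valuationSubringˣ),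
            ∃ h : symb p (cast_succ hm) ((a : F) / (t : F) ^ i)
                (Fin.cons t (fun l => toF (b l)) : Fin (m + 1) → Fˣ) ∈
                  U p v n i,
              φ (0, QuotientAddGroup.mk (logForm (cast_pred hm)
                  (IsLocalRing.residue v.valuationSubring a)
                  (fun l => toRes (b l)))) = QuotientAddGroup.mk ⟨_, h⟩))) ∧
    -- `U 0` is the tame subgroup, and the unramified subgroup is contained in it
    U p v n 0 = tame p v n ∧
    unramified p v n ≤ tame p v n ∧
    -- the residue homomorphism is well defined, surjective, with the unramified group as kernel
    (∃ res : tame p v n →+ H (ResField v) p (n - 1),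
      IsResidue p v n res ∧
      (∀ res' : tame p v n →+
          H (ResField v) p (n - 1),
        IsResidue p v n res' → res' = res) ∧
      Function.Surjective res ∧
      res.ker = (unramified p v n).addSubgroupOf (tame p v n)) ∧
    -- the henselian case
    (HenselianLocalRing v.valuationSubring →
      ∃ φ : H (ResField v) p n ≃+ unramified p v n,
        ∀ (a : v.valuationSubring) (b : Fin n → v.valuationSubringˣ),
          ∃ h : symb p rfl (a : F) (fun l => toF (b l)) ∈
              unramified p v n,
            φ (symb p rfl (IsLocalRing.residue v.valuationSubring a)
              (fun l => toRes (b l))) = ⟨_, h⟩) := by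
  -- Surjectivity of the valuation enters only through the existence of a uniformizer.
  obtain ⟨f, hf⟩ := hv (WithZero.exp (-1 : ℤ))
  have hf0 : f ≠ 0 := by
    rintro rfl
    rw [map_zero] at hf
    exact WithZero.coe_ne_zero hf.symm
  have hU : U p v n 0 = tame p v n := U_zero_eq_tame p v (t := Units.mk0 f hf0) hf n
  refine ⟨U_mono p n, exists_mem_U p n, fun t ht i hi => ⟨fun hpi => ?_, fun hpi => ?_⟩, hU,
    hU ▸ unramified_le_U p n, ?_, fun h => ?_⟩
  · exact exists_gr_equiv_of_not_dvd p ht hi hpi n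
  · exact exists_gr_equiv_of_dvd p ht hi hpi n
  · exact exists_isResidue p (t := Units.mk0 f hf0) hf hU
  · exact exists_unramified_equiv p (t := Units.mk0 f hf0) hf n
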